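/- Let $\mathcal K$ be a field of characteristic $p>2$, let $q\in\mathcal K$ and $n\ge 2$. Let $\mathcal O$ be the restricted divided power algebra with basis $x^{(\alpha)}$, $0\le\alpha\le\tau=(p-1,\dots,p-1)$, $\alpha=(\alpha_{-n},\dots,\alpha_n)\in\mathbb Z^{2n+1}$, product $x^{(\alpha)}x^{(\beta)}=\binom{\alpha+\beta}{\alpha}x^{(\alpha+\beta)}$, and the convention $x^{(\alpha)}=0$ unless $0\le\alpha\le\tau$. Let $\epsilon_j$ be the unit vectors, and let $D_j$ be the derivation of $\mathcal O$ with $D_jx^{(\alpha)}=x^{(\alpha-\epsilon_j)}$. For $0\le\alpha\le\tau$ put $$\mathcal D_K(x^{(\alpha)})=\Big(2-\sum_{i=1}^n(\alpha_i+\alpha_{-i})\Big)x^{(\alpha)}D_0+\sum_{i=1}^n x^{(\alpha-\epsilon_0)}\big(x^{(\epsilon_i)}D_i+x^{(\epsilon_{-i})}D_{-i}\big)+\sum_{i=1}^n\big(x^{(\alpha-\epsilon_{-i})}D_i-x^{(\alpha-\epsilon_i)}D_{-i}\big),$$ extend $\mathcal D_K$ linearly, and let $\mathbf K=\mathbf K(2n+1;\underline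 1)$ be the derived algebra of the Lie algebra $\mathcal D_K(\mathcal O)$ of derivations of $\mathcal O$. Let $\mathbf u(\mathbf K)$ be the quotient of the universal enveloping algebra $U(\mathbf K)$ by the two-sided ideal generated by $\mathcal D_K(x^{(\alpha)})^p-\mathcal D_K(x^{(\alpha)})$ for $\alpha=\epsilon_0$ and $\alpha=\epsilon_i+\epsilon_{-i}$ $(1\le i\le n)$, and by $\mathcal D_K(x^{(\alpha)})^p$ for all other $0\le\alpha\le\tau$ with $\mathcal D_K(x^{(\alpha)})\in\mathbf K$. Let $\mathcal K[t]_p^{(q)}=\mathcal K[t]/(t^p-qt)$ and $\mathbf u_{t,q}(\mathbf K)=\mathbf u(\mathbf K)\otimes_{\mathcal K}\mathcal K[t]_p^{(q)}$. Fix integers $1\le k\le n$ and $m$ with $1\le|m|\le n$ and $|m|\ne k$. Then $h:=\mathcal D_K(x^{(\epsilon_k+\epsilon_{-k})})$ and $e:=\mathcal D_K(x^{(\epsilon_k+\epsilon_m)})$ lie in $\mathbf K$, the element $1-et$ is invertible in $\mathbf u_{t,q}(\mathbf K)$, and there is a noncommutative and noncocommutative Hopf algebra structure on $\mathbf u_{t,q}(\mathbf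 K)$ over $\mathcal K[t]_p^{(q)}$, with the algebra structure undeformed, such that $$\Delta(\mathcal D_K(x^{(\alpha)}))=\mathcal D_K(x^{(\alpha)})\otimes(1-et)^{\alpha_k-\alpha_{-k}}+\sum_{\ell=0}^{p-1}(-1)^\ell h^{\langle\ell\rangle}\otimes(1-et)^{-\ell}\,d^{(\ell)}(\mathcal D_K(x^{(\alpha)}))\,t^\ell,$$ $$S(\mathcal D_K(x^{(\alpha)}))=-(1-et)^{\alpha_{-k}-\alpha_k}\sum_{\ell=0}^{p-1}d^{(\ell)}(\mathcal D_K(x^{(\alpha)}))\,h_1^{\langle\ell\rangle}\,t^\ell,\qquad \varepsilon(\mathcal D_K(x^{(\alpha)}))=0$$ for all $0\le\alpha\le\tau$ if $2n+4\not\equiv0\pmod p$, and for all $0\le\alpha\le\tau$ with $\alpha\ne\tau$ if $2n+4\equiv0\pmod p$ (in particular these $\mathcal D_K(x^{(\alpha)})$ lie in $\mathbf K$). Here $d^{(\ell)}=\frac1{\ell!}(\operatorname{ad}e)^\ell$, $h_a^{\langle\ell\rangle}=(h+a)(h+a+1)\cdots(h+a+\ell-1)$ and $h^{\langle\ell\rangle}=h_0^{\langle\ell\rangle}$.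 Moreover $\mathbf u_{t,q}(\mathbf K)$ is finite-dimensional over $\mathcal K$, of dimension $p^{p^{2n+1}+1}$ if $2n+4\not\equiv0\pmod p$, and $p^{p^{2n+1}}$ if $2n+4\equiv0\pmod p$. -/

import Mathlib

open scoped TensorProduct

/-! ### Indices and multi-indices -/

/-- The `2n+1` indices `-n, …, -1, 0, 1, …, n`: `none` is the index `0`, and for `i : Fin n`
`some (Sum.inl i)` is the positive index `i+1` and `some (Sum.inr i)` the negative index `-(i+1)`. -/
abbrev Idx (n : ℕ) : Type := Option (Fin n ⊕ Fin n)

/-- The index `0`. -/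
abbrev zer {n : ℕ} : Idx n := none

/-- The positive index attached to `i`. -/
abbrev pos {n : ℕ} (i : Fin n) : Idx n := some (Sum.inl i)

/-- The negative index attached to `i`. -/
abbrev neg {n : ℕ} (i : Fin n) : Idx n := some (Sum.inr i)

/-- The unit multi-index `ε_j`. -/
def eps {n : ℕ} (j : Idx n) : Idx n → ℤ := Pi.single j 1

/-- `0 ≤ α ≤ τ`, where `τ = (p-1, …, p-1)`. -/
def InBox {n : ℕ} (p : ℕ) (α : Idx n → ℤ) : Prop := ∀ i, 0 ≤ α i ∧ α i < p

/-! ### The restricted divided power algebra -/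

/-- The space with basis the divided powers `x^(α)`, `0 ≤ α ≤ τ`. -/
def DivPow (𝒦 : Type*) [Field 𝒦] (p n : ℕ) : Type _ := (Idx n → Fin p) →₀ 𝒦

namespace DivPow

variable {𝒦 : Type*} [Field 𝒦] {p n : ℕ}

noncomputable instance : AddCommGroup (DivPow 𝒦 p n) :=
  inferInstanceAs (AddCommGroup ((Idx n → Fin p) →₀ 𝒦))

noncomputable instance : Module 𝒦 (DivPow 𝒦 p n) :=
  inferInstanceAs (Module 𝒦 ((Idx n → Fin p) →₀ 𝒦))

/-- A multi-index in the box, as an integer multi-index. -/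
def toZ (a : Idx n → Fin p) : Idx n → ℤ := fun i => ((a i : ℕ) : ℤ)

lemma inBox_toZ (a : Idx n → Fin p) : InBox p (toZ a) := fun i =>
  ⟨by simp [toZ], by simp [toZ]⟩

/-- The basis vector with index `a`. -/
noncomputable def basisVec (a : Idx n → Fin p) : DivPow 𝒦 p n :=
  (Finsupp.single a 1 : (Idx n → Fin p) →₀ 𝒦)

open Classical in
/-- The divided power `x^(α)`, with the convention `x^(α) = 0` unless `0 ≤ α ≤ τ`. -/
noncomputable def dp (α : Idx n → ℤ) : DivPow 𝒦 p n :=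
  if h : InBox p α then
    basisVec fun i => ⟨(α i).toNat, by have := h i; omega⟩
  else 0

lemma dp_toZ (a : Idx n → Fin p) :
    (dp (toZ a) : DivPow 𝒦 p n) = basisVec a := by
  rw [dp, dif_pos (inBox_toZ a)]
  rfl

lemma dp_eq_zero {α : Idx n → ℤ} (h : ¬ InBox p α) : (dp α : DivPow 𝒦 p n) = 0 := by
  rw [dp, dif_neg h]

lemma exists_toZ {α : Idx n → ℤ} (h : InBox p α) : ∃ a : Idx n → Fin p, toZ a = α := by
  refine ⟨fun i => ⟨(α i).toNat, by have := h i; omega⟩, ?_⟩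
  funext i
  have := (h i).1
  simp [toZ, this]

/-- The linear map with prescribed values on the basis `x^(α)`, `0 ≤ α ≤ τ`. -/
noncomputable def lift {M : Type*} [AddCommGroup M] [Module 𝒦 M] (v : (Idx n → ℤ) → M) :
    DivPow 𝒦 p n →ₗ[𝒦] M :=
  Finsupp.linearCombination 𝒦 (fun a : Idx n → Fin p => v (toZ a))

lemma lift_dp {M : Type*} [AddCommGroup M] [Module 𝒦 M] (v : (Idx n → ℤ) → M)
    {α : Idx n → ℤ} (h : InBox p α) : lift (𝒦 := 𝒦) (p := p) v (dp α) = v α := by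
  obtain ⟨a, rfl⟩ := exists_toZ h
  rw [dp_toZ]
  exact (Finsupp.linearCombination_single 𝒦 1 a).trans (one_smul _ _)

lemma hom_ext {M : Type*} [AddCommGroup M] [Module 𝒦 M] {f g : DivPow 𝒦 p n →ₗ[𝒦] M}
    (h : ∀ α : Idx n → ℤ, InBox p α → f (dp α) = g (dp α)) : f = g := by
  refine Finsupp.lhom_ext' fun a => LinearMap.ext_ring ?_
  have := h _ (inBox_toZ a)
  rw [dp_toZ] at this
  exact this

/-- The multi-index binomial coefficient `(α+β choose α)`. -/
def binom (α β : Idx n → ℤ) : ℕ := ∏ i, ((α i).toNat + (β i).toNat).choose (α i).toNat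

/-- The product `x^(α) x^(β) = (α+β choose α) x^(α+β)`. -/
noncomputable def mulMap : DivPow 𝒦 p n →ₗ[𝒦] DivPow 𝒦 p n →ₗ[𝒦] DivPow 𝒦 p n :=
  lift fun α => lift fun β => (binom α β : 𝒦) • dp (α + β)

noncomputable instance : Mul (DivPow 𝒦 p n) := ⟨fun f g => mulMap f g⟩

lemma mul_def (f g : DivPow 𝒦 p n) : f * g = mulMap f g := rfl

lemma dp_mul_dp {α β : Idx n → ℤ} (hα : ∀ i, 0 ≤ α i) (hβ : ∀ i, 0 ≤ β i) :
    (dp α * dp β : DivPow 𝒦 p n) = (binom α β : 𝒦) • dp (α + β) := by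
  by_cases h1 : InBox p α
  · by_cases h2 : InBox p β
    · rw [mul_def, mulMap, lift_dp _ h1, lift_dp _ h2]
    · have h3 : ¬ InBox p (α + β) := fun h => h2 fun i => ⟨hβ i, by
        have := (h i).2; have := hα i; simp only [Pi.add_apply] at *; omega⟩
      rw [dp_eq_zero h2, dp_eq_zero h3, mul_def, map_zero, smul_zero]
  · have h3 : ¬ InBox p (α + β) := fun h => h1 fun i => ⟨hα i, by
      have := (h i).2; have := hβ i; simp only [Pi.add_apply] at *; omega⟩
    rw [dp_eq_zero h1, dp_eq_zero h3, mul_def, map_zero, LinearMap.zero_apply, smul_zero]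

lemma binom_comm (α β : Idx n → ℤ) : binom α β = binom β α := by
  refine Finset.prod_congr rfl fun i _ => ?_
  rw [Nat.add_comm ((β i).toNat)]
  exact Nat.choose_symm_add

lemma binom_assoc {α β γ : Idx n → ℤ} (hα : ∀ i, 0 ≤ α i) (hβ : ∀ i, 0 ≤ β i)
    (hγ : ∀ i, 0 ≤ γ i) :
    binom α β * binom (α + β) γ = binom β γ * binom α (β + γ) := by
  simp only [binom, ← Finset.prod_mul_distrib]
  refine Finset.prod_congr rfl fun i _ => ?_
  simp only [Pi.add_apply, Int.toNat_add (hα i) (hβ i), Int.toNat_add (hβ i) (hγ i)]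
  generalize (α i).toNat = a
  generalize (β i).toNat = b
  generalize (γ i).toNat = c
  have h := Nat.choose_mul (n := a + b + c) (k := a + b) (s := a) (by omega)
  rw [show a + b + c - a = b + c by omega, show a + b - a = b by omega] at h
  rw [← Nat.add_assoc, Nat.mul_comm, h, Nat.mul_comm]

noncomputable instance [Fact p.Prime] : One (DivPow 𝒦 p n) := ⟨dp 0⟩

lemma one_def [Fact p.Prime] : (1 : DivPow 𝒦 p n) = dp 0 := rfl

lemma mul_comm' (f g : DivPow 𝒦 p n) : f * g = g * f := by
  have : (mulMap : DivPow 𝒦 p n →ₗ[𝒦] DivPow 𝒦 p n →ₗ[𝒦] DivPow 𝒦 p n) = mulMap.flip := by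
    refine hom_ext fun α hα => hom_ext fun β hβ => ?_
    rw [LinearMap.flip_apply, ← mul_def, ← mul_def, dp_mul_dp (fun i => (hα i).1) fun i => (hβ i).1,
      dp_mul_dp (fun i => (hβ i).1) fun i => (hα i).1, binom_comm, add_comm]
  exact congrArg (fun T => T f g) this

lemma mul_assoc' (f g h : DivPow 𝒦 p n) : f * g * h = f * (g * h) := by
  let F : DivPow 𝒦 p n →ₗ[𝒦] DivPow 𝒦 p n →ₗ[𝒦] DivPow 𝒦 p n →ₗ[𝒦] DivPow 𝒦 p n :=
    mulMap.compr₂ mulMap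
  let G : DivPow 𝒦 p n →ₗ[𝒦] DivPow 𝒦 p n →ₗ[𝒦] DivPow 𝒦 p n →ₗ[𝒦] DivPow 𝒦 p n :=
    ((LinearMap.llcomp 𝒦 _ _ _).flip.comp mulMap).flip.comp mulMap
  have : F = G := by
    refine hom_ext fun α hα => hom_ext fun β hβ => hom_ext fun γ hγ => ?_
    have h1 := fun i => (hα i).1
    have h2 := fun i => (hβ i).1
    have h3 := fun i => (hγ i).1
    change dp α * dp β * dp γ = dp α * (dp β * dp γ)
    rw [dp_mul_dp h1 h2, dp_mul_dp h2 h3, mul_def, mul_def, map_smul, map_smul,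
      LinearMap.smul_apply, ← mul_def, ← mul_def,
      dp_mul_dp (α := α + β) (fun i => add_nonneg (h1 i) (h2 i)) h3,
      dp_mul_dp (β := β + γ) h1 (fun i => add_nonneg (h2 i) (h3 i)), smul_smul, smul_smul, ← Nat.cast_mul,
      ← Nat.cast_mul, binom_assoc h1 h2 h3, add_assoc]
  exact congrArg (fun T => T f g h) this

lemma one_mul' [Fact p.Prime] (f : DivPow 𝒦 p n) : 1 * f = f := by
  have : (mulMap 1 : DivPow 𝒦 p n →ₗ[𝒦] _) = LinearMap.id := by
    refine hom_ext fun α hα => ?_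
    rw [← mul_def, one_def, dp_mul_dp (α := 0) (fun _ => le_rfl) fun i => (hα i).1]
    simp [binom]
  exact congrArg (fun T => T f) this

noncomputable instance [Fact p.Prime] : CommRing (DivPow 𝒦 p n) where
  __ := (inferInstance : AddCommGroup (DivPow 𝒦 p n))
  zero_mul f := by rw [mul_def, map_zero, LinearMap.zero_apply]
  mul_zero f := by rw [mul_def, map_zero]
  left_distrib f g h := by simp only [mul_def, map_add]
  right_distrib f g h := by simp only [mul_def, map_add, LinearMap.add_apply]
  mul_assoc := mul_assoc'
  mul_comm := mul_comm'
  one_mul := one_mul'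
  mul_one f := by rw [mul_comm', one_mul']

noncomputable instance [Fact p.Prime] : Algebra 𝒦 (DivPow 𝒦 p n) :=
  Algebra.ofModule
    (fun c f g => by rw [mul_def, map_smul, LinearMap.smul_apply, ← mul_def])
    (fun c f g => by rw [mul_def, map_smul, ← mul_def])

/-- `D_j` as a linear map: `D_j x^(α) = x^(α-ε_j)`. -/
noncomputable def partialLin (j : Idx n) : DivPow 𝒦 p n →ₗ[𝒦] DivPow 𝒦 p n :=
  lift fun α => dp (α - eps j)

lemma partialLin_dp (j : Idx n) {α : Idx n → ℤ} (h : InBox p α) :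
    partialLin j (dp α : DivPow 𝒦 p n) = dp (α - eps j) := lift_dp _ h

/-- The factors of the multi-index binomial coefficient away from the index `j`. -/
def binomOff (j : Idx n) (α β : Idx n → ℤ) : ℕ :=
  ∏ i ∈ Finset.univ.erase j, ((α i).toNat + (β i).toNat).choose (α i).toNat

lemma binom_split (j : Idx n) (α β : Idx n → ℤ) :
    binom α β = ((α j).toNat + (β j).toNat).choose (α j).toNat * binomOff j α β :=
  (Finset.mul_prod_erase _ _ (Finset.mem_univ j)).symm

lemma eps_self (j : Idx n) : eps j j = 1 := by simp [eps]

lemma eps_ne {i j : Idx n} (h : i ≠ j) : eps j i = 0 := by simp [eps, h]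

lemma binomOff_sub_left (j : Idx n) (α β : Idx n → ℤ) :
    binomOff j (α - eps j) β = binomOff j α β :=
  Finset.prod_congr rfl fun i hi => by simp [eps_ne (Finset.ne_of_mem_erase hi)]

lemma binomOff_sub_right (j : Idx n) (α β : Idx n → ℤ) :
    binomOff j α (β - eps j) = binomOff j α β :=
  Finset.prod_congr rfl fun i hi => by simp [eps_ne (Finset.ne_of_mem_erase hi)]

lemma sub_eps_nonneg {j : Idx n} {α : Idx n → ℤ} (h : ∀ i, 0 ≤ α i) (hj : 1 ≤ α j) :
    ∀ i, 0 ≤ (α - eps j) i := fun i => by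
  by_cases hi : i = j
  · subst hi; simp [eps_self, hj]
  · simp [eps_ne hi, h i]

lemma dp_sub_eps_eq_zero {j : Idx n} {α : Idx n → ℤ} (hj : α j = 0) :
    (dp (α - eps j) : DivPow 𝒦 p n) = 0 :=
  dp_eq_zero fun h => by
    have := (h j).1
    simp [eps_self, hj] at this

lemma dp_mul_sub {j : Idx n} {α β : Idx n → ℤ} (hα : InBox p α) (hβ : InBox p β) :
    (dp α * dp (β - eps j) : DivPow 𝒦 p n) =
      ((if 1 ≤ β j then ((α j).toNat + (β j).toNat - 1).choose (α j).toNat * binomOff j α β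
        else 0 : ℕ) : 𝒦) • dp (α + β - eps j) := by
  split_ifs with h
  · rw [dp_mul_dp (fun i => (hα i).1) (sub_eps_nonneg (fun i => (hβ i).1) h), binom_split j,
      binomOff_sub_right, add_sub_assoc]
    congr 4
    simp only [Pi.sub_apply, eps_self]
    omega
  · have : β j = 0 := by have := (hβ j).1; omega
    rw [dp_sub_eps_eq_zero this, mul_def, map_zero, Nat.cast_zero, zero_smul]

lemma partialLin_mul_dp [Fact p.Prime] [CharP 𝒦 p] (j : Idx n) {α β : Idx n → ℤ}
    (hα : InBox p α) (hβ : InBox p β) :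
    partialLin j (dp α * dp β : DivPow 𝒦 p n) =
      dp α * partialLin j (dp β) + dp β * partialLin j (dp α) := by
  have h1 := fun i => (hα i).1
  have h2 := fun i => (hβ i).1
  have hα' := hα j
  have hβ' := hβ j
  rw [partialLin_dp j hα, partialLin_dp j hβ, dp_mul_sub hα hβ, dp_mul_sub hβ hα, add_comm β α,
    ← add_smul, dp_mul_dp h1 h2, map_smul, ← Nat.cast_add]
  have hoff : binomOff j β α = binomOff j α β := by
    refine Finset.prod_congr rfl fun i _ => ?_
    rw [Nat.add_comm ((β i).toNat)]
    exact Nat.choose_symm_add.symm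
  have hL : (binom α β : 𝒦) • partialLin j (dp (α + β) : DivPow 𝒦 p n) =
      (binom α β : 𝒦) • dp (α + β - eps j) := by
    by_cases hb : InBox p (α + β)
    · rw [partialLin_dp j hb]
    · rw [dp_eq_zero hb, map_zero, smul_zero]
      by_cases hc : InBox p (α + β - eps j)
      · have hj : α j + β j = p := by
          by_contra hne
          refine hb fun i => ⟨add_nonneg (h1 i) (h2 i), ?_⟩
          have := (hc i).2
          by_cases hi : i = j
          · subst hi
            simp only [Pi.sub_apply, Pi.add_apply, eps_self] at *
            omega
          · simpa [eps_ne hi] using this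
        have hd : p ∣ binom α β := by
          rw [binom_split j]
          refine Dvd.dvd.mul_right ?_ _
          rw [show (α j).toNat + (β j).toNat = p by omega]
          exact (Fact.out : p.Prime).dvd_choose_self (by omega) (by omega)
        rw [(CharP.cast_eq_zero_iff 𝒦 p _).2 hd, zero_smul]
      · rw [dp_eq_zero hc, smul_zero]
  rw [hL, binom_split j, hoff]
  obtain ⟨a, ha⟩ := Int.eq_ofNat_of_zero_le hα'.1
  obtain ⟨b, hb⟩ := Int.eq_ofNat_of_zero_le hβ'.1
  rw [ha, hb]
  simp only [Int.toNat_natCast]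
  rcases a with _ | a
  · rcases b with _ | b
    · rw [dp_sub_eps_eq_zero (by simp [ha, hb]), smul_zero, smul_zero]
    · simp
  · rcases b with _ | b
    · simp
    · rw [if_pos (by push_cast; omega), if_pos (by push_cast; omega), ← Nat.add_mul]
      congr 3
      rw [show a + 1 + (b + 1) - 1 = a + b + 1 by omega, show b + 1 + (a + 1) - 1 = a + b + 1 by omega,
        show a + 1 + (b + 1) = (a + b + 1) + 1 by omega, Nat.choose_succ_succ, Nat.add_comm]
      congr 1
      rw [show a + b + 1 = (b + 1) + a by omega]
      exact Nat.choose_symm_add.symm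

/-- The special derivation `D_j`, with `D_j x^(α) = x^(α-ε_j)`. -/
noncomputable def D [Fact p.Prime] [CharP 𝒦 p] (j : Idx n) :
    Derivation 𝒦 (DivPow 𝒦 p n) (DivPow 𝒦 p n) :=
  Derivation.mk' (partialLin j) fun f g => by
    let F : DivPow 𝒦 p n →ₗ[𝒦] DivPow 𝒦 p n →ₗ[𝒦] DivPow 𝒦 p n :=
      mulMap.compr₂ (partialLin j)
    let G : DivPow 𝒦 p n →ₗ[𝒦] DivPow 𝒦 p n →ₗ[𝒦] DivPow 𝒦 p n :=
      mulMap.compl₂ (partialLin j) + (mulMap.compl₂ (partialLin j)).flip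
    have : F = G := hom_ext fun α hα => hom_ext fun β hβ => partialLin_mul_dp j hα hβ
    exact congrArg (fun T => T f g) this

lemma D_dp [Fact p.Prime] [CharP 𝒦 p] (j : Idx n) {α : Idx n → ℤ} (h : InBox p α) :
    D j (dp α : DivPow 𝒦 p n) = dp (α - eps j) := partialLin_dp j h

/-- The generator `x_j = x^(ε_j)`. -/
noncomputable def X (j : Idx n) : DivPow 𝒦 p n := dp (eps j)

lemma inBox_eps [Fact p.Prime] (j : Idx n) : InBox p (eps j) := fun i => by
  have := (Fact.out : p.Prime).two_le
  by_cases h : i = j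
  · subst h; rw [eps_self]; omega
  · rw [eps_ne h]; omega

lemma D_X [Fact p.Prime] [CharP 𝒦 p] (i j : Idx n) :
    D i (X j : DivPow 𝒦 p n) = if i = j then 1 else 0 := by
  rw [X, D_dp i (inBox_eps j)]
  split_ifs with h
  · rw [h, sub_self, one_def]
  · exact dp_sub_eps_eq_zero (eps_ne h)

lemma D_comm [Fact p.Prime] [CharP 𝒦 p] (i j : Idx n) (f : DivPow 𝒦 p n) :
    D i (D j f) = D j (D i f) := by
  have key : ∀ (i j : Idx n) (α : Idx n → ℤ), InBox p α →
      partialLin i (dp (α - eps j) : DivPow 𝒦 p n) = dp (α - eps j - eps i) := by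
    intro i j α hα
    by_cases h : 1 ≤ α j
    · refine partialLin_dp i fun l => ⟨sub_eps_nonneg (fun l => (hα l).1) h l, ?_⟩
      have := (hα l).2
      by_cases hl : l = j
      · subst hl; simp only [Pi.sub_apply, eps_self]; omega
      · simpa [eps_ne hl] using this
    · have h0 : α j = 0 := by have := (hα j).1; omega
      rw [dp_sub_eps_eq_zero h0, map_zero, dp_eq_zero]
      intro hb
      have := (hb j).1
      by_cases hl : j = i
      · subst hl; simp [eps_self, h0] at this
      · simp [eps_self, h0, eps_ne hl] at this
  have : (partialLin i).comp (partialLin j) =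
      ((partialLin j).comp (partialLin i) : DivPow 𝒦 p n →ₗ[𝒦] DivPow 𝒦 p n) := by
    refine hom_ext fun α hα => ?_
    rw [LinearMap.comp_apply, LinearMap.comp_apply, partialLin_dp j hα, partialLin_dp i hα,
      key i j α hα, key j i α hα, sub_right_comm]
  exact congrArg (fun T => T f) this

lemma X_mul_D [Fact p.Prime] [CharP 𝒦 p] (j : Idx n) {α : Idx n → ℤ} (h : InBox p α) :
    X j * D j (dp α : DivPow 𝒦 p n) = (α j : 𝒦) • dp α := by
  rw [D_dp j h, X]
  by_cases hj : 1 ≤ α j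
  · rw [dp_mul_dp (fun i => (inBox_eps (p := p) j i).1) (sub_eps_nonneg (fun i => (h i).1) hj),
      add_sub_cancel]
    congr 1
    have : binom (eps j) (α - eps j) = (α j).toNat := by
      rw [binom, Finset.prod_eq_single j]
      · simp only [Pi.sub_apply, eps_self, Int.toNat_one, Nat.choose_one_right]
        omega
      · intro i _ hi; simp [eps_ne hi]
      · simp
    rw [this, ← Int.cast_natCast, Int.toNat_of_nonneg (h j).1]
  · have h0 : α j = 0 := by have := (h j).1; omega
    rw [dp_sub_eps_eq_zero h0, mul_zero, h0, Int.cast_zero, zero_smul]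

end DivPow

/-! ### Contact vector fields -/

section Contact

variable {𝒦 A : Type*} [Field 𝒦] [CommRing A] [Algebra 𝒦 A] {n : ℕ}

/-- The operator `f ↦ 2f - ∑_{i ≠ 0} x_i D_i f`. -/
def contactDelta (D : Idx n → Derivation 𝒦 A A) (x : Idx n → A) (f : A) : A :=
  2 * f - ∑ i : Fin n, (x (pos i) * D (pos i) f + x (neg i) * D (neg i) f)

/-- The coefficients of the contact vector field of `f`. -/
def contactCoef (D : Idx n → Derivation 𝒦 A A) (x : Idx n → A) (f : A) : Idx n → A
  | none => contactDelta D x f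
  | some (Sum.inl i) => x (pos i) * D zer f + D (neg i) f
  | some (Sum.inr i) => x (neg i) * D zer f - D (pos i) f

/-- The contact bracket of functions. -/
def contactBracket (D : Idx n → Derivation 𝒦 A A) (x : Idx n → A) (f g : A) : A :=
  contactDelta D x f * D zer g - contactDelta D x g * D zer f +
    ∑ i : Fin n, (D (neg i) f * D (pos i) g - D (pos i) f * D (neg i) g)

/-- The contact vector field of `f`. -/
def contactField (D : Idx n → Derivation 𝒦 A A) (x : Idx n → A) (f : A) : Derivation 𝒦 A A :=
  ∑ j, contactCoef D x f j • D j

lemma derivation_sum_apply {ι : Type*} (s : Finset ι) (d : ι → Derivation 𝒦 A A) (g : A) :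
    (∑ j ∈ s, d j) g = ∑ j ∈ s, d j g := by
  classical
  induction s using Finset.induction_on with
  | empty => simp
  | insert a s ha ih => rw [Finset.sum_insert ha, Finset.sum_insert ha, Derivation.add_apply, ih]

lemma contactField_apply (D : Idx n → Derivation 𝒦 A A) (x : Idx n → A) (f g : A) :
    contactField D x f g = contactDelta D x f * D zer g +
      ∑ i : Fin n, ((x (pos i) * D zer f + D (neg i) f) * D (pos i) g +
        (x (neg i) * D zer f - D (pos i) f) * D (neg i) g) := by
  have : ∀ (s : Finset (Idx n)) (c : Idx n → A),
      (∑ j ∈ s, c j • D j) g = ∑ j ∈ s, c j * D j g := fun s c => by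
    rw [derivation_sum_apply]; rfl
  rw [contactField, this, Fintype.sum_option, Fintype.sum_sum_type, ← Finset.sum_add_distrib]
  rfl

lemma lie_sum_smul (D : Idx n → Derivation 𝒦 A A) (hD : ∀ i j f, D i (D j f) = D j (D i f))
    (a b : Idx n → A) :
    ⁅∑ j, a j • D j, ∑ j, b j • D j⁆ =
      ∑ j, ((∑ l, a l • D l) (b j) - (∑ l, b l • D l) (a j)) • D j := by
  have key : ∀ (c : Idx n → A) (g : A), (∑ j, c j • D j) g = ∑ j, c j * D j g := fun c g => by
    rw [derivation_sum_apply]; rfl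
  ext g
  rw [Derivation.commutator_apply, key b g, key a g, key _ g, map_sum, map_sum]
  simp only [Derivation.leibniz, smul_eq_mul, Finset.sum_add_distrib, sub_mul,
    Finset.sum_sub_distrib]
  have h : ∑ j, b j * (∑ l, a l • D l) (D j g) = ∑ j, a j * (∑ l, b l • D l) (D j g) := by
    simp only [key, Finset.mul_sum]
    rw [Finset.sum_comm]
    refine Finset.sum_congr rfl fun i _ => Finset.sum_congr rfl fun j _ => ?_
    rw [hD i j]; ring
  rw [h]
  simp only [mul_comm (D _ g)]
  ring

variable (D : Idx n → Derivation 𝒦 A A) (x : Idx n → A)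

lemma contactBracket_eq (f g : A) :
    contactBracket D x f g = contactField D x f g - 2 * g * D zer f := by
  rw [contactBracket, contactField_apply]
  simp only [contactDelta, Finset.sum_add_distrib, Finset.sum_sub_distrib, add_mul, sub_mul,
    Finset.sum_mul]
  have h1 : ∑ i : Fin n, x (pos i) * D zer f * D (pos i) g =
      ∑ i : Fin n, x (pos i) * D (pos i) g * D zer f :=
    Finset.sum_congr rfl fun i _ => by ring
  have h2 : ∑ i : Fin n, x (neg i) * D zer f * D (neg i) g =
      ∑ i : Fin n, x (neg i) * D (neg i) g * D zer f :=
    Finset.sum_congr rfl fun i _ => by ring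
  rw [h1, h2]
  ring

lemma contactBracket_swap (f g : A) :
    contactBracket D x g f = - contactBracket D x f g := by
  have h : ∑ i : Fin n, (D (neg i) g * D (pos i) f - D (pos i) g * D (neg i) f) =
      - ∑ i : Fin n, (D (neg i) f * D (pos i) g - D (pos i) f * D (neg i) g) := by
    rw [← Finset.sum_neg_distrib]
    exact Finset.sum_congr rfl fun i _ => by ring
  rw [contactBracket, contactBracket, h]
  ring

lemma contactDelta_D (hD : ∀ i j f, D i (D j f) = D j (D i f))
    (hx : ∀ i j, D i (x j) = if i = j then 1 else 0) (j : Idx n) (f : A) :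
    D j (contactDelta D x f) = contactDelta D x (D j f) - (if j = zer then 0 else D j f) := by
  have h2 : D j ((2 : A) * f) = 2 * D j f := by
    rw [two_mul, two_mul, map_add]
  simp only [contactDelta, map_sub, h2, map_sum, map_add, Derivation.leibniz, smul_eq_mul, hx,
    hD j, Finset.sum_add_distrib, mul_ite, mul_one, mul_zero]
  rcases j with _ | j | j <;> simp <;> ring

lemma D_contactBracket (hD : ∀ i j f, D i (D j f) = D j (D i f))
    (hx : ∀ i j, D i (x j) = if i = j then 1 else 0) (j : Idx n) (f g : A) :
    D j (contactBracket D x f g) = contactBracket D x (D j f) g + contactBracket D x f (D j g) -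
      (if j = zer then 0 else D j f * D zer g - D j g * D zer f) := by
  simp only [contactBracket, map_add, map_sub, map_sum, Derivation.leibniz, smul_eq_mul,
    contactDelta_D D x hD hx, hD j]
  have h : ∀ u v w z : Fin n → A, ∑ i, (u i - v i) + ∑ i, (w i - z i) =
      ∑ i, (u i - v i + (w i - z i)) := fun u v w z => Finset.sum_add_distrib.symm
  have h' : ∑ i : Fin n, (D (neg i) f * D (pos i) (D j g) + D (pos i) g * D (neg i) (D j f) -
      (D (pos i) f * D (neg i) (D j g) + D (neg i) g * D (pos i) (D j f))) =
      ∑ i : Fin n, (D (neg i) (D j f) * D (pos i) g - D (pos i) (D j f) * D (neg i) g) +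
      ∑ i : Fin n, (D (neg i) f * D (pos i) (D j g) - D (pos i) f * D (neg i) (D j g)) := by
    rw [h]
    exact Finset.sum_congr rfl fun i _ => by ring
  rw [h']
  split_ifs <;> ring

/-- The contact vector fields are closed under the Lie bracket of derivations. -/
lemma lie_contactField (hD : ∀ i j f, D i (D j f) = D j (D i f))
    (hx : ∀ i j, D i (x j) = if i = j then 1 else 0) (f g : A) :
    ⁅contactField D x f, contactField D x g⁆ = contactField D x (contactBracket D x f g) := by
  have hX : ∀ (f : A) (j : Idx n), contactField D x f (x j) = contactCoef D x f j := by
    intro f j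
    have : contactField D x f (x j) = ∑ l, contactCoef D x f l * D l (x j) := by
      rw [contactField, derivation_sum_apply]; rfl
    simp [this, hx]
  have hb : ∀ f g : A, contactField D x f g = contactBracket D x f g + 2 * g * D zer f :=
    fun f g => by rw [contactBracket_eq]; ring
  have hs := contactBracket_swap D x
  have hDb := D_contactBracket D x hD hx
  rw [show ⁅contactField D x f, contactField D x g⁆ = _ from lie_sum_smul D hD _ _]
  refine Finset.sum_congr rfl fun j _ => ?_
  congr 1
  change contactField D x f (contactCoef D x g j) - contactField D x g (contactCoef D x f j) = _
  rcases j with _ | j | j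
  · have h2 : ∀ (d : Derivation 𝒦 A A) (f : A), d ((2 : A) * f) = 2 * d f := fun d f => by
      rw [two_mul, two_mul, map_add]
    simp only [contactCoef, contactDelta]
    simp only [map_sub, h2, map_sum, map_add, Derivation.leibniz, smul_eq_mul, hX, contactCoef]
    simp only [hDb, reduceCtorEq, if_false]
    simp only [hb]
    have e4 : ∀ U V P Q R : Fin n → A,
        ∑ i, (U i - V i + (2 * P i * D zer g - 2 * Q i * D zer f - 2 * R i)) =
          ∑ i, U i - ∑ i, V i +
            (2 * (∑ i, P i) * D zer g - 2 * (∑ i, Q i) * D zer f - 2 * ∑ i, R i) := by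
      intro U V P Q R
      simp only [Finset.sum_add_distrib, Finset.sum_sub_distrib, Finset.mul_sum, Finset.sum_mul]
    have e1 : ∀ i : Fin n,
        x (pos i) * (contactBracket D x (D (pos i) f) g + contactBracket D x f (D (pos i) g) -
            (D (pos i) f * D zer g - D (pos i) g * D zer f)) +
          x (neg i) * (contactBracket D x (D (neg i) f) g + contactBracket D x f (D (neg i) g) -
            (D (neg i) f * D zer g - D (neg i) g * D zer f)) =
        (x (pos i) * (contactBracket D x f (D (pos i) g) + 2 * D (pos i) g * D zer f) +
            D (pos i) g * (x (pos i) * D zer f + D (neg i) f) +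
          (x (neg i) * (contactBracket D x f (D (neg i) g) + 2 * D (neg i) g * D zer f) +
            D (neg i) g * (x (neg i) * D zer f - D (pos i) f))) -
        (x (pos i) * (contactBracket D x g (D (pos i) f) + 2 * D (pos i) f * D zer g) +
            D (pos i) f * (x (pos i) * D zer g + D (neg i) g) +
          (x (neg i) * (contactBracket D x g (D (neg i) f) + 2 * D (neg i) f * D zer g) +
            D (neg i) f * (x (neg i) * D zer g - D (pos i) g))) +
        (2 * (x (pos i) * D (pos i) f + x (neg i) * D (neg i) f) * D zer g -
          2 * (x (pos i) * D (pos i) g + x (neg i) * D (neg i) g) * D zer f -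
          2 * (D (neg i) f * D (pos i) g - D (pos i) f * D (neg i) g)) := by
      intro i
      rw [hs (D (pos i) f) g, hs (D (neg i) f) g]
      ring
    rw [Finset.sum_congr rfl fun i _ => e1 i, e4]
    rw [hs f g]
    have e2 : contactBracket D x f g =
      (2 * f - ∑ i : Fin n, (x (pos i) * D (pos i) f + x (neg i) * D (neg i) f)) * D zer g -
      (2 * g - ∑ i : Fin n, (x (pos i) * D (pos i) g + x (neg i) * D (neg i) g)) * D zer f +
      ∑ i : Fin n, (D (neg i) f * D (pos i) g - D (pos i) f * D (neg i) g) := rfl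
    linear_combination (2 : A) * e2
  · simp only [contactCoef, map_add, Derivation.leibniz, smul_eq_mul, hX, hDb, reduceCtorEq,
      if_false, if_true]
    simp only [hb]
    rw [hs (D zer f) g, hs (D (neg j) f) g]
    ring
  · simp only [contactCoef, map_sub, Derivation.leibniz, smul_eq_mul, hX, hDb, reduceCtorEq,
      if_false, if_true]
    simp only [hb]
    rw [hs (D zer f) g, hs (D (pos j) f) g]
    ring

end Contact

/-! ### The contact algebra -/

open DivPow

section ContactAlgebra

variable (𝒦 : Type*) [Field 𝒦] (p n : ℕ) [Fact p.Prime] [CharP 𝒦 p]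

/-- The Lie algebra of derivations of the restricted divided power algebra. -/
abbrev DerDP : Type _ := Derivation 𝒦 (DivPow 𝒦 p n) (DivPow 𝒦 p n)

variable {𝒦 p n}

/-- The value of `D_K` at `x^(α)`. -/
noncomputable def DKval (α : Idx n → ℤ) : DerDP 𝒦 p n :=
  ((2 - ∑ i : Fin n, (α (pos i) + α (neg i)) : ℤ) : 𝒦) • (dp α : DivPow 𝒦 p n) • D zer +
    ∑ i : Fin n, (dp (α - eps zer) : DivPow 𝒦 p n) •
      ((dp (eps (pos i)) : DivPow 𝒦 p n) • D (pos i) +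
        (dp (eps (neg i)) : DivPow 𝒦 p n) • D (neg i)) +
    ∑ i : Fin n, ((dp (α - eps (neg i)) : DivPow 𝒦 p n) • D (pos i) -
      (dp (α - eps (pos i)) : DivPow 𝒦 p n) • D (neg i))

/-- The linear map `D_K`. -/
noncomputable def DK : DivPow 𝒦 p n →ₗ[𝒦] DerDP 𝒦 p n := DivPow.lift DKval

lemma DK_dp {α : Idx n → ℤ} (h : InBox p α) : DK (dp α : DivPow 𝒦 p n) = DKval α := lift_dp _ h

/-- `D_K f` in terms of the derivations `D_j`. -/
lemma DK_eq_contactField (f : DivPow 𝒦 p n) : DK f = contactField D DivPow.X f := by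
  have hfield : ∀ f g : DivPow 𝒦 p n, contactField D DivPow.X f g =
      ∑ j, contactCoef D DivPow.X f j * D j g := fun f g => by
    rw [contactField, derivation_sum_apply]; rfl
  let F : DivPow 𝒦 p n →ₗ[𝒦] DerDP 𝒦 p n :=
    { toFun := contactField D DivPow.X
      map_add' := fun f g => by
        ext a
        rw [Derivation.add_apply]
        simp only [contactField_apply, contactDelta, map_add, mul_add, Finset.sum_add_distrib,
          Finset.sum_sub_distrib, add_mul, sub_mul]
        ring
      map_smul' := fun c f => by
        ext a
        rw [RingHom.id_apply, Derivation.smul_apply]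
        simp only [contactField_apply, contactDelta, Derivation.map_smul, mul_smul_comm, ← smul_add,
          ← smul_sub, smul_mul_assoc, ← Finset.smul_sum] }
  have : DK = F := by
    refine hom_ext fun α hα => ?_
    change DK (dp α) = contactField D DivPow.X (dp α)
    rw [DK_dp hα, DKval, contactField, Fintype.sum_option, Fintype.sum_sum_type, add_assoc,
      ← Finset.sum_add_distrib, ← Finset.sum_add_distrib]
    have h2 : ((2 : DivPow 𝒦 p n)) * dp α = (2 : 𝒦) • dp α := by rw [two_mul, two_smul]
    congr 1
    · change _ = contactDelta D DivPow.X (dp α) • D zer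
      rw [contactDelta, h2, ← smul_assoc]
      congr 1
      simp only [X_mul_D _ hα, ← add_smul, ← Finset.sum_smul, ← sub_smul]
      push_cast
      rfl
    · refine Finset.sum_congr rfl fun i _ => ?_
      change _ = (DivPow.X (pos i) * D zer (dp α) + D (neg i) (dp α)) • D (pos i) +
        (DivPow.X (neg i) * D zer (dp α) - D (pos i) (dp α)) • D (neg i)
      rw [D_dp _ hα, D_dp _ hα, D_dp _ hα, smul_add, add_smul, sub_smul, smul_smul, smul_smul,
        mul_comm (dp (α - eps zer)), mul_comm (dp (α - eps zer))]
      simp only [DivPow.X]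
      abel
  exact congrArg (fun T => T f) this

variable (𝒦 p n)

/-- The Lie algebra `K'(2n+1;1)`, the image of `D_K`. -/
noncomputable def KPrime : LieSubalgebra 𝒦 (DerDP 𝒦 p n) where
  __ := LinearMap.range (DK : DivPow 𝒦 p n →ₗ[𝒦] DerDP 𝒦 p n)
  lie_mem' := by
    rintro _ _ ⟨f, rfl⟩ ⟨g, rfl⟩
    exact ⟨contactBracket D DivPow.X f g, by
      rw [DK_eq_contactField, DK_eq_contactField, DK_eq_contactField,
        lie_contactField D DivPow.X D_comm D_X]⟩

/-- The contact algebra `K(2n+1;1)`, the derived algebra of `K'(2n+1;1)`. -/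
abbrev ContactK : Type _ :=
  ((⁅(⊤ : LieIdeal 𝒦 (KPrime 𝒦 p n)), (⊤ : LieIdeal 𝒦 (KPrime 𝒦 p n))⁆ :
    LieIdeal 𝒦 (KPrime 𝒦 p n)))

variable {𝒦 p n}

/-- The element `x` of the contact algebra is `D_K (x^(α))`. -/
def ContactK.IsDK (x : ContactK 𝒦 p n) (α : Idx n → ℤ) : Prop :=
  ((x : KPrime 𝒦 p n) : DerDP 𝒦 p n) = DK (dp α)

/-- The operator `d^(ℓ) = (1/ℓ!) (ad e)^ℓ`. -/
noncomputable def dPow (e : ContactK 𝒦 p n) (ℓ : ℕ) (x : ContactK 𝒦 p n) : ContactK 𝒦 p n :=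
  ((ℓ.factorial : 𝒦)⁻¹) • (fun y => ⁅e, y⁆)^[ℓ] x

/-- The relations that define the restricted enveloping algebra as a quotient of the universal
enveloping algebra by the two-sided ideal they generate. -/
inductive RestrRel : UniversalEnvelopingAlgebra 𝒦 (ContactK 𝒦 p n) →
    UniversalEnvelopingAlgebra 𝒦 (ContactK 𝒦 p n) → Prop
  | pair (i : Fin n) (x : ContactK 𝒦 p n) (hx : x.IsDK (eps (pos i) + eps (neg i))) :
      RestrRel (UniversalEnvelopingAlgebra.ι 𝒦 x ^ p) (UniversalEnvelopingAlgebra.ι 𝒦 x)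
  | zero (x : ContactK 𝒦 p n) (hx : x.IsDK (eps zer)) :
      RestrRel (UniversalEnvelopingAlgebra.ι 𝒦 x ^ p) (UniversalEnvelopingAlgebra.ι 𝒦 x)
  | nil (α : Idx n → ℤ) (hα : InBox p α) (h0 : α ≠ eps zer)
      (h1 : ∀ i : Fin n, α ≠ eps (pos i) + eps (neg i)) (x : ContactK 𝒦 p n) (hx : x.IsDK α) :
      RestrRel (UniversalEnvelopingAlgebra.ι 𝒦 x ^ p) 0

variable (𝒦 p n)

/-- The restricted universal enveloping algebra `u(K(2n+1;1))`. -/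
abbrev RestrU : Type _ := RingQuot (RestrRel (𝒦 := 𝒦) (p := p) (n := n))

end ContactAlgebra

/-- The truncated polynomial ring `𝒦[t]/(t^p - q t)`. -/
abbrev TruncPoly {𝒦 : Type*} [Field 𝒦] (p : ℕ) (q : 𝒦) : Type _ :=
  AdjoinRoot (Polynomial.X ^ p - Polynomial.C q * Polynomial.X : Polynomial 𝒦)

/-- The class of `t` in `𝒦[t]/(t^p - q t)`. -/
noncomputable abbrev TruncPoly.t {𝒦 : Type*} [Field 𝒦] (p : ℕ) (q : 𝒦) : TruncPoly p q :=
  AdjoinRoot.root _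

/-- The algebra `u_{t,q}(K(2n+1;1))` over `𝒦[t]/(t^p - q t)`, obtained from `u(K(2n+1;1))` by
extension of scalars. -/
abbrev RestrUtq {𝒦 : Type*} [Field 𝒦] (p n : ℕ) [Fact p.Prime] [CharP 𝒦 p] (q : 𝒦) : Type _ :=
  TruncPoly p q ⊗[𝒦] RestrU 𝒦 p n

/-- The image in `u_{t,q}(K(2n+1;1))` of an element of the contact algebra. -/
noncomputable def toUtq {𝒦 : Type*} [Field 𝒦] {p n : ℕ} [Fact p.Prime] [CharP 𝒦 p] (q : 𝒦)
    (x : ContactK 𝒦 p n) : RestrUtq p n q :=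
  1 ⊗ₜ[𝒦] RingQuot.mkAlgHom 𝒦 RestrRel (UniversalEnvelopingAlgebra.ι 𝒦 x)

/-! ### Hopf algebras and twist formulas -/

/-- The rising factorial `x^⟨m⟩ = x (x+1) ⋯ (x+m-1)`. -/
def rising {A : Type*} [Ring A] (x : A) : ℕ → A
  | 0 => 1
  | m + 1 => rising x m * (x + m)

/-- The values of the coproduct, the antipode and the counit at an element `x` of weight `w`
are given by the twist formulas truncated at `p`, where `T` stands for `1 - e t` and `d ℓ` for
`d^(ℓ)(x)`. -/
structure TwistFormulas {R A : Type*} [CommRing R] [Ring A] [HopfAlgebra R A] (p : ℕ) (t : R)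
    (h : A) (T : Aˣ) (w : ℤ) (x : A) (d : ℕ → A) : Prop where
  comul : Coalgebra.comul (R := R) x = x ⊗ₜ[R] ((T ^ w : Aˣ) : A) +
    ∑ ℓ ∈ Finset.range p,
      ((-1) ^ ℓ * t ^ ℓ) • (rising h ℓ ⊗ₜ[R] (((T ^ (-(ℓ : ℤ)) : Aˣ) : A) * d ℓ))
  antipode : HopfAlgebra.antipode R x = - (((T ^ (-w) : Aˣ) : A) *
    ∑ ℓ ∈ Finset.range p, t ^ ℓ • (d ℓ * rising (h + 1) ℓ))
  counit : Coalgebra.counit (R := R) x = 0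

/-- The Hopf algebra `A` is neither commutative nor cocommutative. -/
def NoncommNoncocomm (R A : Type*) [CommRing R] [Ring A] [HopfAlgebra R A] : Prop :=
  (¬ ∀ a b : A, a * b = b * a) ∧ ¬ Coalgebra.IsCocomm R A

/-! ### Ordered monomials -/

/-! The Hopf structure is a Drinfeld twist of the usual cocommutative one. The relations give `h ^ p
= h`, so `h` has orthogonal spectral idempotents π_c = 1 - (h - c)^(p-1), indexed by the residues c
modulo p, with sum 1. They also give `e ^ p = 0`, so in characteristic p both T = 1 - et and T' = 1
+ et have p-th power 1, and T^c makes sense for a residue c. The twisting element is the finite sum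
F = ∑ π_c ⊗ T^c, the Drinfeld element is V = ∑ π_c T'^c with inverse ∑ π_c T^c, and the new maps are
F Δ F⁻¹ and V S V⁻¹.

The cocycle identity for F is never needed. The algebra is generated by the `D_K (x^(α))`, which are
primitive weight vectors of ad h; for such an x of weight w the twisted coproduct is x ⊗ T^w + ∑ π_c
⊗ T^c x T^(-c) (`TwistData.comulHom_primitive`), and the Hopf axioms are checked on this form. The
stated formulas follow from expanding T^c x in the divided powers of ad e (`zmodPow_mul_eq_sum`,
`zmodPow_mul_eq_sum'`) and from ∑ c^⟨ℓ⟩ π_c = h^⟨ℓ⟩. The truncation at p is harmless because (ad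
e)^p = 0 in the enveloping algebra.

The dimension needs a basis of the contact algebra and a restricted Poincaré–Birkhoff–Witt theorem.
A contact bracket is a divergence up to a multiple of 2n+4 (`contactBracket_eq_divergence`), and
divergences have no x^(τ) coefficient; hence x^(τ) is missing exactly when p divides 2n+4, while
every other x^(α) is obtained from brackets. For the second ingredient, `D_K (x^(α))` is a sum of
commuting operators, each shifting all exponents by a fixed vector. A nonzero shift has p-th power
0, and a zero shift is diagonal with eigenvalues in the prime field. So the defining relations hold
in the action on the divided power algebra, this action factors through the restricted enveloping
algebra, and the contact algebra embeds there (`toU_injective`). Ordered monomials in a basis of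
primitive elements are then a linear basis (`finrank_eq_of_primitive_generators`).

Noncommutativity comes from [h, e] = e ≠ 0. Cocommutativity fails on h, whose twisted coproduct
contains the asymmetric term h ⊗ t T⁻¹ e; a matrix coefficient of the standard representation
detects it. -/

section OrderedMonomials

variable {𝒦 A : Type*} [Field 𝒦] [Ring A] [Algebra 𝒦 A] {N : ℕ}

variable (𝒦) in
/-- The span of the products of at most `d` members of the family `y`. -/
def prodSpan (y : Fin N → A) (d : ℕ) : Submodule 𝒦 A :=
  Submodule.span 𝒦 {a | ∃ l : List (Fin N), l.length ≤ d ∧ a = (l.map y).prod}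

lemma prod_mem_prodSpan (y : Fin N → A) {d : ℕ} (l : List (Fin N)) (hl : l.length ≤ d) :
    (l.map y).prod ∈ prodSpan 𝒦 y d :=
  Submodule.subset_span ⟨l, hl, rfl⟩

lemma mul_mem_prodSpan (y : Fin N → A) {d d' : ℕ} {a b : A} (ha : a ∈ prodSpan 𝒦 y d)
    (hb : b ∈ prodSpan 𝒦 y d') : a * b ∈ prodSpan 𝒦 y (d + d') := by
  have h : prodSpan 𝒦 y d * prodSpan 𝒦 y d' ≤ prodSpan 𝒦 y (d + d') := by
    rw [prodSpan, prodSpan, Submodule.span_mul_span]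
    refine Submodule.span_mono ?_
    rintro _ ⟨_, ⟨l, hl, rfl⟩, _, ⟨l', hl', rfl⟩, rfl⟩
    exact ⟨l ++ l', by rw [List.length_append]; omega, by simp⟩
  exact h (Submodule.mul_mem_mul ha hb)

lemma span_range_le_prodSpan (y : Fin N → A) :
    Submodule.span 𝒦 (Set.range y) ≤ prodSpan 𝒦 y 1 := by
  rw [Submodule.span_le]
  rintro _ ⟨i, rfl⟩
  exact Submodule.subset_span ⟨[i], by simp, by simp⟩

lemma prod_perm_sub_mem (y : Fin N → A)
    (hc : ∀ i j, y i * y j - y j * y i ∈ Submodule.span 𝒦 (Set.range y))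
    {l l' : List (Fin N)} (h : l.Perm l') :
    ∀ d, l.length ≤ d + 1 → (l.map y).prod - (l'.map y).prod ∈ prodSpan 𝒦 y d := by
  induction h with
  | nil => intro d _; simp
  | @cons x l l' hp ih =>
    intro d hd
    rw [List.length_cons] at hd
    rw [List.map_cons, List.map_cons, List.prod_cons, List.prod_cons, ← mul_sub]
    rcases d with _ | d
    · obtain rfl : l = [] := List.eq_nil_of_length_eq_zero (by omega)
      rw [List.Perm.eq_nil (hp.symm)]
      simp
    · rw [Nat.add_comm d 1]
      exact mul_mem_prodSpan y (span_range_le_prodSpan y (Submodule.subset_span ⟨x, rfl⟩))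
        (ih d (by omega))
  | swap i j l =>
    intro d hd
    simp only [List.length_cons] at hd
    obtain ⟨d, rfl⟩ : ∃ d', d = 1 + d' := ⟨d - 1, by omega⟩
    simp only [List.map_cons, List.prod_cons, ← mul_assoc]
    rw [← sub_mul]
    exact mul_mem_prodSpan y (span_range_le_prodSpan y (hc _ _)) (prod_mem_prodSpan y l (by omega))
  | trans h1 _ ih1 ih2 =>
    intro d hd
    have := add_mem (ih1 d hd) (ih2 d (h1.length_eq ▸ hd))
    simpa using this

variable (𝒦) in
/-- The ordered monomial with divided exponents `a`. -/
noncomputable def dividedMonomial {p : ℕ} (y : Fin N → A) (a : Fin N → Fin p) : A :=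
  (List.ofFn fun i => (((a i : ℕ).factorial : 𝒦)⁻¹) • y i ^ (a i : ℕ)).prod

lemma prod_ofFn_smul {N : ℕ} (c : Fin N → 𝒦) (g : Fin N → A) :
    (List.ofFn fun i => c i • g i).prod = (∏ i, c i) • (List.ofFn g).prod := by
  induction N with
  | zero => simp
  | succ N ih =>
    rw [List.ofFn_succ, List.prod_cons, ih (fun i => c i.succ) (fun i => g i.succ),
      Fin.prod_univ_succ, List.ofFn_succ, List.prod_cons, smul_mul_smul_comm]

lemma factorial_cast_ne_zero (p : ℕ) [Fact p.Prime] [CharP 𝒦 p] {k : ℕ} (hk : k < p) :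
    (k.factorial : 𝒦) ≠ 0 := by
  rw [Ne, CharP.cast_eq_zero_iff 𝒦 p, (Fact.out : p.Prime).dvd_factorial]
  omega

/-- Straightening by induction on the word length. Reordering costs only shorter words; a letter
occurring `p` times can be collected and its `p`-th power rewritten as a combination of single
letters; otherwise the sorted word is a product of factorials times a divided monomial. -/
lemma span_dividedMonomial_eq_top (p : ℕ) [Fact p.Prime] [CharP 𝒦 p] (y : Fin N → A)
    (hgen : Algebra.adjoin 𝒦 (Set.range y) = ⊤)
    (hc : ∀ i j, y i * y j - y j * y i ∈ Submodule.span 𝒦 (Set.range y))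
    (hp : ∀ i, y i ^ p ∈ Submodule.span 𝒦 (Set.range y)) :
    Submodule.span 𝒦 (Set.range (dividedMonomial 𝒦 (p := p) y)) = ⊤ := by
  have hp2 := (Fact.out : p.Prime).two_le
  set V := Submodule.span 𝒦 (Set.range (dividedMonomial 𝒦 (p := p) y)) with hV
  have key : ∀ d, prodSpan 𝒦 y d ≤ V := by
    intro d
    induction d using Nat.strong_induction_on with
    | _ d ih =>
    refine Submodule.span_le.2 ?_
    rintro _ ⟨l, hl, rfl⟩
    rw [SetLike.mem_coe]
    have hred : ∀ l' : List (Fin N), l.Perm l' → (l'.map y).prod ∈ V → (l.map y).prod ∈ V := by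
      intro l' hll' hl'
      rcases d with _ | d
      · obtain rfl : l = [] := List.eq_nil_of_length_eq_zero (by omega)
        rwa [List.Perm.eq_nil (hll'.symm)] at hl'
      · have := add_mem (ih d (by omega) (prod_perm_sub_mem (𝒦 := 𝒦) y hc hll' d hl)) hl'
        simpa using this
    by_cases hcount : ∃ i, p ≤ l.count i
    · obtain ⟨i, hi⟩ := hcount
      obtain ⟨l', hl'⟩ := (List.replicate_sublist_iff.2 hi).exists_perm_append
      refine hred _ hl' ?_
      have hlen := hl'.length_eq
      rw [List.length_append, List.length_replicate] at hlen
      rw [List.map_append, List.prod_append, List.map_replicate, List.prod_replicate]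
      -- The `p ≥ 2` collected letters shrink to one, so the length drops.
      exact ih (1 + l'.length) (by omega)
        (mul_mem_prodSpan y (span_range_le_prodSpan y (hp i)) (prod_mem_prodSpan y l' le_rfl))
    · push Not at hcount
      have hperm : l.Perm (List.ofFn fun i => List.replicate (l.count i) i).flatten := by
        rw [List.perm_iff_count]
        intro j
        rw [List.count_flatten, List.map_ofFn, List.sum_ofFn]
        simp [List.count_replicate]
      refine hred _ hperm ?_
      have hmon : ((List.ofFn fun i => List.replicate (l.count i) i).flatten.map y).prod =
          (∏ i, ((l.count i).factorial : 𝒦)) •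
            dividedMonomial 𝒦 (p := p) y fun i => ⟨l.count i, hcount i⟩ := by
        rw [dividedMonomial, ← prod_ofFn_smul, List.map_flatten, List.prod_flatten, List.map_map,
          List.map_ofFn]
        congr 2
        funext i
        simp [smul_smul, mul_inv_cancel₀ (factorial_cast_ne_zero (𝒦 := 𝒦) p (hcount i))]
      rw [hmon]
      exact V.smul_mem _ (Submodule.subset_span ⟨_, rfl⟩)
  rw [eq_top_iff, ← Algebra.top_toSubmodule, ← hgen, Algebra.adjoin_eq_span, Submodule.span_le]
  intro a ha
  obtain ⟨L, hL, rfl⟩ := Submonoid.exists_list_of_mem_closure ha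
  choose f hf using fun x : {x // x ∈ L} => hL x.1 x.2
  have : L = (L.attach.map f).map y := by
    rw [List.map_map]
    conv_lhs => rw [← List.attach_map_subtype_val L]
    exact List.map_congr_left fun x _ => (hf x).symm
  rw [this]
  exact key _ (prod_mem_prodSpan y _ le_rfl)

/-- Ordered products distribute over finite sums. -/
lemma prod_ofFn_sum {κ : Type*} [Fintype κ] {N : ℕ} (g : Fin N → κ → A) :
    (List.ofFn fun i => ∑ k, g i k).prod =
      ∑ f : Fin N → κ, (List.ofFn fun i => g i (f i)).prod := by
  induction N with
  | zero => simp
  | succ N ih =>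
    rw [List.ofFn_succ, List.prod_cons, ih, Finset.sum_mul_sum, ← Fintype.sum_prod_type']
    refine Fintype.sum_equiv (Fin.consEquiv fun _ => κ) _ _ fun x => ?_
    rw [List.ofFn_succ, List.prod_cons]
    simp [Fin.consEquiv]

/-- The binomial theorem for the commuting elements `z ⊗ 1` and `1 ⊗ z`. Dividing by the factorials,
invertible below `p`, turns every binomial coefficient into 1. -/
lemma comul_divided_pow (p : ℕ) [Fact p.Prime] [CharP 𝒦 p] (Δ : A →ₐ[𝒦] A ⊗[𝒦] A) {z : A}
    (hz : Δ z = z ⊗ₜ 1 + 1 ⊗ₜ z) {a : ℕ} (ha : a < p) :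
    Δ (((a.factorial : 𝒦)⁻¹) • z ^ a) =
      ∑ k : Fin p × Fin p, (if (k.1 : ℕ) + k.2 = a then (1 : 𝒦) else 0) •
        ((((k.1 : ℕ).factorial : 𝒦)⁻¹ • z ^ (k.1 : ℕ)) ⊗ₜ[𝒦]
          (((k.2 : ℕ).factorial : 𝒦)⁻¹ • z ^ (k.2 : ℕ))) := by
  have hcomm : Commute (z ⊗ₜ[𝒦] (1 : A)) (1 ⊗ₜ z) := by
    simp [Commute, SemiconjBy]
  simp only [ite_smul, one_smul, zero_smul]
  rw [map_smul, map_pow, hz, hcomm.add_pow', Finset.smul_sum, ← Finset.sum_filter]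
  symm
  refine Finset.sum_bij (fun k _ => ((k.1 : ℕ), (k.2 : ℕ))) ?_ ?_ ?_ ?_
  · intro k hk
    simpa using hk
  · intro k _ k' _ h
    simp only [Prod.mk.injEq] at h
    exact Prod.ext (Fin.ext h.1) (Fin.ext h.2)
  · rintro ⟨b, c⟩ hbc
    rw [Finset.HasAntidiagonal.mem_antidiagonal] at hbc
    exact ⟨(⟨b, by simp only at hbc; omega⟩, ⟨c, by simp only at hbc; omega⟩), by simpa using hbc,
      rfl⟩
  · rintro ⟨b, c⟩ hbc
    simp only [Finset.mem_filter, Finset.mem_univ, true_and] at hbc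
    have h1 := factorial_cast_ne_zero (𝒦 := 𝒦) p b.2
    have h2 := factorial_cast_ne_zero (𝒦 := 𝒦) p c.2
    have h3 := factorial_cast_ne_zero (𝒦 := 𝒦) p ha
    have h4 : (a.choose b : 𝒦) * (b : ℕ).factorial * (c : ℕ).factorial = a.factorial := by
      have := Nat.choose_mul_factorial_mul_factorial (n := a) (k := b) (by omega)
      rw [show a - b = (c : ℕ) by omega] at this
      rw [← this]
      push_cast
      rfl
    rw [TensorProduct.smul_tmul_smul, ← Nat.cast_smul_eq_nsmul 𝒦, smul_smul]
    simp only [Algebra.TensorProduct.tmul_pow, one_pow, Algebra.TensorProduct.tmul_mul_tmul,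
      mul_one, one_mul]
    congr 1
    rw [← h4]
    rw [← h4] at h3
    field_simp
    rw [div_self]
    intro h0
    simp [h0] at h3

lemma prod_ofFn_tmul {N : ℕ} (f g : Fin N → A) :
    (List.ofFn fun i => f i ⊗ₜ[𝒦] g i).prod = (List.ofFn f).prod ⊗ₜ[𝒦] (List.ofFn g).prod := by
  induction N with
  | zero => simp [Algebra.TensorProduct.one_def]
  | succ N ih =>
    rw [List.ofFn_succ, List.prod_cons, ih, List.ofFn_succ, List.prod_cons, List.ofFn_succ,
      List.prod_cons, Algebra.TensorProduct.tmul_mul_tmul]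

lemma comul_dividedMonomial (p : ℕ) [Fact p.Prime] [CharP 𝒦 p] (Δ : A →ₐ[𝒦] A ⊗[𝒦] A)
    (y : Fin N → A) (hy : ∀ i, Δ (y i) = y i ⊗ₜ 1 + 1 ⊗ₜ y i) (a : Fin N → Fin p) :
    Δ (dividedMonomial 𝒦 y a) =
      ∑ f : (Fin N → Fin p) × (Fin N → Fin p),
        (if ∀ i, (f.1 i : ℕ) + f.2 i = a i then (1 : 𝒦) else 0) •
          (dividedMonomial 𝒦 y f.1 ⊗ₜ[𝒦] dividedMonomial 𝒦 y f.2) := by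
  rw [dividedMonomial, map_list_prod, List.map_ofFn]
  have : (Δ ∘ fun i => (((a i : ℕ).factorial : 𝒦)⁻¹) • y i ^ (a i : ℕ)) = fun i =>
      ∑ k : Fin p × Fin p, (if (k.1 : ℕ) + k.2 = a i then (1 : 𝒦) else 0) •
        ((((k.1 : ℕ).factorial : 𝒦)⁻¹ • y i ^ (k.1 : ℕ)) ⊗ₜ[𝒦]
          (((k.2 : ℕ).factorial : 𝒦)⁻¹ • y i ^ (k.2 : ℕ))) :=
    funext fun i => comul_divided_pow p Δ (hy i) (a i).2
  rw [this, prod_ofFn_sum]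
  refine Fintype.sum_equiv (Equiv.arrowProdEquivProdArrow _ _ _) _ _ fun f => ?_
  rw [prod_ofFn_smul, prod_ofFn_tmul, Finset.prod_ite_zero]
  change _ = (if ∀ i, ((f i).1 : ℕ) + (f i).2 = a i then (1 : 𝒦) else 0) •
    (dividedMonomial 𝒦 y (fun i => (f i).1) ⊗ₜ[𝒦] dividedMonomial 𝒦 y fun i => (f i).2)
  congr 1
  simp

lemma dividedMonomial_zero {p : ℕ} [NeZero p] (y : Fin N → A) :
    dividedMonomial 𝒦 (p := p) y 0 = 1 := by
  simp [dividedMonomial]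

lemma prod_ofFn_eq_single {N : ℕ} (g : Fin N → A) (i : Fin N) (h : ∀ j ≠ i, g j = 1) :
    (List.ofFn g).prod = g i := by
  induction N with
  | zero => exact i.elim0
  | succ N ih =>
    rw [List.ofFn_succ, List.prod_cons]
    refine Fin.cases (fun h => ?_) (fun i h => ?_) i h
    · rw [List.prod_eq_one, mul_one]
      intro x hx
      obtain ⟨j, rfl⟩ := (List.mem_ofFn' _ _).1 hx
      exact h _ (Fin.succ_ne_zero j)
    · rw [h 0 (Fin.succ_ne_zero i).symm, one_mul]
      exact ih (fun j => g j.succ) i fun j hj => h _ fun hji => hj (Fin.succ_injective _ hji)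

lemma dividedMonomial_single {p : ℕ} (y : Fin N → A) (i : Fin N) (b : Fin N → Fin p)
    (hi : (b i : ℕ) = 1) (h : ∀ j ≠ i, (b j : ℕ) = 0) :
    dividedMonomial 𝒦 y b = y i := by
  rw [dividedMonomial, prod_ofFn_eq_single _ i fun j hj => by simp [h j hj]]
  simp [hi]

/-- Descent on the degree of a linear relation. Contracting one leg of its coproduct with a
functional that kills 1 and is dual to `y i` gives a relation of smaller degree, in which the
coefficient at `a - ε_i` is that of `a` when `a` has top degree. Thus only the independence of the
generators themselves is needed. -/
theorem linearIndependent_dividedMonomial (p : ℕ) [Fact p.Prime] [CharP 𝒦 p]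
    (Δ : A →ₐ[𝒦] A ⊗[𝒦] A) (ε : A →ₐ[𝒦] 𝒦) (y : Fin N → A)
    (hΔ : ∀ i, Δ (y i) = y i ⊗ₜ 1 + 1 ⊗ₜ y i) (hε : ∀ i, ε (y i) = 0)
    (hy : LinearIndependent 𝒦 y) :
    LinearIndependent 𝒦 (dividedMonomial 𝒦 (p := p) y) := by
  have hp2 := (Fact.out : p.Prime).two_le
  have : NeZero p := ⟨by omega⟩
  have hφ : ∀ i, ∃ φ : A →ₗ[𝒦] 𝒦, φ 1 = 0 ∧ ∀ j, φ (y j) = if j = i then 1 else 0 := by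
    intro i
    obtain ⟨ψ, hψ⟩ := LinearMap.exists_extend ((Finsupp.lapply i).comp hy.repr)
    have hψ' : ∀ j, ψ (y j) = if j = i then 1 else 0 := by
      intro j
      have := LinearMap.congr_fun hψ ⟨y j, Submodule.subset_span ⟨j, rfl⟩⟩
      simp only [LinearMap.comp_apply, Submodule.subtype_apply] at this
      rw [this, hy.repr_eq_single j _ rfl]
      simp [Finsupp.single_apply]
    -- The counit vanishes on the `y j`, so this correction kills 1 without changing the dual
    -- values.
    refine ⟨ψ - ψ 1 • ε.toLinearMap, by simp, fun j => by simp [hε, hψ']⟩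
  let deg : (Fin N → Fin p) → ℕ := fun a => ∑ i, (a i : ℕ)
  have hdeg0 : ∀ a, deg a = 0 → a = 0 := by
    intro a ha
    funext i
    have := (Finset.sum_eq_zero_iff.1 ha) i (Finset.mem_univ i)
    exact Fin.ext (by simpa using this)
  have main : ∀ d (c : (Fin N → Fin p) → 𝒦), (∀ a, d ≤ deg a → c a = 0) →
      ∑ a, c a • dividedMonomial 𝒦 y a = 0 → ∀ a, c a = 0 := by
    intro d
    induction d with
    | zero => exact fun c hc _ a => hc a (Nat.zero_le _)
    | succ d ih =>
      intro c hc h0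
      suffices htop : ∀ a, deg a = d → c a = 0 by
        refine ih c (fun a ha => ?_) h0
        rcases ha.eq_or_lt with h | h
        · exact htop a h.symm
        · exact hc a h
      rcases Nat.eq_zero_or_pos d with rfl | hd
      · intro a ha
        rw [hdeg0 a ha]
        rw [Finset.sum_eq_single 0] at h0
        · rw [dividedMonomial_zero] at h0
          simpa using congrArg ε h0
        · intro b _ hb
          rw [hc b, zero_smul]
          by_contra h
          exact hb (hdeg0 b (by omega))
        · simp
      · intro a ha
        obtain ⟨i, hi⟩ : ∃ i, 0 < (a i : ℕ) := by
          by_contra h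
          push Not at h
          have : deg a = 0 := Finset.sum_eq_zero fun i _ => Nat.le_zero.1 (h i)
          omega
        obtain ⟨φ, hφ1, hφ2⟩ := hφ i
        -- These are the coefficients of the relation after contracting the left leg with `φ`.
        let c' : (Fin N → Fin p) → 𝒦 := fun b' => ∑ b : Fin N → Fin p, ∑ a : Fin N → Fin p,
          if ∀ i, (b i : ℕ) + b' i = a i then c a * φ (dividedMonomial 𝒦 y b) else 0
        have hdegadd : ∀ a b b' : Fin N → Fin p, (∀ i, (b i : ℕ) + b' i = a i) →
            deg a = deg b + deg b' := by
          intro a b b' h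
          simp only [deg, ← Finset.sum_add_distrib, h]
        -- A term with `b'` of degree at least `d` has either `b = 0`, killed by `φ 1 = 0`, or total
        -- degree above `d`, where `c` vanishes.
        have hvanish : ∀ a b b' : Fin N → Fin p, (∀ i, (b i : ℕ) + b' i = a i) → d ≤ deg b' →
            c a * φ (dividedMonomial 𝒦 y b) = 0 := by
          intro a b b' h hb'
          have := hdegadd a b b' h
          rcases Nat.eq_zero_or_pos (deg b) with hb | hb
          · rw [hdeg0 b hb, dividedMonomial_zero, hφ1, mul_zero]
          · rw [hc a (by omega), zero_mul]
        have hrel : ∑ b', c' b' • dividedMonomial 𝒦 y b' = 0 := by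
          have h1 := congrArg ((TensorProduct.lid 𝒦 A).toLinearMap ∘ₗ φ.rTensor A ∘ₗ
            Δ.toLinearMap) h0
          rw [map_zero, map_sum] at h1
          rw [← h1]
          simp only [c', Finset.sum_smul, map_smul, LinearMap.comp_apply, AlgHom.toLinearMap_apply,
            comul_dividedMonomial p Δ y hΔ, map_sum, LinearMap.rTensor_tmul,
            LinearEquiv.coe_coe, TensorProduct.lid_tmul, Fintype.sum_prod_type, Finset.smul_sum,
            smul_smul]
          rw [Finset.sum_comm]
          conv_rhs => rw [Finset.sum_comm]
          refine Finset.sum_congr rfl fun b _ => ?_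
          conv_rhs => rw [Finset.sum_comm]
          refine Finset.sum_congr rfl fun b' _ => Finset.sum_congr rfl fun a _ => ?_
          split_ifs <;> simp
        have hc' := ih c' (fun b' hb' => Finset.sum_eq_zero fun b _ =>
            Finset.sum_eq_zero fun a _ => by
          split_ifs with h
          · exact hvanish a b b' h hb'
          · rfl) hrel
        have hup : ∀ x : Fin p, (x : ℕ) - 1 < p := fun x => by omega
        let b₀ : Fin N → Fin p := Pi.single i ⟨1, by omega⟩
        let b' : Fin N → Fin p := Function.update a i ⟨(a i : ℕ) - 1, hup _⟩
        have hb₀i : (b₀ i : ℕ) = 1 := by simp [b₀]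
        have hb₀j : ∀ j ≠ i, (b₀ j : ℕ) = 0 := fun j hj => by simp [b₀, hj]
        have hbb' : ∀ j, (b₀ j : ℕ) + b' j = a j := by
          intro j
          by_cases hj : j = i
          · subst hj
            rw [hb₀i]
            simp only [b', Function.update_self]
            omega
          · rw [hb₀j j hj]
            simp [b', hj]
        have hdegb₀ : deg b₀ = 1 := by
          simp only [deg]
          rw [Finset.sum_eq_single i (fun j _ hj => hb₀j j hj) (by simp), hb₀i]
        have hdegb' : deg b' + 1 = d := by
          have := hdegadd a b₀ b' hbb'
          omega
        -- At `b' = a - ε_i` only `b = ε_i` contributes: degree 0 and the other degree 1 indices are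
        -- killed by `φ`, and degree at least 2 would force total degree above `d`.
        have h2 := hc' b'
        simp only [c'] at h2
        rw [Finset.sum_eq_single b₀, Finset.sum_eq_single a, if_pos hbb',
          dividedMonomial_single y i b₀ hb₀i hb₀j, hφ2, if_pos rfl, mul_one] at h2
        · exact h2
        · intro a' _ ha'
          rw [if_neg]
          intro h
          exact ha' (funext fun j => Fin.ext (by rw [← h j, hbb' j]))
        · simp
        · intro b _ hb
          refine Finset.sum_eq_zero fun a' _ => ?_
          split_ifs with h
          · have hd' := hdegadd a' b b' h
            rcases Nat.lt_trichotomy (deg b) 1 with h1 | h1 | h1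
            · rw [hdeg0 b (by omega), dividedMonomial_zero, hφ1, mul_zero]
            · obtain ⟨j, hj⟩ : ∃ j, (b j : ℕ) ≠ 0 := by
                by_contra hcon
                push Not at hcon
                have : deg b = 0 := Finset.sum_eq_zero fun i _ => hcon i
                omega
              have hle : ∀ s : Finset (Fin N), ∑ l ∈ s, (b l : ℕ) ≤ 1 := fun s =>
                (Finset.sum_le_sum_of_subset (Finset.subset_univ s)).trans h1.le
              have hj1 : (b j : ℕ) = 1 := by
                have := hle {j}
                rw [Finset.sum_singleton] at this
                omega
              have hl0 : ∀ l ≠ j, (b l : ℕ) = 0 := by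
                intro l hl
                have := hle {l, j}
                rw [Finset.sum_pair hl] at this
                omega
              rw [dividedMonomial_single y j b hj1 hl0, hφ2, if_neg, mul_zero]
              rintro rfl
              refine hb (funext fun l => Fin.ext ?_)
              by_cases hl : l = j
              · rw [hl, hj1, hb₀i]
              · rw [hl0 l hl, hb₀j l hl]
            · rw [hc a' (by omega), zero_mul]
          · rfl
        · simp
  rw [Fintype.linearIndependent_iff]
  intro c h0
  -- This bound exceeds every degree, so the vanishing hypothesis is vacuous.
  refine main ((∑ _i : Fin N, p) + 1) c (fun a ha => ?_) h0
  have : deg a ≤ ∑ _i : Fin N, p := Finset.sum_le_sum fun i _ => (a i).2.le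
  omega

/-- A bialgebra that is generated by a finite-dimensional restricted Lie algebra of primitive
elements has dimension a power of `p`. -/
theorem finrank_eq_of_primitive_generators (p : ℕ) [Fact p.Prime] [CharP 𝒦 p]
    (Δ : A →ₐ[𝒦] A ⊗[𝒦] A) (ε : A →ₐ[𝒦] 𝒦) (y : Fin N → A)
    (hΔ : ∀ i, Δ (y i) = y i ⊗ₜ 1 + 1 ⊗ₜ y i) (hε : ∀ i, ε (y i) = 0)
    (hy : LinearIndependent 𝒦 y) (hgen : Algebra.adjoin 𝒦 (Set.range y) = ⊤)
    (hc : ∀ i j, y i * y j - y j * y i ∈ Submodule.span 𝒦 (Set.range y))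
    (hp : ∀ i, y i ^ p ∈ Submodule.span 𝒦 (Set.range y)) :
    Module.Finite 𝒦 A ∧ Module.finrank 𝒦 A = p ^ N := by
  let b := Module.Basis.mk (linearIndependent_dividedMonomial p Δ ε y hΔ hε hy)
    (span_dividedMonomial_eq_top p y hgen hc hp).ge
  exact ⟨Module.Finite.of_basis b, by simp [Module.finrank_eq_card_basis b]⟩

end OrderedMonomials

/-! ### Spectral projections -/

section SpectralProjections

variable (R : Type*) {A : Type*} [CommRing R] [Ring A] [Algebra R A] (p : ℕ) [Fact p.Prime]
  [CharP R p]

/-- The class of an integer modulo `p` in a ring of characteristic `p`. -/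
abbrev residue : ZMod p →+* R := ZMod.castHom (dvd_refl p) R

/-- The polynomial `1 - (X - c) ^ (p - 1)`, which is `1` at `c` and `0` at the other residues. -/
noncomputable def projPoly (c : ZMod p) : Polynomial R :=
  1 - (Polynomial.X - Polynomial.C (residue R p c)) ^ (p - 1)

/-- The projection to the eigenspace of `h` with eigenvalue `c`. -/
noncomputable def specProj (h : A) (c : ZMod p) : A := Polynomial.aeval h (projPoly R p c)

variable {R p}

lemma specProj_eq (h : A) (c : ZMod p) :
    specProj R p h c = 1 - (h - algebraMap R A (residue R p c)) ^ (p - 1) := by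
  simp [specProj, projPoly]

lemma projPoly_eval_residue (c d : ZMod p) :
    (projPoly R p c).eval (residue R p d) = if c = d then 1 else 0 := by
  have : (projPoly R p c).eval (residue R p d) = residue R p (1 - (d - c) ^ (p - 1)) := by
    simp [projPoly]
  rw [this]
  split_ifs with h
  · have := (Fact.out : p.Prime).one_lt
    simp [h, zero_pow (show p - 1 ≠ 0 by omega)]
  · rw [ZMod.pow_card_sub_one_eq_one (sub_ne_zero.2 (Ne.symm h)), sub_self, map_zero]

/-- Over the prime field both sides have degree below `p` and agree at all `p` points; the identity
is then mapped to `R`. -/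
lemma sum_projPoly : ∑ c : ZMod p, projPoly R p c = 1 := by
  have key : ∑ c : ZMod p, projPoly (ZMod p) p c = 1 := by
    refine Polynomial.eq_of_natDegree_lt_card_of_eval_eq _ _ (f := id) Function.injective_id
      (fun d => ?_) ?_
    · have : ∀ c, (projPoly (ZMod p) p c).eval d = if c = d then 1 else 0 := fun c => by
        simpa using projPoly_eval_residue (R := ZMod p) c d
      simp [Polynomial.eval_finsetSum, this]
    · have hp := (Fact.out : p.Prime).one_lt
      rw [Polynomial.natDegree_one, ZMod.card, max_eq_left (Nat.zero_le _)]
      refine lt_of_le_of_lt (Polynomial.natDegree_sum_le_of_forall_le _ _ (n := p - 1)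
        fun c _ => ?_) (by omega)
      refine (Polynomial.natDegree_sub_le _ _).trans (max_le (by simp) ?_)
      exact (Polynomial.natDegree_pow_le).trans (by simp)
  have := congrArg (Polynomial.map (residue R p)) key
  simpa [projPoly, Polynomial.map_sum] using this

lemma sum_specProj (h : A) : ∑ c : ZMod p, specProj R p h c = 1 := by
  simp only [specProj]
  rw [← map_sum, sum_projPoly, map_one]

lemma aeval_mul_of_mul_eq_smul {h z : A} {r : R} (hz : h * z = r • z) (f : Polynomial R) :
    Polynomial.aeval h f * z = f.eval r • z := by
  induction f using Polynomial.induction_on' with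
  | add f g hf hg => rw [map_add, add_mul, hf, hg, Polynomial.eval_add, add_smul]
  | monomial n a =>
    have hn : ∀ n : ℕ, h ^ n * z = r ^ n • z := by
      intro n
      induction n with
      | zero => simp
      | succ n ih => rw [pow_succ, mul_assoc, hz, mul_smul_comm, ih, smul_smul, pow_succ']
    rw [Polynomial.aeval_monomial, Polynomial.eval_monomial, mul_assoc, hn, ← Algebra.smul_def,
      smul_smul]

/-- By Frobenius and Fermat, (X - c)(1 - (X - c)^(p-1)) = X - X^p, and `h` is a root of the right
side. -/
lemma mul_specProj {h : A} (hh : h ^ p = h) (c : ZMod p) :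
    h * specProj R p h c = residue R p c • specProj R p h c := by
  have hp := (Fact.out : p.Prime).pos
  have h1 : (Polynomial.X - Polynomial.C (residue R p c)) * projPoly R p c =
      Polynomial.X - Polynomial.X ^ p := by
    rw [projPoly, mul_sub, mul_one, ← pow_succ', Nat.sub_add_cancel hp, sub_pow_char,
      ← Polynomial.C_pow, ← map_pow, ZMod.pow_card]
    ring
  have h2 := congrArg (Polynomial.aeval h) h1
  simp only [map_mul, map_sub, Polynomial.aeval_X, Polynomial.aeval_C, map_pow, hh, sub_self,
    sub_mul] at h2
  rw [Algebra.smul_def]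
  exact sub_eq_zero.1 h2

lemma specProj_mul_specProj {h : A} (hh : h ^ p = h) (c d : ZMod p) :
    specProj R p h c * specProj R p h d = if c = d then specProj R p h d else 0 := by
  rw [specProj, aeval_mul_of_mul_eq_smul (mul_specProj hh d), projPoly_eval_residue]
  split_ifs <;> simp

/-- An element of weight `w` intertwines `h - (c - w)` with `h - c`, hence also the polynomials in
them. -/
lemma specProj_mul {h x : A} {w : ℤ} (hx : h * x = x * h + w • x) (c : ZMod p) :
    specProj R p h c * x = x * specProj R p h (c - w) := by
  have h1 : SemiconjBy x (h - algebraMap R A (residue R p (c - w)))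
      (h - algebraMap R A (residue R p c)) := by
    rw [SemiconjBy, map_sub, map_sub, map_intCast, map_intCast, sub_mul, hx, mul_sub, mul_sub,
      (Algebra.commutes (residue R p c) x), zsmul_eq_mul, (Int.cast_commute w x).eq]
    abel
  have h2 := (SemiconjBy.one_right x).sub_right (h1.pow_right (p - 1))
  rw [specProj_eq, specProj_eq]
  exact h2.eq.symm

lemma mul_specProj_eq {h x : A} {w : ℤ} (hx : h * x = x * h + w • x) (c : ZMod p) :
    x * specProj R p h c = specProj R p h (c + w) * x := by
  rw [specProj_mul hx, add_sub_cancel_right]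

/-- The rising factorial of an operator acts on its eigenvectors by a scalar. -/
lemma rising_mul_of_mul_eq_smul {h z : A} {r : R} (hz : h * z = r • z) (ℓ : ℕ) :
    rising h ℓ * z = rising r ℓ • z := by
  induction ℓ with
  | zero => simp [rising]
  | succ ℓ ih =>
    have : (h + ℓ) * z = (r + ℓ) • z := by
      rw [add_mul, hz, add_smul, Nat.cast_smul_eq_nsmul, nsmul_eq_mul]
    rw [rising, rising, mul_assoc, this, mul_smul_comm, ih, smul_smul, mul_comm]

lemma rising_succ_left (r : R) (m : ℕ) : rising r (m + 1) = r * rising (r + 1) m := by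
  induction m with
  | zero => simp [rising]
  | succ m ih =>
    rw [rising, ih, rising]
    push_cast
    ring

/-- This Pascal-type recursion drives the inductions on the exponent in `zmodPow_mul_eq_sum` and
`zmodPow_mul_eq_sum'`. -/
lemma rising_add_one (r : R) (m : ℕ) :
    rising (r + 1) (m + 1) = rising r (m + 1) + (m + 1) * rising (r + 1) m := by
  rw [rising_succ_left r, rising]
  ring

lemma rising_neg_natCast (m : ℕ) : rising (-(m : R)) (m + 1) = 0 := by
  simp [rising]

end SpectralProjections

/-! ### Powers with exponents modulo `p` -/

section ZModPow

variable {A : Type*} [Ring A] {p : ℕ} [Fact p.Prime]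

/-- The power `T ^ c` of a unit with `T ^ p = 1`, for a residue `c` modulo `p`. -/
def zmodPow (T : Aˣ) (c : ZMod p) : Aˣ := T ^ c.val

lemma zmodPow_intCast {T : Aˣ} (hT : T ^ p = 1) (w : ℤ) : zmodPow T (w : ZMod p) = T ^ w := by
  have h : ((((w : ZMod p).val : ℤ)) : ZMod p) = w := by simp
  obtain ⟨k, hk⟩ := (ZMod.intCast_eq_intCast_iff_dvd_sub _ _ p).1 h
  have hw : T ^ w = T ^ ((p : ℤ) * k + ((w : ZMod p).val : ℤ)) := by rw [← hk, sub_add_cancel]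
  rw [hw, zpow_add, zpow_mul, zpow_natCast T p, hT, one_zpow, one_mul, zpow_natCast, zmodPow]

lemma zmodPow_natCast {T : Aˣ} (hT : T ^ p = 1) (k : ℕ) : zmodPow T (k : ZMod p) = T ^ k := by
  have := zmodPow_intCast hT (k : ℤ)
  rwa [Int.cast_natCast, zpow_natCast] at this

lemma zmodPow_add {T : Aˣ} (hT : T ^ p = 1) (c d : ZMod p) :
    zmodPow T (c + d) = zmodPow T c * zmodPow T d := by
  have h := zmodPow_natCast hT (c.val + d.val)
  rw [Nat.cast_add, ZMod.natCast_zmod_val, ZMod.natCast_zmod_val, pow_add] at h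
  exact h

lemma zmodPow_zero (T : Aˣ) : zmodPow T (0 : ZMod p) = 1 := by simp [zmodPow]

lemma zmodPow_one {T : Aˣ} (hT : T ^ p = 1) : zmodPow T (1 : ZMod p) = T := by
  simpa using zmodPow_natCast (p := p) hT 1

lemma zmodPow_mul_neg {T : Aˣ} (hT : T ^ p = 1) (c : ZMod p) :
    (zmodPow T c : A) * zmodPow T (-c) = 1 := by
  rw [← Units.val_mul, ← zmodPow_add hT, add_neg_cancel, zmodPow_zero, Units.val_one]

lemma zmodPow_neg_mul {T : Aˣ} (hT : T ^ p = 1) (c : ZMod p) :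
    (zmodPow T (-c) : A) * zmodPow T c = 1 := by
  rw [← Units.val_mul, ← zmodPow_add hT, neg_add_cancel, zmodPow_zero, Units.val_one]

omit [Fact p.Prime] in
lemma zmodPow_commute {T : Aˣ} {x : A} (h : Commute (T : A) x) (c : ZMod p) :
    Commute (zmodPow T c : A) x := by
  rw [zmodPow, Units.val_pow_eq_pow_val]
  exact h.pow_left _

lemma zmodPow_semiconj {T T' : Aˣ} (hT : T ^ p = 1) {v : A}
    (h : (T : A) * v = v * zmodPow T' (-1 : ZMod p)) (hT' : T' ^ p = 1) (c : ZMod p) :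
    (zmodPow T c : A) * v = v * zmodPow T' (-c) := by
  have key : ∀ k : ℕ, (zmodPow T (k : ZMod p) : A) * v = v * zmodPow T' (-(k : ZMod p)) := by
    intro k
    induction k with
    | zero => simp [zmodPow_zero]
    | succ k ih =>
      rw [Nat.cast_succ, zmodPow_add hT, zmodPow_one hT, Units.val_mul, mul_assoc, h, ← mul_assoc,
        ih, neg_add, zmodPow_add hT', Units.val_mul, mul_assoc]
  have := key c.val
  rwa [ZMod.natCast_zmod_val] at this

end ZModPow

/-! ### The Jordanian twist -/

section Twist

variable {R A : Type*} [CommRing R] [Ring A] [Algebra R A] {p : ℕ} [Fact p.Prime] [CharP R p]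

/-- The data of a modular Jordanian twist: `T = 1 - e t` and `T' = 1 + e t` have order dividing `p`,
and `h` is semisimple with eigenvalues in the prime field. -/
structure TwistData (p : ℕ) (h e : A) (t : R) (T T' : Aˣ) : Prop where
  pow_h : h ^ p = h
  lie : h * e = e * h + e
  T_eq : (T : A) = 1 - t • e
  T'_eq : (T' : A) = 1 + t • e
  pow_T : T ^ p = 1
  pow_T' : T' ^ p = 1

variable (R p) in
/-- The element `∑ π_c T ^ c`. -/
noncomputable def diagSum (h : A) (T : Aˣ) : A := ∑ c : ZMod p, specProj R p h c * zmodPow T c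

lemma specProj_mul_diagSum {h : A} (hh : h ^ p = h) (T : Aˣ) (c : ZMod p) :
    specProj R p h c * diagSum R p h T = specProj R p h c * zmodPow T c := by
  rw [diagSum, Finset.mul_sum, Finset.sum_eq_single c]
  · rw [← mul_assoc, specProj_mul_specProj hh, if_pos rfl]
  · intro d _ hd
    rw [← mul_assoc, specProj_mul_specProj hh, if_neg hd.symm, zero_mul]
  · simp

namespace TwistData

variable {h e : A} {t : R} {T T' : Aˣ}

-- Changing the sign of `t` exchanges `T` and `T'`, so each identity for V yields one for its
-- inverse.
omit [Fact p.Prime] [CharP R p] in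
lemma symm (D : TwistData p h e t T T') : TwistData p h e (-t) T' T where
  pow_h := D.pow_h
  lie := D.lie
  T_eq := by rw [D.T'_eq, neg_smul, sub_neg_eq_add]
  T'_eq := by rw [D.T_eq, neg_smul, sub_eq_add_neg]
  pow_T := D.pow_T'
  pow_T' := D.pow_T

/-- Since e raises the h-eigenvalue by one, e V = V T'⁻¹ e. Hence (1 - te) V = V T'⁻¹ (T' - te) = V
T'⁻¹. -/
lemma mul_diagSum (D : TwistData p h e t T T') :
    (T : A) * diagSum R p h T' = diagSum R p h T' * zmodPow T' (-1 : ZMod p) := by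
  have hcomm : Commute (T' : A) e := by
    rw [D.T'_eq]
    exact (Commute.one_left e).add_left ((Commute.refl e).smul_left t)
  have hlie : h * e = e * h + (1 : ℤ) • e := by rw [one_zsmul, D.lie]
  have he : e * diagSum R p h T' = diagSum R p h T' * (zmodPow T' (-1 : ZMod p) * e) := by
    rw [diagSum, Finset.mul_sum, Finset.sum_mul]
    refine Fintype.sum_equiv (Equiv.addRight (1 : ZMod p)) _ _ fun c => ?_
    rw [Equiv.coe_addRight, zmodPow_add D.pow_T', ← mul_assoc, mul_specProj_eq hlie, Int.cast_one,
      mul_assoc, mul_assoc, Units.val_mul, mul_assoc,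
      ← mul_assoc (zmodPow T' (1 : ZMod p) : A), zmodPow_mul_neg D.pow_T', one_mul,
      (zmodPow_commute hcomm c).eq]
  have hinv : (zmodPow T' (-1 : ZMod p) : A) * T' = 1 := by
    have := zmodPow_neg_mul D.pow_T' (1 : ZMod p)
    rwa [zmodPow_one D.pow_T'] at this
  have h1 : diagSum R p h T' = diagSum R p h T' * (zmodPow T' (-1 : ZMod p) * (1 + t • e)) := by
    rw [← D.T'_eq, hinv, mul_one]
  rw [D.T_eq, sub_mul, one_mul, smul_mul_assoc, he, sub_eq_iff_eq_add]
  conv_lhs => rw [h1]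
  simp only [mul_add, mul_one, mul_smul_comm]

lemma zmodPow_mul_diagSum (D : TwistData p h e t T T') (c : ZMod p) :
    (zmodPow T c : A) * diagSum R p h T' = diagSum R p h T' * zmodPow T' (-c) :=
  zmodPow_semiconj D.pow_T D.mul_diagSum D.pow_T' c

/-- Termwise, π_c T^c V = π_c V T'^(-c) = π_c T'^c T'^(-c) = π_c, and the idempotents sum to 1. -/
lemma diagSum_mul_diagSum (D : TwistData p h e t T T') :
    diagSum R p h T * diagSum R p h T' = 1 := by
  conv_lhs => rw [diagSum]
  rw [Finset.sum_mul, ← sum_specProj (R := R) (p := p) h]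
  refine Finset.sum_congr rfl fun c _ => ?_
  rw [mul_assoc, D.zmodPow_mul_diagSum, ← mul_assoc, specProj_mul_diagSum D.pow_h, mul_assoc,
    zmodPow_mul_neg D.pow_T', mul_one]

/-- The Drinfeld element of the twist. -/
noncomputable def unitV (D : TwistData p h e t T T') : Aˣ where
  val := diagSum R p h T'
  inv := diagSum R p h T
  val_inv := D.symm.diagSum_mul_diagSum
  inv_val := D.diagSum_mul_diagSum

lemma coe_unitV (D : TwistData p h e t T T') : (D.unitV : A) = diagSum R p h T' := rfl

lemma coe_unitV_inv (D : TwistData p h e t T T') : ((D.unitV⁻¹ : Aˣ) : A) = diagSum R p h T := rfl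

/-- The twisting element `∑ π_c ⊗ T ^ c`. -/
noncomputable def unitF (D : TwistData p h e t T T') : (A ⊗[R] A)ˣ where
  val := ∑ c : ZMod p, specProj R p h c ⊗ₜ[R] (zmodPow T c : A)
  inv := ∑ c : ZMod p, specProj R p h c ⊗ₜ[R] (zmodPow T (-c) : A)
  val_inv := by
    simp only [Finset.sum_mul_sum, Algebra.TensorProduct.tmul_mul_tmul,
      specProj_mul_specProj D.pow_h, TensorProduct.ite_tmul]
    simp [zmodPow_mul_neg D.pow_T, ← TensorProduct.sum_tmul, sum_specProj,
      Algebra.TensorProduct.one_def]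
  inv_val := by
    simp only [Finset.sum_mul_sum, Algebra.TensorProduct.tmul_mul_tmul,
      specProj_mul_specProj D.pow_h, TensorProduct.ite_tmul]
    simp [zmodPow_neg_mul D.pow_T, ← TensorProduct.sum_tmul, sum_specProj,
      Algebra.TensorProduct.one_def]

lemma coe_unitF (D : TwistData p h e t T T') :
    (D.unitF : A ⊗[R] A) = ∑ c : ZMod p, specProj R p h c ⊗ₜ[R] (zmodPow T c : A) := rfl

lemma coe_unitF_inv (D : TwistData p h e t T T') : ((D.unitF⁻¹ : (A ⊗[R] A)ˣ) : A ⊗[R] A) =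
    ∑ c : ZMod p, specProj R p h c ⊗ₜ[R] (zmodPow T (-c) : A) := rfl

lemma unitF_conj_specProj (D : TwistData p h e t T T') (c : ZMod p) (y : A) :
    (D.unitF : A ⊗[R] A) * (specProj R p h c ⊗ₜ y) * ((D.unitF⁻¹ : (A ⊗[R] A)ˣ) : A ⊗[R] A) =
      specProj R p h c ⊗ₜ (zmodPow T c * y * zmodPow T (-c)) := by
  rw [coe_unitF, coe_unitF_inv]
  simp only [Finset.sum_mul, Finset.mul_sum, Algebra.TensorProduct.tmul_mul_tmul,
    specProj_mul_specProj D.pow_h, TensorProduct.ite_tmul, ite_mul,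
    zero_mul]
  simp

lemma unitF_conj_one_tmul (D : TwistData p h e t T T') (y : A) :
    (D.unitF : A ⊗[R] A) * (1 ⊗ₜ y) * ((D.unitF⁻¹ : (A ⊗[R] A)ˣ) : A ⊗[R] A) =
      ∑ c : ZMod p, specProj R p h c ⊗ₜ (zmodPow T c * y * zmodPow T (-c)) := by
  rw [← sum_specProj (R := R) (p := p) h, TensorProduct.sum_tmul, Finset.mul_sum, Finset.sum_mul]
  exact Finset.sum_congr rfl fun c _ => D.unitF_conj_specProj c y

/-- Moving `x` to the left of π_c shifts the residue by `w`; reindexing the sum F then leaves T^w as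
a factor of the second leg. -/
lemma unitF_conj_tmul_one (D : TwistData p h e t T T') {x : A} {w : ℤ}
    (hx : h * x = x * h + w • x) :
    (D.unitF : A ⊗[R] A) * (x ⊗ₜ 1) * ((D.unitF⁻¹ : (A ⊗[R] A)ˣ) : A ⊗[R] A) =
      x ⊗ₜ (zmodPow T (w : ZMod p) : A) := by
  rw [Units.mul_inv_eq_iff_eq_mul, coe_unitF, Finset.sum_mul, Finset.mul_sum]
  refine Fintype.sum_equiv (Equiv.subRight (w : ZMod p)) _ _ fun c => ?_
  rw [Equiv.subRight_apply, Algebra.TensorProduct.tmul_mul_tmul,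
    Algebra.TensorProduct.tmul_mul_tmul, specProj_mul hx, mul_one, ← Units.val_mul,
    ← zmodPow_add D.pow_T, add_sub_cancel]

end TwistData

/-- Conjugation by a unit. -/
def conjHom (R : Type*) {B : Type*} [CommRing R] [Ring B] [Algebra R B] (u : Bˣ) : B →ₐ[R] B where
  toFun b := u * b * ((u⁻¹ : Bˣ) : B)
  map_one' := by simp
  map_mul' a b := by simp [mul_assoc]
  map_zero' := by simp
  map_add' a b := by simp [mul_add, add_mul]
  commutes' r := by rw [← (Algebra.commutes r (u : B)), mul_assoc, Units.mul_inv, mul_one]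

end Twist

/-! ### Values of the twisted coproduct, counit and antipode -/

section TwistHopf

variable {R A : Type*} [CommRing R] [Ring A] [Algebra R A] {p : ℕ} [Fact p.Prime] [CharP R p]
  {h e : A} {t : R} {T T' : Aˣ}

namespace TwistData

/-- The twisted comultiplication. -/
noncomputable def comulHom (D : TwistData p h e t T T') (Δ : A →ₐ[R] A ⊗[R] A) :
    A →ₐ[R] A ⊗[R] A :=
  (conjHom R D.unitF).comp Δ

/-- The twisted antipode, as a homomorphism to the opposite algebra. -/
noncomputable def antipodeHom (D : TwistData p h e t T T') (S : A →ₐ[R] Aᵐᵒᵖ) : A →ₐ[R] Aᵐᵒᵖ where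
  toFun a := MulOpposite.op (D.unitV * (S a).unop * ((D.unitV⁻¹ : Aˣ) : A))
  map_one' := by simp
  map_mul' a b := by
    rw [← MulOpposite.op_mul, map_mul, MulOpposite.unop_mul]
    simp [mul_assoc]
  map_zero' := by simp
  map_add' a b := by simp [mul_add, add_mul]
  commutes' r := by
    rw [AlgHom.commutes, MulOpposite.algebraMap_apply, MulOpposite.unop_op,
      ← (Algebra.commutes r (D.unitV : A)), mul_assoc, Units.mul_inv, mul_one]

section Values

variable (D : TwistData p h e t T T') {Δ : A →ₐ[R] A ⊗[R] A} {ε : A →ₐ[R] R} {S : A →ₐ[R] Aᵐᵒᵖ}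

include D in
omit [Fact p.Prime] [CharP R p] in
lemma commute_T_e : Commute (T : A) e := by
  rw [D.T_eq]
  exact (Commute.one_left e).sub_left ((Commute.refl e).smul_left t)

include D in
omit [Fact p.Prime] [CharP R p] in
lemma lie_int : h * e = e * h + (1 : ℤ) • e := by rw [one_zsmul, D.lie]

lemma comulHom_apply (a : A) : D.comulHom Δ a =
    D.unitF * Δ a * ((D.unitF⁻¹ : (A ⊗[R] A)ˣ) : A ⊗[R] A) := rfl

lemma comulHom_primitive {x : A} (hΔ : Δ x = x ⊗ₜ 1 + 1 ⊗ₜ x) {w : ℤ}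
    (hx : h * x = x * h + w • x) :
    D.comulHom Δ x = x ⊗ₜ (zmodPow T (w : ZMod p) : A) +
      ∑ c : ZMod p, specProj R p h c ⊗ₜ (zmodPow T c * x * zmodPow T (-c)) := by
  rw [comulHom_apply, hΔ, mul_add, add_mul, D.unitF_conj_tmul_one hx, D.unitF_conj_one_tmul]

/-- As T commutes with e, the twisted coproduct of e is e ⊗ T + 1 ⊗ e, and this makes T = 1 - te
grouplike. -/
lemma comulHom_zmodPow (hΔ : Δ e = e ⊗ₜ 1 + 1 ⊗ₜ e) (c : ZMod p) :
    D.comulHom Δ (zmodPow T c : A) = (zmodPow T c : A) ⊗ₜ (zmodPow T c : A) := by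
  have he : D.comulHom Δ e = e ⊗ₜ (T : A) + 1 ⊗ₜ e := by
    rw [D.comulHom_primitive hΔ D.lie_int, Int.cast_one, zmodPow_one D.pow_T]
    congr 1
    have : ∀ c : ZMod p, (zmodPow T c : A) * e * zmodPow T (-c) = e := fun c => by
      rw [(zmodPow_commute D.commute_T_e c).eq, mul_assoc, zmodPow_mul_neg D.pow_T, mul_one]
    simp only [this]
    rw [← TensorProduct.sum_tmul, sum_specProj]
  have hT : D.comulHom Δ (T : A) = (T : A) ⊗ₜ (T : A) := by
    conv_lhs => rw [D.T_eq]
    rw [map_sub, map_one, map_smul, he, smul_add, TensorProduct.smul_tmul',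
      ← TensorProduct.tmul_smul,
      Algebra.TensorProduct.one_def]
    have h1 : t • e = 1 - (T : A) := by rw [D.T_eq]; abel
    rw [h1, TensorProduct.sub_tmul, TensorProduct.tmul_sub]
    abel
  rw [zmodPow, Units.val_pow_eq_pow_val, map_pow, hT, Algebra.TensorProduct.tmul_pow]

/-- Before twisting, the eigenvalues of h ⊗ 1 + 1 ⊗ h add up, so π_a goes to ∑ π_c ⊗ π_(a-c);
conjugation by F acts on each summand separately. -/
lemma comulHom_specProj (hΔ : Δ h = h ⊗ₜ 1 + 1 ⊗ₜ h) (a : ZMod p) :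
    D.comulHom Δ (specProj R p h a) =
      ∑ c : ZMod p, specProj R p h c ⊗ₜ
        (zmodPow T c * specProj R p h (a - c) * zmodPow T (-c)) := by
  have h1 : Δ (specProj R p h a) = ∑ c : ZMod p, specProj R p h c ⊗ₜ specProj R p h (a - c) := by
    have h2 : (1 : A ⊗[R] A) =
        ∑ c : ZMod p, ∑ d : ZMod p, specProj R p h c ⊗ₜ specProj R p h d := by
      simp only [← TensorProduct.tmul_sum, ← TensorProduct.sum_tmul, sum_specProj,
        Algebra.TensorProduct.one_def]
    rw [specProj, ← Polynomial.aeval_algHom_apply, ← mul_one (Polynomial.aeval (Δ h) _), h2]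
    simp only [Finset.mul_sum]
    refine Finset.sum_congr rfl fun c _ => ?_
    have h3 : ∀ d : ZMod p, Polynomial.aeval (Δ h) (projPoly R p a) *
        (specProj R p h c ⊗ₜ[R] specProj R p h d) =
        if d = a - c then specProj R p h c ⊗ₜ[R] specProj R p h d else 0 := by
      intro d
      rw [aeval_mul_of_mul_eq_smul (r := residue R p (c + d)), projPoly_eval_residue, ite_smul,
        one_smul, zero_smul]
      · exact if_congr ⟨fun h => by rw [h]; ring, fun h => by rw [h]; ring⟩ rfl rfl
      · rw [hΔ, add_mul, Algebra.TensorProduct.tmul_mul_tmul, Algebra.TensorProduct.tmul_mul_tmul,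
          mul_specProj D.pow_h, mul_specProj D.pow_h, one_mul, one_mul, map_add, add_smul,
          TensorProduct.smul_tmul', TensorProduct.tmul_smul]
    simp only [h3]
    simp
  rw [comulHom_apply, h1, Finset.mul_sum, Finset.sum_mul]
  exact Finset.sum_congr rfl fun c _ => D.unitF_conj_specProj c _

include D in
omit [Fact p.Prime] [CharP R p] in
lemma counit_zmodPow (hε : ε e = 0) (c : ZMod p) : ε (zmodPow T c : A) = 1 := by
  rw [zmodPow, Units.val_pow_eq_pow_val, map_pow, D.T_eq]
  simp [hε]

lemma counit_specProj (hε : ε h = 0) (c : ZMod p) :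
    ε (specProj R p h c) = if c = 0 then 1 else 0 := by
  rw [specProj, ← Polynomial.aeval_algHom_apply, hε, Polynomial.aeval_def,
    Polynomial.eval₂_eq_eval_map, Algebra.algebraMap_self, Polynomial.map_id]
  simpa using projPoly_eval_residue (R := R) c (0 : ZMod p)

lemma antipodeHom_unop (a : A) : (D.antipodeHom S a).unop =
    D.unitV * (S a).unop * ((D.unitV⁻¹ : Aˣ) : A) := rfl

/-- The untwisted antipode takes T to T', and conjugation by V takes T'^c to T^(-c). -/
lemma antipodeHom_zmodPow (hS : S e = MulOpposite.op (-e)) (c : ZMod p) :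
    (D.antipodeHom S (zmodPow T c : A)).unop = zmodPow T (-c) := by
  have hT : S (T : A) = MulOpposite.op (T' : A) := by
    rw [D.T_eq, D.T'_eq, map_sub, map_smul, hS, map_one]
    simp
  have h1 : (S (zmodPow T c : A)).unop = zmodPow T' c := by
    rw [zmodPow, Units.val_pow_eq_pow_val, map_pow, hT, zmodPow, Units.val_pow_eq_pow_val]
    simp
  rw [antipodeHom_unop, h1, Units.mul_inv_eq_iff_eq_mul, coe_unitV, D.zmodPow_mul_diagSum, neg_neg]

lemma antipodeHom_specProj (hp : p ≠ 2) (hS : S h = MulOpposite.op (-h)) (c : ZMod p) :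
    (D.antipodeHom S (specProj R p h c)).unop =
      D.unitV * specProj R p h (-c) * ((D.unitV⁻¹ : Aˣ) : A) := by
  have h1 : (S (specProj R p h c)).unop = specProj R p h (-c) := by
    -- The even exponent absorbs the sign in -h - c = -(h - (-c)).
    have heven : Even (p - 1) := (Fact.out : p.Prime).even_sub_one hp
    have h2 : ((-h - algebraMap R A (residue R p c)) : A) =
        - (h - algebraMap R A (residue R p (-c))) := by
      rw [map_neg, map_neg]
      abel
    rw [specProj_eq, specProj_eq, map_sub, map_pow, map_sub, hS, AlgHom.commutes, map_one,
      MulOpposite.algebraMap_apply, ← MulOpposite.op_sub, ← MulOpposite.op_pow, h2, heven.neg_pow,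
      MulOpposite.unop_sub, MulOpposite.unop_one, MulOpposite.unop_op]
  rw [antipodeHom_unop, h1]

lemma antipodeHom_primitive {x : A} (hS : S x = MulOpposite.op (-x)) :
    (D.antipodeHom S x).unop = - (D.unitV * x * ((D.unitV⁻¹ : Aˣ) : A)) := by
  rw [antipodeHom_unop, hS, MulOpposite.unop_op, mul_neg, neg_mul]

end Values

end TwistData

end TwistHopf

/-! ### The Hopf axioms, checked on generators -/

section TwistHopf

variable {R A : Type*} [CommRing R] [Ring A] [Algebra R A] {p : ℕ} [Fact p.Prime] [CharP R p]
  {h e : A} {T T' : Aˣ} {t : R}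

/-- The antipode axioms need only be checked on algebra generators. -/
lemma antipode_left_of_adjoin (Δ : A →ₐ[R] A ⊗[R] A) (ε : A →ₐ[R] R) (S : A →ₐ[R] Aᵐᵒᵖ)
    (X : Set A) (hX : Algebra.adjoin R X = ⊤) (f : A →ₗ[R] A) (hf : ∀ a, f a = (S a).unop)
    (h : ∀ x ∈ X, LinearMap.mul' R A (f.rTensor A (Δ x)) = algebraMap R A (ε x)) (a : A) :
    LinearMap.mul' R A (f.rTensor A (Δ a)) = algebraMap R A (ε a) := by
  have key : ∀ (u : A ⊗[R] A) (x y : A), LinearMap.mul' R A (f.rTensor A (u * (x ⊗ₜ y))) =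
      f x * LinearMap.mul' R A (f.rTensor A u) * y := by
    intro u x y
    induction u using TensorProduct.induction_on with
    | zero => simp
    | tmul a b => simp [hf, mul_assoc]
    | add u v hu hv => rw [add_mul, map_add, map_add, hu, hv, map_add, map_add, mul_add, add_mul]
  have ha : a ∈ Algebra.adjoin R X := by rw [hX]; trivial
  induction ha using Algebra.adjoin_induction with
  | mem x hx => exact h x hx
  | algebraMap r => simp [hf, Algebra.TensorProduct.algebraMap_apply]
  | add a b _ _ iha ihb => simp only [map_add, iha, ihb]
  | mul a b _ _ iha ihb =>
    -- The antihomomorphism `S` puts the legs of `Δ a` next to each other inside those of `v`; there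
    -- they collapse to the scalar `ε a`, which can be moved out.
    have h2 : ∀ v : A ⊗[R] A, LinearMap.mul' R A (f.rTensor A (Δ a * v)) =
        algebraMap R A (ε a) * LinearMap.mul' R A (f.rTensor A v) := by
      intro v
      induction v using TensorProduct.induction_on with
      | zero => simp
      | tmul x y =>
        rw [key, iha, ← Algebra.commutes, LinearMap.rTensor_tmul, LinearMap.mul'_apply, mul_assoc]
      | add u v hu hv => rw [mul_add, map_add, map_add, hu, hv, map_add, map_add, mul_add]
    rw [map_mul, h2, ihb, map_mul, map_mul]

lemma antipode_right_of_adjoin (Δ : A →ₐ[R] A ⊗[R] A) (ε : A →ₐ[R] R) (S : A →ₐ[R] Aᵐᵒᵖ)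
    (X : Set A) (hX : Algebra.adjoin R X = ⊤) (f : A →ₗ[R] A) (hf : ∀ a, f a = (S a).unop)
    (h : ∀ x ∈ X, LinearMap.mul' R A (f.lTensor A (Δ x)) = algebraMap R A (ε x)) (a : A) :
    LinearMap.mul' R A (f.lTensor A (Δ a)) = algebraMap R A (ε a) := by
  have key : ∀ (u : A ⊗[R] A) (x y : A), LinearMap.mul' R A (f.lTensor A ((x ⊗ₜ y) * u)) =
      x * LinearMap.mul' R A (f.lTensor A u) * f y := by
    intro u x y
    induction u using TensorProduct.induction_on with
    | zero => simp
    | tmul a b => simp [hf, mul_assoc]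
    | add u v hu hv => rw [mul_add, map_add, map_add, hu, hv, map_add, map_add, mul_add, add_mul]
  have ha : a ∈ Algebra.adjoin R X := by rw [hX]; trivial
  induction ha using Algebra.adjoin_induction with
  | mem x hx => exact h x hx
  | algebraMap r => simp [hf, Algebra.TensorProduct.algebraMap_apply]
  | add a b _ _ iha ihb => simp only [map_add, iha, ihb]
  | mul a b _ _ iha ihb =>
    have h2 : ∀ v : A ⊗[R] A, LinearMap.mul' R A (f.lTensor A (v * Δ b)) =
        algebraMap R A (ε b) * LinearMap.mul' R A (f.lTensor A v) := by
      intro v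
      induction v using TensorProduct.induction_on with
      | zero => simp
      | tmul x y =>
        rw [key, ihb, ← Algebra.commutes, LinearMap.lTensor_tmul, LinearMap.mul'_apply, mul_assoc]
      | add u v hu hv => rw [add_mul, map_add, map_add, hu, hv, map_add, map_add, mul_add]
    rw [map_mul, h2, iha, map_mul, map_mul, Algebra.commutes]

namespace TwistData

variable (D : TwistData p h e t T T') {Δ : A →ₐ[R] A ⊗[R] A} {ε : A →ₐ[R] R} {S : A →ₐ[R] Aᵐᵒᵖ}

/-- Since T^c is grouplike, conjugation by it becomes conjugation by T^c ⊗ T^c. These elements occur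
in the second leg of the closed form, so they are what coassociativity requires. -/
lemma comulHom_conj_primitive (hΔe : Δ e = e ⊗ₜ 1 + 1 ⊗ₜ e) {x : A}
    (hΔ : Δ x = x ⊗ₜ 1 + 1 ⊗ₜ x) {w : ℤ} (hx : h * x = x * h + w • x) (c : ZMod p) :
    D.comulHom Δ (zmodPow T c * x * zmodPow T (-c)) =
      (zmodPow T c * x * zmodPow T (-c)) ⊗ₜ (zmodPow T (w : ZMod p) : A) +
      ∑ d : ZMod p, (zmodPow T c * specProj R p h d * zmodPow T (-c)) ⊗ₜ
        (zmodPow T (c + d) * x * zmodPow T (-(c + d))) := by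
  rw [map_mul, map_mul, D.comulHom_zmodPow hΔe, D.comulHom_zmodPow hΔe,
    D.comulHom_primitive hΔ hx, mul_add, add_mul, Finset.mul_sum, Finset.sum_mul]
  simp only [Algebra.TensorProduct.tmul_mul_tmul]
  congr 1
  · rw [← Units.val_mul, ← Units.val_mul, ← zmodPow_add D.pow_T, ← zmodPow_add D.pow_T,
      add_comm c, add_neg_cancel_right]
  · refine Finset.sum_congr rfl fun d _ => ?_
    rw [neg_add, add_comm (-c), zmodPow_add D.pow_T, zmodPow_add D.pow_T, Units.val_mul,
      Units.val_mul]
    simp only [mul_assoc]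

/-- Both sides expand to x ⊗ T^w ⊗ T^w + ∑ π_c ⊗ T^c x T^(-c) ⊗ T^w plus a double sum; the double
sums match under a = c + d. -/
lemma coassoc_primitive (hΔh : Δ h = h ⊗ₜ 1 + 1 ⊗ₜ h) (hΔe : Δ e = e ⊗ₜ 1 + 1 ⊗ₜ e) {x : A}
    (hΔ : Δ x = x ⊗ₜ 1 + 1 ⊗ₜ x) {w : ℤ} (hx : h * x = x * h + w • x) :
    TensorProduct.assoc R A A A
      (TensorProduct.map (D.comulHom Δ).toLinearMap .id (D.comulHom Δ x)) =
    TensorProduct.map .id (D.comulHom Δ).toLinearMap (D.comulHom Δ x) := by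
  have hprim := D.comulHom_primitive hΔ hx
  have hconj := D.comulHom_conj_primitive hΔe hΔ hx
  have hproj := D.comulHom_specProj hΔh
  have hpow := D.comulHom_zmodPow hΔe (w : ZMod p)
  generalize D.comulHom Δ = Δ' at *
  rw [hprim, map_add, map_add, map_add, map_sum, map_sum, map_sum]
  simp only [TensorProduct.map_tmul, LinearMap.id_apply, AlgHom.toLinearMap_apply, hpow, hproj,
    hconj]
  rw [hprim]
  simp only [TensorProduct.add_tmul, TensorProduct.tmul_add, TensorProduct.sum_tmul,
    TensorProduct.tmul_sum, map_add, map_sum, TensorProduct.assoc_tmul, Finset.sum_add_distrib]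
  have key : ∑ a : ZMod p, ∑ c : ZMod p, specProj R p h c ⊗ₜ[R]
      ((zmodPow T c * specProj R p h (a - c) * zmodPow T (-c) : A) ⊗ₜ[R]
        (zmodPow T a * x * zmodPow T (-a) : A)) =
      ∑ c : ZMod p, ∑ d : ZMod p, specProj R p h c ⊗ₜ[R]
        ((zmodPow T c * specProj R p h d * zmodPow T (-c) : A) ⊗ₜ[R]
          (zmodPow T (c + d) * x * zmodPow T (-(c + d)) : A)) := by
    rw [Finset.sum_comm]
    refine Finset.sum_congr rfl fun c _ => ?_
    refine Fintype.sum_equiv (Equiv.subRight c) _ _ fun d => ?_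
    rw [Equiv.subRight_apply, add_sub_cancel]
  rw [key, add_assoc]

lemma counit_left_primitive (hεh : ε h = 0) {x : A} (hΔ : Δ x = x ⊗ₜ 1 + 1 ⊗ₜ x) (hε : ε x = 0)
    {w : ℤ} (hx : h * x = x * h + w • x) :
    Algebra.TensorProduct.map ε (.id R A) (D.comulHom Δ x) = 1 ⊗ₜ x := by
  rw [D.comulHom_primitive hΔ hx]
  simp [hε, counit_specProj hεh, TensorProduct.ite_tmul, zmodPow_zero]

lemma counit_right_primitive (hεe : ε e = 0) {x : A} (hΔ : Δ x = x ⊗ₜ 1 + 1 ⊗ₜ x) (hε : ε x = 0)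
    {w : ℤ} (hx : h * x = x * h + w • x) :
    Algebra.TensorProduct.map (.id R A) ε (D.comulHom Δ x) = x ⊗ₜ 1 := by
  rw [D.comulHom_primitive hΔ hx]
  simp [hε, D.counit_zmodPow hεe]

lemma specProj_mul_unitV (c : ZMod p) :
    specProj R p h c * (D.unitV : A) = specProj R p h c * zmodPow T' c :=
  specProj_mul_diagSum D.pow_h T' c

lemma zmodPow_mul_unitV (c : ZMod p) :
    (zmodPow T c : A) * D.unitV = D.unitV * zmodPow T' (-c) := D.zmodPow_mul_diagSum c

lemma zmodPow_mul_unitV_inv (c : ZMod p) :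
    (zmodPow T' c : A) * ((D.unitV⁻¹ : Aˣ) : A) = ((D.unitV⁻¹ : Aˣ) : A) * zmodPow T (-c) :=
  D.symm.zmodPow_mul_diagSum c

/-- Because π_(-c) V⁻¹ T^c = π_(-c), the c-th summand equals V x π_(-c-w) T^(-c). The sum over c
rebuilds V x V⁻¹ T^w, which cancels the contribution of x ⊗ T^w. -/
lemma antipode_left_primitive (hp : p ≠ 2) (hSh : S h = MulOpposite.op (-h))
    {x : A} (hΔ : Δ x = x ⊗ₜ 1 + 1 ⊗ₜ x) (hS : S x = MulOpposite.op (-x))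
    {w : ℤ} (hx : h * x = x * h + w • x) (f : A →ₗ[R] A)
    (hf : ∀ a, f a = (D.antipodeHom S a).unop) :
    LinearMap.mul' R A (f.rTensor A (D.comulHom Δ x)) = 0 := by
  rw [D.comulHom_primitive hΔ hx, map_add, map_add, map_sum, map_sum]
  simp only [LinearMap.rTensor_tmul, LinearMap.mul'_apply, hf, D.antipodeHom_primitive hS,
    D.antipodeHom_specProj hp hSh]
  have hterm : ∀ c : ZMod p, D.unitV * specProj R p h (-c) * ((D.unitV⁻¹ : Aˣ) : A) *
      (zmodPow T c * x * zmodPow T (-c)) =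
      (D.unitV : A) * x * (specProj R p h (-c - w) * zmodPow T (-c)) := by
    intro c
    have h1 : specProj R p h (-c) * (((D.unitV⁻¹ : Aˣ) : A) * zmodPow T c) =
        specProj R p h (-c) := by
      have := D.zmodPow_mul_unitV_inv (-c)
      rw [neg_neg] at this
      rw [← this, ← mul_assoc, ← D.specProj_mul_unitV, mul_assoc, Units.mul_inv, mul_one]
    calc _ = (D.unitV : A) * (specProj R p h (-c) * (((D.unitV⁻¹ : Aˣ) : A) * zmodPow T c)) *
          x * zmodPow T (-c) := by simp only [mul_assoc]
      _ = _ := by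
        rw [h1, mul_assoc (D.unitV : A), specProj_mul hx]
        simp only [mul_assoc]
  simp only [hterm]
  have hsum : ∑ c : ZMod p, specProj R p h (-c - w) * (zmodPow T (-c) : A) =
      ((D.unitV⁻¹ : Aˣ) : A) * zmodPow T (w : ZMod p) := by
    rw [coe_unitV_inv, diagSum, Finset.sum_mul]
    refine Fintype.sum_equiv ((Equiv.neg _).trans (Equiv.subRight (w : ZMod p))) _ _ fun c => ?_
    rw [Equiv.trans_apply, Equiv.neg_apply, Equiv.subRight_apply, mul_assoc, ← Units.val_mul,
      ← zmodPow_add D.pow_T, sub_add_cancel]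
  rw [← Finset.mul_sum, hsum]
  simp only [mul_assoc, neg_mul]
  exact neg_add_cancel _

/-- Because π_c T^c V = π_c, the c-th summand equals -x π_(c-w) T'^c V⁻¹. The sum is -x V T'^w V⁻¹ =
-x T^(-w), the negative of the contribution of x ⊗ T^w. -/
lemma antipode_right_primitive (hSe : S e = MulOpposite.op (-e)) {x : A}
    (hΔ : Δ x = x ⊗ₜ 1 + 1 ⊗ₜ x) (hS : S x = MulOpposite.op (-x))
    {w : ℤ} (hx : h * x = x * h + w • x) (f : A →ₗ[R] A)
    (hf : ∀ a, f a = (D.antipodeHom S a).unop) :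
    LinearMap.mul' R A (f.lTensor A (D.comulHom Δ x)) = 0 := by
  rw [D.comulHom_primitive hΔ hx, map_add, map_add, map_sum, map_sum]
  simp only [LinearMap.lTensor_tmul, LinearMap.mul'_apply, hf, map_mul, MulOpposite.unop_mul,
    D.antipodeHom_primitive hS, D.antipodeHom_zmodPow hSe, neg_neg]
  have hterm : ∀ c : ZMod p, specProj R p h c * (zmodPow T c *
      (-(D.unitV * x * ((D.unitV⁻¹ : Aˣ) : A)) * zmodPow T (-c))) =
      -(x * (specProj R p h (c - w) * zmodPow T' c * ((D.unitV⁻¹ : Aˣ) : A))) := by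
    intro c
    calc _ = -(specProj R p h c * (zmodPow T c * D.unitV) * x *
          (((D.unitV⁻¹ : Aˣ) : A) * zmodPow T (-c))) := by
            simp only [mul_assoc, neg_mul, mul_neg]
      _ = -(specProj R p h c * x * (zmodPow T' c * ((D.unitV⁻¹ : Aˣ) : A))) := by
        rw [D.zmodPow_mul_unitV, ← mul_assoc (specProj R p h c), D.specProj_mul_unitV,
          mul_assoc (specProj R p h c), zmodPow_mul_neg D.pow_T', mul_one,
          ← D.zmodPow_mul_unitV_inv]
      _ = _ := by
        rw [specProj_mul hx]
        simp only [mul_assoc]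
  simp only [hterm]
  have hsum : ∑ c : ZMod p, specProj R p h (c - w) * zmodPow T' c * ((D.unitV⁻¹ : Aˣ) : A) =
      zmodPow T (-(w : ZMod p)) := by
    have h1 : ∑ c : ZMod p, specProj R p h (c - w) * (zmodPow T' c : A) =
        D.unitV * zmodPow T' (w : ZMod p) := by
      rw [coe_unitV, diagSum, Finset.sum_mul]
      refine Fintype.sum_equiv (Equiv.subRight (w : ZMod p)) _ _ fun c => ?_
      rw [Equiv.subRight_apply, mul_assoc, ← Units.val_mul, ← zmodPow_add D.pow_T', sub_add_cancel]
    rw [← Finset.sum_mul, h1, mul_assoc, D.zmodPow_mul_unitV_inv, ← mul_assoc, Units.mul_inv,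
      one_mul]
  rw [Finset.sum_neg_distrib, ← Finset.mul_sum, hsum, add_neg_cancel]

/-- The twisted bialgebra structure. -/
noncomputable abbrev bialgebra (hΔh : Δ h = h ⊗ₜ 1 + 1 ⊗ₜ h) (hΔe : Δ e = e ⊗ₜ 1 + 1 ⊗ₜ e)
    (hεh : ε h = 0) (hεe : ε e = 0) (X : Set A) (hX : Algebra.adjoin R X = ⊤)
    (hΔ : ∀ x ∈ X, Δ x = x ⊗ₜ 1 + 1 ⊗ₜ x) (hε : ∀ x ∈ X, ε x = 0)
    (hw : ∀ x ∈ X, ∃ w : ℤ, h * x = x * h + w • x) : Bialgebra R A :=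
  Bialgebra.ofAlgHom (D.comulHom Δ) ε
    (AlgHom.ext_of_adjoin_eq_top hX fun x hx => by
      obtain ⟨w, hw⟩ := hw x hx
      exact D.coassoc_primitive hΔh hΔe (hΔ x hx) hw)
    (AlgHom.ext_of_adjoin_eq_top hX fun x hx => by
      obtain ⟨w, hw⟩ := hw x hx
      exact D.counit_left_primitive hεh (hΔ x hx) (hε x hx) hw)
    (AlgHom.ext_of_adjoin_eq_top hX fun x hx => by
      obtain ⟨w, hw⟩ := hw x hx
      exact D.counit_right_primitive hεe (hΔ x hx) (hε x hx) hw)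

/-- The twisted Hopf algebra structure. -/
noncomputable abbrev hopfAlgebra (hp : p ≠ 2) (hΔh : Δ h = h ⊗ₜ 1 + 1 ⊗ₜ h)
    (hΔe : Δ e = e ⊗ₜ 1 + 1 ⊗ₜ e)
    (hεh : ε h = 0) (hεe : ε e = 0) (hSh : S h = MulOpposite.op (-h))
    (hSe : S e = MulOpposite.op (-e)) (X : Set A) (hX : Algebra.adjoin R X = ⊤)
    (hΔ : ∀ x ∈ X, Δ x = x ⊗ₜ 1 + 1 ⊗ₜ x) (hε : ∀ x ∈ X, ε x = 0)
    (hS : ∀ x ∈ X, S x = MulOpposite.op (-x))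
    (hw : ∀ x ∈ X, ∃ w : ℤ, h * x = x * h + w • x) : HopfAlgebra R A :=
  { D.bialgebra hΔh hΔe hεh hεe X hX hΔ hε hw with
    antipode := (MulOpposite.opLinearEquiv R).symm.toLinearMap ∘ₗ (D.antipodeHom S).toLinearMap
    mul_antipode_rTensor_comul := LinearMap.ext fun a =>
      antipode_left_of_adjoin (D.comulHom Δ) ε (D.antipodeHom S) X hX _ (fun _ => rfl)
        (fun x hx => by
          obtain ⟨w, hw⟩ := hw x hx
          rw [hε x hx, map_zero]
          exact D.antipode_left_primitive hp hSh (hΔ x hx) (hS x hx) hw _ fun _ => rfl) a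
    mul_antipode_lTensor_comul := LinearMap.ext fun a =>
      antipode_right_of_adjoin (D.comulHom Δ) ε (D.antipodeHom S) X hX _ (fun _ => rfl)
        (fun x hx => by
          obtain ⟨w, hw⟩ := hw x hx
          rw [hε x hx, map_zero]
          exact D.antipode_right_primitive hSe (hΔ x hx) (hS x hx) hw _ fun _ => rfl) a }

end TwistData

end TwistHopf

/-! ### The explicit formulas for the twisted coproduct and antipode -/

section TwistValues

variable {R A : Type*} [CommRing R] [Ring A] [Algebra R A] {p : ℕ} [Fact p.Prime] [CharP R p]
  {h e : A} {t : R} {T T' : Aˣ}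

-- Shifting the index creates a boundary term at ℓ = p, whose factor p is zero in `R`. This is why
-- sums truncated at p are stable under the recursions below.
omit [Fact p.Prime] in
lemma sum_range_shift_smul (b : ℕ → R) (G : ℕ → A) :
    ∑ ℓ ∈ Finset.range p, ((ℓ + 1) * b ℓ) • G (ℓ + 1) =
      ∑ ℓ ∈ Finset.range p, (ℓ * b (ℓ - 1)) • G ℓ := by
  have h1 := Finset.sum_range_succ (fun ℓ : ℕ => ((ℓ : R) * b (ℓ - 1)) • G ℓ) p
  rw [Finset.sum_range_succ'] at h1
  simpa using h1

namespace TwistData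

/-- The sequence `d` of divided powers of `ad e`, applied to an element of weight `w`. -/
structure DividedAd (p : ℕ) (h e : A) (w : ℤ) (x : A) (d : ℕ → A) : Prop where
  zero : d 0 = x
  succ : ∀ ℓ < p, e * d ℓ - d ℓ * e = (ℓ + 1) • d (ℓ + 1)
  weight : ∀ ℓ < p, h * d ℓ = d ℓ * h + (w + ℓ) • d ℓ

variable (D : TwistData p h e t T T') {w : ℤ} {x : A} {d : ℕ → A}

-- Induction on a natural number representing `c`. Moving T past `d ℓ` produces t(ℓ+1) `d (ℓ+1)`;
-- after an index shift the coefficients agree by the recursion for rising factorials.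
include D in
lemma zmodPow_mul_eq_sum (hd : DividedAd p h e w x d) (c : ZMod p) :
    (zmodPow T c : A) * x = ∑ ℓ ∈ Finset.range p, ((-1) ^ ℓ * t ^ ℓ * rising (residue R p c) ℓ) •
      ((zmodPow T (-(ℓ : ZMod p)) : A) * d ℓ * zmodPow T c) := by
  suffices key : ∀ n : ℕ, (zmodPow T (n : ZMod p) : A) * x = ∑ ℓ ∈ Finset.range p,
      ((-1) ^ ℓ * t ^ ℓ * rising (n : R) ℓ) •
      ((zmodPow T (-(ℓ : ZMod p)) : A) * d ℓ * zmodPow T (n : ZMod p)) by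
    have := key c.val
    rwa [ZMod.natCast_zmod_val, ← map_natCast (residue R p), ZMod.natCast_zmod_val] at this
  intro n
  induction n with
  | zero =>
    have hp := (Fact.out : p.Prime).pos
    rw [Finset.sum_eq_single 0]
    · simp [zmodPow_zero, rising, hd.zero]
    · intro ℓ _ hℓ
      obtain ⟨m, rfl⟩ := Nat.exists_eq_succ_of_ne_zero hℓ
      rw [Nat.cast_zero, Nat.succ_eq_add_one, rising_succ_left, zero_mul, mul_zero, zero_smul]
    · simp [hp]
  | succ n ih =>
    have hdT : ∀ ℓ < p, d ℓ * (T : A) = T * d ℓ + (t * (ℓ + 1)) • d (ℓ + 1) := by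
      intro ℓ hℓ
      have h1 := hd.succ ℓ hℓ
      have h2 : ((ℓ : R) + 1) • d (ℓ + 1) = e * d ℓ - d ℓ * e := by
        rw [h1, ← Nat.cast_smul_eq_nsmul R, Nat.cast_succ]
      rw [mul_smul, h2, D.T_eq, mul_sub, sub_mul, smul_sub, mul_smul_comm, smul_mul_assoc]
      simp
    -- Both sides become combinations of these elements, so only their coefficients have to be
    -- compared.
    let G : ℕ → A := fun ℓ => T * zmodPow T (-(ℓ : ZMod p)) * d ℓ * zmodPow T (n : ZMod p)
    have hstep : ∀ ℓ : ℕ, (zmodPow T (-(ℓ : ZMod p)) : A) =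
        T * zmodPow T (-((ℓ + 1 : ℕ) : ZMod p)) := by
      intro ℓ
      have := congrArg Units.val (zmodPow_add D.pow_T (1 : ZMod p) (-((ℓ + 1 : ℕ) : ZMod p)))
      rw [Units.val_mul, zmodPow_one D.pow_T] at this
      rw [← this]
      congr 2
      push_cast
      ring
    have hcomm : ∀ c : ZMod p, (zmodPow T c : A) * T = T * zmodPow T c := fun c =>
      (zmodPow_commute (Commute.refl (T : A)) c).eq
    have hL : (zmodPow T ((n + 1 : ℕ) : ZMod p) : A) * x = ∑ ℓ ∈ Finset.range p,
        ((-1) ^ ℓ * t ^ ℓ * rising (n : R) ℓ) • G ℓ := by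
      rw [Nat.cast_succ, add_comm, zmodPow_add D.pow_T, zmodPow_one D.pow_T, Units.val_mul,
        mul_assoc, ih, Finset.mul_sum]
      exact Finset.sum_congr rfl fun ℓ _ => by simp only [G, mul_smul_comm, mul_assoc]
    have hR : ∀ ℓ ∈ Finset.range p, ((-1) ^ ℓ * t ^ ℓ * rising ((n + 1 : ℕ) : R) ℓ) •
        ((zmodPow T (-(ℓ : ZMod p)) : A) * d ℓ * zmodPow T ((n + 1 : ℕ) : ZMod p)) =
        ((-1) ^ ℓ * t ^ ℓ * rising ((n + 1 : ℕ) : R) ℓ) • G ℓ +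
        ((ℓ + 1) * (t * ((-1) ^ ℓ * t ^ ℓ * rising ((n + 1 : ℕ) : R) ℓ))) • G (ℓ + 1) := by
      intro ℓ hℓ
      rw [Nat.cast_succ n (R := ZMod p), add_comm (n : ZMod p), zmodPow_add D.pow_T,
        zmodPow_one D.pow_T, Units.val_mul, ← mul_assoc, mul_assoc _ (d ℓ),
        hdT ℓ (Finset.mem_range.1 hℓ), mul_add, add_mul, smul_add]
      congr 1
      · simp only [G, ← hcomm, mul_assoc]
      · rw [mul_smul_comm, smul_mul_assoc, smul_smul, hstep ℓ]
        simp only [G]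
        congr 1
        ring
    rw [hL, Finset.sum_congr rfl hR, Finset.sum_add_distrib,
      sum_range_shift_smul (fun ℓ => t * ((-1) ^ ℓ * t ^ ℓ * rising ((n + 1 : ℕ) : R) ℓ)) G,
      ← Finset.sum_add_distrib]
    refine Finset.sum_congr rfl fun ℓ _ => ?_
    rw [← add_smul]
    congr 1
    rcases ℓ with _ | m
    · simp [rising]
    · rw [Nat.cast_succ n, rising_add_one, Nat.add_sub_cancel]
      push_cast
      ring

-- The counterpart for T', with its powers collected on the right as the antipode requires. The
-- coefficient is the falling factorial c(c-1)⋯(c-ℓ+1), written as a rising one.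
include D in
lemma zmodPow_mul_eq_sum' (hd : DividedAd p h e w x d) (c : ZMod p) :
    (zmodPow T' c : A) * x = ∑ ℓ ∈ Finset.range p, (t ^ ℓ * rising (residue R p (c - ℓ) + 1) ℓ) •
      (d ℓ * zmodPow T' (c - (ℓ : ZMod p))) := by
  suffices key : ∀ n : ℕ, (zmodPow T' (n : ZMod p) : A) * x = ∑ ℓ ∈ Finset.range p,
      (t ^ ℓ * rising ((n : R) - ℓ + 1) ℓ) • (d ℓ * zmodPow T' ((n : ZMod p) - (ℓ : ZMod p))) by
    have := key c.val
    simp only [map_sub, map_natCast]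
    rwa [ZMod.natCast_zmod_val, ← map_natCast (residue R p), ZMod.natCast_zmod_val] at this
  intro n
  induction n with
  | zero =>
    have hp := (Fact.out : p.Prime).pos
    rw [Finset.sum_eq_single 0]
    · simp [zmodPow_zero, rising, hd.zero]
    · intro ℓ _ hℓ
      obtain ⟨m, rfl⟩ := Nat.exists_eq_succ_of_ne_zero hℓ
      -- The factors run from -m up to 0, so the product vanishes.
      have : ((0 : ℕ) : R) - (m.succ : ℕ) + 1 = -(m : R) := by push_cast; ring
      rw [this, Nat.succ_eq_add_one, rising_neg_natCast, mul_zero, zero_smul]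
    · simp [hp]
  | succ n ih =>
    have hdT : ∀ ℓ < p, (T' : A) * d ℓ = d ℓ * T' + (t * (ℓ + 1)) • d (ℓ + 1) := by
      intro ℓ hℓ
      have h1 := hd.succ ℓ hℓ
      have h2 : ((ℓ : R) + 1) • d (ℓ + 1) = e * d ℓ - d ℓ * e := by
        rw [h1, ← Nat.cast_smul_eq_nsmul R, Nat.cast_succ]
      rw [mul_smul, h2, D.T'_eq, mul_add, add_mul, smul_sub, mul_smul_comm, smul_mul_assoc]
      simp
    let G : ℕ → A := fun ℓ => d ℓ * zmodPow T' ((n : ZMod p) + 1 - (ℓ : ZMod p))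
    have hL : (zmodPow T' ((n + 1 : ℕ) : ZMod p) : A) * x = ∑ ℓ ∈ Finset.range p,
        ((t ^ ℓ * rising ((n : R) - ℓ + 1) ℓ) • G ℓ +
          ((ℓ + 1) * (t * (t ^ ℓ * rising ((n : R) - ℓ + 1) ℓ))) • G (ℓ + 1)) := by
      rw [Nat.cast_succ, add_comm, zmodPow_add D.pow_T', zmodPow_one D.pow_T', Units.val_mul,
        mul_assoc, ih, Finset.mul_sum]
      refine Finset.sum_congr rfl fun ℓ hℓ => ?_
      rw [mul_smul_comm, ← mul_assoc, hdT ℓ (Finset.mem_range.1 hℓ), add_mul, smul_add]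
      congr 1
      · simp only [G]
        rw [mul_assoc, add_comm (n : ZMod p), add_sub_assoc, zmodPow_add D.pow_T',
          zmodPow_one D.pow_T',
          Units.val_mul]
      · simp only [G]
        rw [smul_mul_assoc, smul_smul]
        congr 1
        · ring
        · congr 3
          push_cast
          ring
    rw [hL, Finset.sum_add_distrib,
      sum_range_shift_smul (fun ℓ => t * (t ^ ℓ * rising ((n : R) - ℓ + 1) ℓ)) G,
      ← Finset.sum_add_distrib]
    refine Finset.sum_congr rfl fun ℓ _ => ?_
    rw [← add_smul]
    simp only [G]
    rw [Nat.cast_succ (R := ZMod p)]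
    congr 1
    rcases ℓ with _ | m
    · simp [rising]
    · have h1 : ((n + 1 : ℕ) : R) - (m + 1 : ℕ) + 1 = (n - m : R) + 1 := by push_cast; ring
      have h2 : (n : R) - (m + 1 : ℕ) + 1 = n - m := by push_cast; ring
      rw [h1, h2, rising_add_one, Nat.add_sub_cancel]
      push_cast
      ring

variable {Δ : A →ₐ[R] A ⊗[R] A} {S : A →ₐ[R] Aᵐᵒᵖ}

/-- Expand T^c x in the closed form; T^(-c) cancels the power on the right, and the scalars c^⟨ℓ⟩ on
the π_c reassemble to h^⟨ℓ⟩. -/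
lemma comulHom_formula (hd : DividedAd p h e w x d) (hΔ : Δ x = x ⊗ₜ 1 + 1 ⊗ₜ x) :
    D.comulHom Δ x = x ⊗ₜ[R] ((T ^ w : Aˣ) : A) + ∑ ℓ ∈ Finset.range p,
      ((-1) ^ ℓ * t ^ ℓ) • (rising h ℓ ⊗ₜ[R] (((T ^ (-(ℓ : ℤ)) : Aˣ) : A) * d ℓ)) := by
  have hx : h * x = x * h + w • x := by
    have := hd.weight 0 (Fact.out : p.Prime).pos
    rwa [hd.zero, Nat.cast_zero, add_zero] at this
  rw [D.comulHom_primitive hΔ hx, zmodPow_intCast D.pow_T]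
  congr 1
  have h1 : ∀ ℓ : ℕ, ((T ^ (-(ℓ : ℤ)) : Aˣ) : A) = zmodPow T (-(ℓ : ZMod p)) := fun ℓ => by
    rw [← zmodPow_intCast (p := p) D.pow_T]
    simp
  have h2 : ∀ ℓ : ℕ, rising h ℓ =
      ∑ c : ZMod p, rising (residue R p c) ℓ • specProj R p h c := fun ℓ => by
    rw [← mul_one (rising h ℓ), ← sum_specProj (R := R) (p := p) h, Finset.mul_sum]
    exact Finset.sum_congr rfl fun c _ => rising_mul_of_mul_eq_smul (mul_specProj D.pow_h c) ℓ
  simp only [h1, h2, TensorProduct.sum_tmul, Finset.smul_sum]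
  rw [Finset.sum_comm]
  refine Finset.sum_congr rfl fun c _ => ?_
  rw [D.zmodPow_mul_eq_sum hd, Finset.sum_mul, TensorProduct.tmul_sum]
  refine Finset.sum_congr rfl fun ℓ _ => ?_
  rw [smul_mul_assoc, mul_assoc _ (zmodPow T c : A), zmodPow_mul_neg D.pow_T, mul_one,
    TensorProduct.tmul_smul, ← TensorProduct.smul_tmul', smul_smul]

/-- After multiplication by V on the right, both sides are compared on the spectral idempotents of
h, where (h+1)^⟨ℓ⟩ is a scalar and the expansion of T'^(c-w) x applies. -/
lemma antipodeHom_formula (hd : DividedAd p h e w x d) (hS : S x = MulOpposite.op (-x)) :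
    (D.antipodeHom S x).unop = - (((T ^ (-w) : Aˣ) : A) *
      ∑ ℓ ∈ Finset.range p, t ^ ℓ • (d ℓ * rising (h + 1) ℓ)) := by
  rw [D.antipodeHom_primitive hS]
  congr 1
  rw [Units.mul_inv_eq_iff_eq_mul, mul_assoc, ← zmodPow_intCast (p := p) D.pow_T, Int.cast_neg]
  have key : (∑ ℓ ∈ Finset.range p, t ^ ℓ • (d ℓ * rising (h + 1) ℓ)) * (D.unitV : A) =
      D.unitV * (zmodPow T' (-(w : ZMod p)) * x) := by
    have h1 : ∀ ℓ ∈ Finset.range p, (t ^ ℓ • (d ℓ * rising (h + 1) ℓ)) * (D.unitV : A) =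
        ∑ c : ZMod p, specProj R p h c * ((t ^ ℓ *
          rising (residue R p (-(w : ZMod p) + c - ℓ) + 1) ℓ) •
            (d ℓ * zmodPow T' (-(w : ZMod p) + c - (ℓ : ZMod p)))) := by
      intro ℓ hℓ
      rw [coe_unitV, diagSum, Finset.mul_sum]
      -- Since `d ℓ` has weight w + ℓ, it carries π_c to π_(c+w+ℓ).
      refine Fintype.sum_equiv (Equiv.addRight ((w : ZMod p) + ℓ)) _ _ fun c => ?_
      have h3 : -(w : ZMod p) + (c + (w + ℓ)) - ℓ = c := by ring
      have h4 : (h + 1) * specProj R p h c = (residue R p c + 1) • specProj R p h c := by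
        rw [add_mul, mul_specProj D.pow_h, one_mul, add_smul, one_smul]
      have h5 := mul_specProj_eq (R := R) (p := p) (hd.weight ℓ (Finset.mem_range.1 hℓ)) c
      push_cast at h5
      rw [Equiv.coe_addRight, h3, smul_mul_assoc, ← mul_assoc, mul_assoc (d ℓ),
        rising_mul_of_mul_eq_smul h4, mul_smul_comm, smul_mul_assoc, smul_smul, h5, mul_smul_comm,
        mul_assoc]
    rw [Finset.sum_mul, Finset.sum_congr rfl h1, Finset.sum_comm, coe_unitV, diagSum,
      Finset.sum_mul]
    refine Finset.sum_congr rfl fun c _ => ?_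
    rw [← Finset.mul_sum, ← D.zmodPow_mul_eq_sum' hd, zmodPow_add D.pow_T', Units.val_mul,
      (zmodPow_commute (zmodPow_commute (Commute.refl (T' : A)) c).symm _).eq]
    simp only [mul_assoc]
  rw [key, ← mul_assoc, D.zmodPow_mul_unitV, mul_assoc, neg_neg, ← mul_assoc (zmodPow T' _ : A),
    zmodPow_mul_neg D.pow_T', one_mul]

end TwistData

end TwistValues

/-! ### Contact vector fields as sums of commuting homogeneous operators -/

section ContactPowers

section Commuting

variable {𝒦 A : Type*} [Field 𝒦] [CommRing A] [Algebra 𝒦 A] {n : ℕ}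
  (D : Idx n → Derivation 𝒦 A A) (x : Idx n → A)

/-- The Euler derivation in the variables with nonzero index. -/
def eulerField : Derivation 𝒦 A A := ∑ i : Fin n, (x (pos i) • D (pos i) + x (neg i) • D (neg i))

/-- The part of a contact vector field along `D_0` and the Euler derivation. -/
def contactMain (f : A) : Derivation 𝒦 A A :=
  contactDelta D x f • D zer + D zer f • eulerField D x

/-- The Hamiltonian part of a contact vector field in the variables `x_i`, `x_{-i}`. -/
def contactPair (f : A) (i : Fin n) : Derivation 𝒦 A A :=
  D (neg i) f • D (pos i) - D (pos i) f • D (neg i)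

lemma eulerField_apply (g : A) :
    eulerField D x g = ∑ i : Fin n, (x (pos i) * D (pos i) g + x (neg i) * D (neg i) g) := by
  rw [eulerField, derivation_sum_apply]
  rfl

lemma contactMain_apply (f g : A) : contactMain D x f g =
    contactDelta D x f * D zer g + D zer f * eulerField D x g := rfl

lemma contactPair_apply (f : A) (i : Fin n) (g : A) : contactPair D f i g =
    D (neg i) f * D (pos i) g - D (pos i) f * D (neg i) g := rfl

lemma contactField_eq_add (f : A) :
    contactField D x f = contactMain D x f + ∑ i, contactPair D f i := by
  ext g
  rw [contactField_apply, Derivation.add_apply, derivation_sum_apply, contactMain_apply,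
    eulerField_apply, Finset.mul_sum, add_assoc, ← Finset.sum_add_distrib]
  congr 1
  refine Finset.sum_congr rfl fun i _ => ?_
  rw [contactPair_apply]
  ring

variable {D x}

/-- The hypothesis on `f` holds for products of functions of one variable each. The commutator of
the two Hamiltonian parts is a combination of four of its instances. -/
lemma contactPair_commute (hD : ∀ i j f, D i (D j f) = D j (D i f)) {f : A}
    (hf : ∀ a b c : Idx n, a ≠ b → a ≠ c → b ≠ c → D a f * D b (D c f) = D b f * D a (D c f))
    {i j : Fin n} (hij : i ≠ j) (g : A) :
    contactPair D f i (contactPair D f j g) = contactPair D f j (contactPair D f i g) := by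
  have e1 := hf (neg i) (pos i) (neg j) (by simp) (by simpa using hij) (by simp)
  have e2 := hf (neg i) (pos i) (pos j) (by simp) (by simp) (by simpa using hij)
  have e3 := hf (neg j) (pos j) (neg i) (by simp) (by simpa using hij.symm) (by simp)
  have e4 := hf (neg j) (pos j) (pos i) (by simp) (by simp) (by simpa using hij.symm)
  simp only [contactPair_apply, map_sub, Derivation.leibniz, smul_eq_mul]
  rw [hD (pos j) (pos i) g, hD (neg j) (pos i) g, hD (pos j) (neg i) g, hD (neg j) (neg i) g]
  linear_combination D (pos j) g * e1 - D (neg j) g * e2 - D (pos i) g * e3 + D (neg i) g * e4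

lemma D_eulerField (hD : ∀ i j f, D i (D j f) = D j (D i f))
    (hx : ∀ i j, D i (x j) = if i = j then 1 else 0) (j : Idx n) (f : A) :
    D j (eulerField D x f) = eulerField D x (D j f) + if j = zer then 0 else D j f := by
  simp only [eulerField_apply, map_sum, map_add, Derivation.leibniz, smul_eq_mul, hx,
    hD j, Finset.sum_add_distrib, mul_ite, mul_one, mul_zero]
  rcases j with _ | j | j <;> simp <;> ring

/-- As `f` is an eigenvector of `contactDelta`, it has Euler degree 2 - c and its derivatives `D j
f`, j ≠ 0, have degree 1 - c. What remains of the commutator is a combination of the separation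
identities. -/
lemma contactMain_commute (hD : ∀ i j f, D i (D j f) = D j (D i f))
    (hx : ∀ i j, D i (x j) = if i = j then 1 else 0) {f : A} {c : 𝒦}
    (hc : contactDelta D x f = c • f)
    (hf2 : ∀ a b : Idx n, a ≠ b → f * D a (D b f) = D a f * D b f)
    (hf : ∀ a b c : Idx n, a ≠ b → a ≠ c → b ≠ c → D a f * D b (D c f) = D b f * D a (D c f))
    (i : Fin n) (g : A) :
    contactMain D x f (contactPair D f i g) = contactPair D f i (contactMain D x f g) := by
  have e1 := hf2 zer (pos i) (by simp)
  have e2 := hf2 zer (neg i) (by simp)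
  have e3 := hf (neg i) (pos i) zer (by simp) (by simp) (by simp)
  have hE : eulerField D x f = 2 * f - c • f := by
    rw [← hc, contactDelta, eulerField_apply]
    ring
  have hEj : ∀ j : Idx n, j ≠ zer → eulerField D x (D j f) = D j f - c • D j f := by
    intro j hj
    have h := D_eulerField hD hx j f
    have h2 : D j ((2 : A) * f) = 2 * D j f := by rw [two_mul, two_mul, map_add]
    rw [hE, map_sub, h2, Derivation.map_smul, if_neg hj] at h
    linear_combination -h
  have hEg : ∀ j : Idx n, j ≠ zer → D j (eulerField D x g) = eulerField D x (D j g) + D j g := by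
    intro j hj
    rw [D_eulerField hD hx, if_neg hj]
  simp only [contactMain_apply, contactPair_apply, hc, map_sub, map_add, Derivation.leibniz,
    Derivation.map_smul, smul_eq_mul, hEj (pos i) (by simp), hEj (neg i) (by simp),
    hEg (pos i) (by simp), hEg (neg i) (by simp)]
  rw [hD (pos i) zer g, hD (neg i) zer g, hD (pos i) zer f, hD (neg i) zer f]
  rw [hD (pos i) zer f, hD (neg i) zer f] at e3
  simp only [Algebra.smul_def]
  linear_combination algebraMap 𝒦 A c * (D (pos i) g * e2 - D (neg i) g * e1) -
    eulerField D x g * e3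

end Commuting

variable {𝒦 : Type*} [Field 𝒦] {p n : ℕ}

/-- `g` is zero or a divided power with exponent `k` at the index `a`. -/
def IsMonoAt (a : Idx n) (k : ℤ) (g : DivPow 𝒦 p n) : Prop :=
  g = 0 ∨ ∃ β : Idx n → ℤ, InBox p β ∧ β a = k ∧ g = dp β

lemma inBox_sub_eps {α : Idx n → ℤ} (h : InBox p α) {j : Idx n} (hj : 1 ≤ α j) :
    InBox p (α - eps j) := fun i => by
  refine ⟨sub_eps_nonneg (fun i => (h i).1) hj i, ?_⟩
  have := (h i).2
  by_cases hi : i = j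
  · subst hi; simp only [Pi.sub_apply, eps_self]; omega
  · simpa [eps_ne hi] using this

variable [Fact p.Prime] [CharP 𝒦 p]

lemma IsMonoAt.D {a : Idx n} {k : ℤ} {g : DivPow 𝒦 p n} (hg : IsMonoAt a k g) {j : Idx n}
    (hj : a ≠ j) : IsMonoAt a k (DivPow.D j g) := by
  rcases hg with rfl | ⟨β, hβ, rfl, rfl⟩
  · exact Or.inl (map_zero _)
  · rw [D_dp j hβ]
    by_cases h : 1 ≤ β j
    · exact Or.inr ⟨_, inBox_sub_eps hβ h, by simp [eps_ne hj], rfl⟩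
    · exact Or.inl (dp_sub_eps_eq_zero (by have := (hβ j).1; omega))

/-- With equal exponents k at `a`, both products carry the coefficient binom(2k-1, k) there, and the
other coefficients are symmetric. -/
lemma IsMonoAt.D_mul {a : Idx n} {k : ℤ} {f g : DivPow 𝒦 p n} (hf : IsMonoAt a k f)
    (hg : IsMonoAt a k g) : DivPow.D a f * g = f * DivPow.D a g := by
  rcases hf with rfl | ⟨α, hα, hαk, rfl⟩
  · simp
  rcases hg with rfl | ⟨β, hβ, hβk, rfl⟩
  · simp
  have hoff : binomOff a β α = binomOff a α β := by
    refine Finset.prod_congr rfl fun i _ => ?_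
    rw [Nat.add_comm ((β i).toNat)]
    exact Nat.choose_symm_add.symm
  rw [D_dp a hα, D_dp a hβ, mul_comm, dp_mul_sub hβ hα, dp_mul_sub hα hβ, hoff, hαk, hβk,
    add_comm α β]

omit [Fact p.Prime] [CharP 𝒦 p] in
lemma isMonoAt_dp {α : Idx n → ℤ} (hα : InBox p α) (a : Idx n) :
    IsMonoAt a (α a) (dp α : DivPow 𝒦 p n) := Or.inr ⟨α, hα, rfl, rfl⟩

lemma dp_mul_D_D {α : Idx n → ℤ} (hα : InBox p α) {a b : Idx n} (hab : a ≠ b) :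
    (dp α : DivPow 𝒦 p n) * D a (D b (dp α)) = D a (dp α) * D b (dp α) :=
  ((isMonoAt_dp hα a).D_mul ((isMonoAt_dp hα a).D hab)).symm

lemma D_dp_mul_D_D {α : Idx n → ℤ} (hα : InBox p α) {a b c : Idx n} (hab : a ≠ b) (hac : a ≠ c)
    (hbc : b ≠ c) : D a (dp α : DivPow 𝒦 p n) * D b (D c (dp α)) =
      D b (dp α) * D a (D c (dp α)) := by
  have ha := isMonoAt_dp (𝒦 := 𝒦) hα a
  have hb := isMonoAt_dp (𝒦 := 𝒦) hα b
  rw [ha.D_mul ((ha.D hac).D hab), hb.D_mul ((hb.D hbc).D hab.symm), D_comm]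

lemma contactDelta_dp {α : Idx n → ℤ} (hα : InBox p α) :
    contactDelta D DivPow.X (dp α : DivPow 𝒦 p n) =
      ((2 - ∑ i : Fin n, (α (pos i) + α (neg i)) : ℤ) : 𝒦) • dp α := by
  have h2 : ((2 : DivPow 𝒦 p n)) * dp α = (2 : 𝒦) • dp α := by rw [two_mul, two_smul]
  rw [contactDelta, h2]
  simp only [X_mul_D _ hα, ← add_smul, ← Finset.sum_smul, ← sub_smul]
  push_cast
  rfl

/-! ### Homogeneous operators -/

/-- The operator `T` maps every divided power `x^(β)` to an integral multiple of `x^(β+s)`. -/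
def IsHomog (T : Module.End 𝒦 (DivPow 𝒦 p n)) (s : Idx n → ℤ) : Prop :=
  ∀ β, InBox p β → ∃ z : ℤ, T (dp β) = (z : 𝒦) • dp (β + s)

omit [CharP 𝒦 p] in
lemma IsHomog.add {T U : Module.End 𝒦 (DivPow 𝒦 p n)} {s : Idx n → ℤ} (hT : IsHomog T s)
    (hU : IsHomog U s) : IsHomog (T + U) s := fun β hβ => by
  obtain ⟨z, hz⟩ := hT β hβ
  obtain ⟨y, hy⟩ := hU β hβ
  exact ⟨z + y, by rw [LinearMap.add_apply, hz, hy, ← add_smul, Int.cast_add]⟩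

omit [CharP 𝒦 p] in
lemma IsHomog.smul {T : Module.End 𝒦 (DivPow 𝒦 p n)} {s : Idx n → ℤ} (hT : IsHomog T s) (y : ℤ) :
    IsHomog ((y : 𝒦) • T) s := fun β hβ => by
  obtain ⟨z, hz⟩ := hT β hβ
  exact ⟨y * z, by rw [LinearMap.smul_apply, hz, smul_smul, Int.cast_mul]⟩

omit [CharP 𝒦 p] in
lemma IsHomog.sum {ι : Type*} {T : ι → Module.End 𝒦 (DivPow 𝒦 p n)} {s : Idx n → ℤ}
    (I : Finset ι) (hT : ∀ i, IsHomog (T i) s) : IsHomog (∑ i ∈ I, T i) s := by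
  classical
  induction I using Finset.induction_on with
  | empty => exact fun β _ => ⟨0, by simp⟩
  | insert a I ha ih => rw [Finset.sum_insert ha]; exact (hT a).add ih

omit [CharP 𝒦 p] in
lemma exists_dp_mul_dp (γ δ : Idx n → ℤ) :
    ∃ z : ℤ, (dp γ * dp δ : DivPow 𝒦 p n) = (z : 𝒦) • dp (γ + δ) := by
  by_cases h1 : InBox p γ
  · by_cases h2 : InBox p δ
    · exact ⟨binom γ δ, by rw [dp_mul_dp (fun i => (h1 i).1) fun i => (h2 i).1, Int.cast_natCast]⟩
    · exact ⟨0, by rw [dp_eq_zero h2]; simp⟩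
  · exact ⟨0, by rw [dp_eq_zero h1]; simp⟩

omit [CharP 𝒦 p] in
lemma IsHomog.pow_apply {T : Module.End 𝒦 (DivPow 𝒦 p n)} {s : Idx n → ℤ} (hT : IsHomog T s)
    (β : Idx n → ℤ) (k : ℕ) : ∃ z : ℤ, (T ^ k) (dp β) = (z : 𝒦) • dp (β + k • s) := by
  induction k with
  | zero => exact ⟨1, by simp⟩
  | succ k ih =>
    obtain ⟨z, hz⟩ := ih
    rw [pow_succ', Module.End.mul_apply, hz, map_smul]
    by_cases h : InBox p (β + k • s)
    · obtain ⟨y, hy⟩ := hT _ h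
      exact ⟨z * y, by rw [hy, smul_smul, Int.cast_mul, add_assoc, ← succ_nsmul]⟩
    · exact ⟨0, by rw [dp_eq_zero h]; simp⟩

lemma intCast_pow_char (z : ℤ) : (z : 𝒦) ^ p = z := by
  have := congrArg (ZMod.castHom (dvd_refl p) 𝒦) (ZMod.pow_card (z : ZMod p))
  rwa [map_pow, map_intCast] at this

/-- Such an operator is diagonal with eigenvalues in the prime field, fixed by Frobenius. -/
lemma IsHomog.pow_char_zero {T : Module.End 𝒦 (DivPow 𝒦 p n)} (hT : IsHomog T 0) : T ^ p = T := by
  refine hom_ext fun β hβ => ?_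
  obtain ⟨z, hz⟩ := hT β hβ
  rw [add_zero] at hz
  have : ∀ k : ℕ, (T ^ k) (dp β) = (z : 𝒦) ^ k • dp β := by
    intro k
    induction k with
    | zero => simp
    | succ k ih => rw [pow_succ', Module.End.mul_apply, ih, map_smul, hz, smul_smul, pow_succ]
  rw [this, intCast_pow_char, hz]

-- Shifting p times by a nonzero vector moves some exponent by at least p, out of the box.
omit [CharP 𝒦 p] in
lemma IsHomog.pow_char_of_ne {T : Module.End 𝒦 (DivPow 𝒦 p n)} {s : Idx n → ℤ} (hT : IsHomog T s)
    (hs : s ≠ 0) : T ^ p = 0 := by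
  refine hom_ext fun β hβ => ?_
  obtain ⟨z, hz⟩ := hT.pow_apply β p
  rw [hz, dp_eq_zero, smul_zero, LinearMap.zero_apply]
  intro hb
  obtain ⟨j, hj⟩ := Function.ne_iff.1 hs
  have h1 := hb j
  have h2 := hβ j
  rw [Pi.add_apply, Pi.smul_apply, nsmul_eq_mul] at h1
  rw [Pi.zero_apply] at hj
  rcases lt_or_gt_of_ne hj with h | h
  · nlinarith
  · nlinarith

/-- The operators x_j D_j are diagonal, so only the factors x^(α) D_0 and D_0 x^(α) shift exponents,
both by α - ε_0. -/
lemma isHomog_contactMain {α : Idx n → ℤ} (hα : InBox p α) :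
    IsHomog (contactMain D DivPow.X (dp α : DivPow 𝒦 p n)).toLinearMap (α - eps zer) := by
  have h0 : IsHomog ((LinearMap.mulLeft 𝒦 (dp α : DivPow 𝒦 p n)) * (D zer).toLinearMap)
      (α - eps zer) := by
    intro β hβ
    obtain ⟨z, hz⟩ := exists_dp_mul_dp (𝒦 := 𝒦) (p := p) α (β - eps zer)
    refine ⟨z, ?_⟩
    rw [show β + (α - eps zer) = α + (β - eps zer) by abel, ← hz, ← D_dp zer hβ]
    rfl
  have h1 : ∀ j : Idx n, IsHomog ((LinearMap.mulLeft 𝒦 ((D zer : DerDP 𝒦 p n) (dp α))) *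
      ((DivPow.X j : DivPow 𝒦 p n) • DivPow.D j : DerDP 𝒦 p n).toLinearMap) (α - eps zer) := by
    intro j β hβ
    obtain ⟨z, hz⟩ := exists_dp_mul_dp (𝒦 := 𝒦) (p := p) (α - eps zer) β
    refine ⟨β j * z, ?_⟩
    have h : ((DivPow.X j : DivPow 𝒦 p n) • DivPow.D j : DerDP 𝒦 p n) (dp β : DivPow 𝒦 p n) =
        (β j : 𝒦) • dp β :=
      X_mul_D j hβ
    change (D zer : DerDP 𝒦 p n) (dp α) *
      ((DivPow.X j : DivPow 𝒦 p n) • DivPow.D j : DerDP 𝒦 p n) (dp β) = _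
    rw [h, D_dp zer hα, mul_smul_comm, hz, smul_smul, Int.cast_mul, add_comm β]
  have h2 := (h0.smul (2 - ∑ i : Fin n, (α (pos i) + α (neg i)))).add
    (IsHomog.sum Finset.univ fun i : Fin n => (h1 (pos i)).add (h1 (neg i)))
  convert h2 using 1
  refine LinearMap.ext fun g => ?_
  change contactMain D DivPow.X (dp α) g = _
  rw [contactMain_apply, contactDelta_dp hα, eulerField_apply, Finset.mul_sum]
  simp [mul_add]

lemma isHomog_contactPair {α : Idx n → ℤ} (hα : InBox p α) (i : Fin n) :
    IsHomog (contactPair D (dp α : DivPow 𝒦 p n) i).toLinearMap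
      (α - eps (pos i) - eps (neg i)) := by
  intro β hβ
  obtain ⟨z, hz⟩ := exists_dp_mul_dp (𝒦 := 𝒦) (p := p) (α - eps (neg i)) (β - eps (pos i))
  obtain ⟨y, hy⟩ := exists_dp_mul_dp (𝒦 := 𝒦) (p := p) (α - eps (pos i)) (β - eps (neg i))
  refine ⟨z - y, ?_⟩
  change contactPair D (dp α : DivPow 𝒦 p n) i (dp β) = _
  rw [contactPair_apply, D_dp _ hα, D_dp _ hα, D_dp _ hβ, D_dp _ hβ, hz, hy, Int.cast_sub,
    sub_smul]
  congr 3 <;> abel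

/-! ### The `p`-th powers of the contact vector fields -/

lemma DK_toLinearMap_eq {α : Idx n → ℤ} :
    (DK (dp α : DivPow 𝒦 p n)).toLinearMap =
      (contactMain D DivPow.X (dp α : DivPow 𝒦 p n)).toLinearMap +
        ∑ i, (contactPair D (dp α : DivPow 𝒦 p n) i).toLinearMap := by
  rw [DK_eq_contactField, contactField_eq_add]
  refine LinearMap.ext fun g => ?_
  rw [LinearMap.add_apply, LinearMap.sum_apply]
  change (contactMain D DivPow.X (dp α) + ∑ i, contactPair D (dp α) i : DerDP 𝒦 p n) g = _
  rw [Derivation.add_apply, derivation_sum_apply]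
  rfl

lemma add_pow_prime_of_commute {B : Type*} [Ring B] (hB : (p : B) = 0) {x y : B}
    (h : Commute x y) : (x + y) ^ p = x ^ p + y ^ p := by
  obtain ⟨r, hr⟩ := h.exists_add_pow_prime_eq (Fact.out : p.Prime)
  rw [hr, hB]
  simp

lemma sum_pow_prime_of_commute {B ι : Type*} [Ring B] (hB : (p : B) = 0) (s : Finset ι)
    (x : ι → B) (h : ∀ i j, i ≠ j → Commute (x i) (x j)) :
    (∑ i ∈ s, x i) ^ p = ∑ i ∈ s, x i ^ p := by
  classical
  induction s using Finset.induction_on with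
  | empty => simp [(Fact.out : p.Prime).ne_zero]
  | insert a s ha ih =>
    rw [Finset.sum_insert ha, Finset.sum_insert ha, add_pow_prime_of_commute hB, ih]
    exact Commute.sum_right _ _ _ fun i hi => h a i fun hai => ha (hai ▸ hi)

lemma add_sum_pow_prime_of_commute {B ι : Type*} [Fintype ι] [Ring B] (hB : (p : B) = 0) (y : B)
    (x : ι → B) (hy : ∀ i, Commute y (x i)) (h : ∀ i j, i ≠ j → Commute (x i) (x j)) :
    (y + ∑ i, x i) ^ p = y ^ p + ∑ i, x i ^ p := by
  rw [add_pow_prime_of_commute hB (Commute.sum_right _ _ _ fun i _ => hy i),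
    sum_pow_prime_of_commute hB _ _ h]

omit [Fact p.Prime] in
lemma natCast_eq_zero_of_algebra {B : Type*} [Ring B] [Algebra 𝒦 B] : (p : B) = 0 := by
  rw [← map_natCast (algebraMap 𝒦 B), CharP.cast_eq_zero, map_zero]

lemma DK_pow_char {α : Idx n → ℤ} (hα : InBox p α) :
    (DK (dp α : DivPow 𝒦 p n)).toLinearMap ^ p =
      (contactMain D DivPow.X (dp α : DivPow 𝒦 p n)).toLinearMap ^ p +
        ∑ i, (contactPair D (dp α : DivPow 𝒦 p n) i).toLinearMap ^ p := by
  have hp : ((p : ℕ) : Module.End 𝒦 (DivPow 𝒦 p n)) = 0 := natCast_eq_zero_of_algebra (𝒦 := 𝒦)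
  have h1 : ∀ i j, i ≠ j → Commute (contactPair D (dp α : DivPow 𝒦 p n) i).toLinearMap
      (contactPair D (dp α : DivPow 𝒦 p n) j).toLinearMap := by
    intro i j hij
    refine LinearMap.ext fun g => ?_
    exact contactPair_commute D_comm (fun a b c hab hac hbc => D_dp_mul_D_D hα hab hac hbc) hij g
  have h2 : ∀ i, Commute (contactMain D DivPow.X (dp α : DivPow 𝒦 p n)).toLinearMap
      (contactPair D (dp α : DivPow 𝒦 p n) i).toLinearMap := by
    intro i
    refine LinearMap.ext fun g => ?_
    have := contactMain_commute (D := (D : Idx n → DerDP 𝒦 p n)) (x := DivPow.X) D_comm D_X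
      (contactDelta_dp hα) (fun a b hab => dp_mul_D_D hα hab)
      (fun a b c hab hac hbc => D_dp_mul_D_D hα hab hac hbc) i g
    exact this
  rw [DK_toLinearMap_eq]
  exact add_sum_pow_prime_of_commute hp _ _ h2 h1

/-- The excluded indices are exactly those for which one of the commuting parts has shift zero. -/
lemma DK_pow_char_nil {α : Idx n → ℤ} (hα : InBox p α) (h0 : α ≠ eps zer)
    (h1 : ∀ i : Fin n, α ≠ eps (pos i) + eps (neg i)) :
    (DK (dp α : DivPow 𝒦 p n)).toLinearMap ^ p = 0 := by
  rw [DK_pow_char hα, (isHomog_contactMain hα).pow_char_of_ne (sub_ne_zero.2 h0), zero_add]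
  refine Finset.sum_eq_zero fun i _ => (isHomog_contactPair hα i).pow_char_of_ne ?_
  rw [sub_sub]
  exact sub_ne_zero.2 (h1 i)

lemma DK_pow_char_zero :
    (DK (dp (eps zer) : DivPow 𝒦 p n)).toLinearMap ^ p = (DK (dp (eps zer))).toLinearMap := by
  have h0 : ∀ i, (contactPair D (dp (eps zer) : DivPow 𝒦 p n) i).toLinearMap = 0 := by
    intro i
    refine LinearMap.ext fun g => ?_
    change contactPair D (DivPow.X zer : DivPow 𝒦 p n) i g = 0
    rw [contactPair_apply, D_X, D_X]
    simp
  have hs := isHomog_contactMain (𝒦 := 𝒦) (inBox_eps (p := p) (zer : Idx n))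
  rw [sub_self] at hs
  rw [DK_pow_char (inBox_eps _), DK_toLinearMap_eq, hs.pow_char_zero]
  simp [h0, (Fact.out : p.Prime).ne_zero]

omit [CharP 𝒦 p] in
lemma inBox_eps_add_eps {a b : Idx n} (hab : a ≠ b) : InBox p (eps a + eps b) := fun i => by
  have := (Fact.out : p.Prime).two_le
  rw [Pi.add_apply]
  by_cases ha : i = a
  · subst ha; rw [eps_self, eps_ne hab]; omega
  · rw [eps_ne ha]
    by_cases hb : i = b
    · subst hb; rw [eps_self]; omega
    · rw [eps_ne hb]; omega

omit [CharP 𝒦 p] in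
lemma dp_eps_add_eps {a b : Idx n} (hab : a ≠ b) :
    (dp (eps a + eps b) : DivPow 𝒦 p n) = DivPow.X a * DivPow.X b := by
  have hnn : ∀ (j i : Idx n), 0 ≤ eps j i := fun j i => (inBox_eps (p := p) j i).1
  have hb : binom (eps a) (eps b) = 1 := by
    refine Finset.prod_eq_one fun i _ => ?_
    by_cases ha : i = a
    · subst ha; simp [eps_self, eps_ne hab]
    · simp [eps_ne ha]
  rw [DivPow.X, DivPow.X, dp_mul_dp (hnn a) (hnn b), hb, Nat.cast_one, one_smul]

lemma DK_pow_char_pair (i : Fin n) :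
    (DK (dp (eps (pos i) + eps (neg i)) : DivPow 𝒦 p n)).toLinearMap ^ p =
      (DK (dp (eps (pos i) + eps (neg i)))).toLinearMap := by
  have hbox : InBox p (eps (pos i) + eps (neg i)) := inBox_eps_add_eps (by simp)
  have hX : (dp (eps (pos i) + eps (neg i)) : DivPow 𝒦 p n) =
    DivPow.X (pos i) * DivPow.X (neg i) := dp_eps_add_eps (by simp)
  have h0 : ∀ j ≠ i, (contactPair D (dp (eps (pos i) + eps (neg i)) : DivPow 𝒦 p n)
      j).toLinearMap = 0 := by
    intro j hj
    refine LinearMap.ext fun g => ?_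
    change contactPair D (dp (eps (pos i) + eps (neg i)) : DivPow 𝒦 p n) j g = 0
    rw [contactPair_apply, hX]
    simp [D_X, hj]
  have hm : (contactMain D DivPow.X (dp (eps (pos i) + eps (neg i)) :
      DivPow 𝒦 p n)).toLinearMap = 0 := by
    refine LinearMap.ext fun g => ?_
    change contactMain D DivPow.X (dp (eps (pos i) + eps (neg i)) : DivPow 𝒦 p n) g = 0
    have hd : D zer (dp (eps (pos i) + eps (neg i)) : DivPow 𝒦 p n) = 0 := by
      rw [hX]
      simp [D_X]
    have hsum : ∑ j : Fin n, ((eps (pos i) + eps (neg i) : Idx n → ℤ) (pos j) +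
        (eps (pos i) + eps (neg i) : Idx n → ℤ) (neg j)) = 2 := by
      rw [Finset.sum_eq_single i]
      · simp [eps]
      · intro j _ hj
        simp [eps, hj]
      · simp
    rw [contactMain_apply, contactDelta_dp hbox, hsum, hd]
    simp
  have hs := isHomog_contactPair (𝒦 := 𝒦) hbox i
  rw [add_sub_cancel_left, sub_self] at hs
  have hne := (Fact.out : p.Prime).ne_zero
  rw [DK_pow_char hbox, DK_toLinearMap_eq, hm, zero_pow hne,
    Finset.sum_eq_single i (fun j _ hj => by rw [h0 j hj, zero_pow hne]) (by simp),
    Finset.sum_eq_single i (fun j _ hj => h0 j hj) (by simp), hs.pow_char_zero]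

end ContactPowers

/-! ### Contact brackets with low-degree functions and the divergence formula -/

section DerivedContact

section Brackets

variable {𝒦 A : Type*} [Field 𝒦] [CommRing A] [Algebra 𝒦 A] {n : ℕ}
  {D : Idx n → Derivation 𝒦 A A} {x : Idx n → A}

lemma contactBracket_one (g : A) : contactBracket D x 1 g = 2 * D zer g := by
  simp [contactBracket, contactDelta]

lemma contactBracket_zer (hx : ∀ i j, D i (x j) = if i = j then 1 else 0) (g : A) :
    contactBracket D x (x zer) g = 2 * x zer * D zer g - contactDelta D x g := by
  simp [contactBracket, contactDelta, hx]

lemma contactBracket_pos (hx : ∀ i j, D i (x j) = if i = j then 1 else 0) (i : Fin n) (g : A) :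
    contactBracket D x (x (pos i)) g = D zer (x (pos i) * g) - D (neg i) g := by
  have h : contactDelta D x (x (pos i)) = x (pos i) := by
    simp [contactDelta, hx]
    ring
  rw [contactBracket, h]
  simp [hx, Derivation.leibniz]
  ring

lemma contactBracket_neg (hx : ∀ i j, D i (x j) = if i = j then 1 else 0) (i : Fin n) (g : A) :
    contactBracket D x (x (neg i)) g = D zer (x (neg i) * g) + D (pos i) g := by
  have h : contactDelta D x (x (neg i)) = x (neg i) := by
    simp [contactDelta, hx]
    ring
  rw [contactBracket, h]
  simp [hx, Derivation.leibniz]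

lemma contactBracket_pair (hx : ∀ i j, D i (x j) = if i = j then 1 else 0) (i : Fin n) (g : A) :
    contactBracket D x (x (pos i) * x (neg i)) g =
      x (pos i) * D (pos i) g - x (neg i) * D (neg i) g := by
  have h : contactDelta D x (x (pos i) * x (neg i)) = 0 := by
    simp [contactDelta, hx, Finset.sum_add_distrib]
    ring
  rw [contactBracket, h]
  simp [hx, Finset.sum_sub_distrib]

/-- The contact bracket is a divergence up to a multiple of `2n+4`. -/
lemma contactBracket_eq_divergence (hD : ∀ i j f, D i (D j f) = D j (D i f))
    (hx : ∀ i j, D i (x j) = if i = j then 1 else 0) (f g : A) :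
    contactBracket D x f g = D zer (2 * (f * g)) +
      ∑ i : Fin n, (D (pos i) (x (pos i) * g * D zer f - f * D (neg i) g) +
        D (neg i) (x (neg i) * g * D zer f + f * D (pos i) g) -
        D zer (x (pos i) * D (pos i) f * g + x (neg i) * D (neg i) f * g)) -
      ((2 * n + 4 : ℕ) : A) * (g * D zer f) := by
  have h2 : D zer ((2 : A) * (f * g)) = 2 * (f * D zer g + g * D zer f) := by
    rw [two_mul, map_add, Derivation.leibniz, two_mul]
    rfl
  have hterm : ∀ i : Fin n, D (pos i) (x (pos i) * g * D zer f - f * D (neg i) g) +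
        D (neg i) (x (neg i) * g * D zer f + f * D (pos i) g) -
        D zer (x (pos i) * D (pos i) f * g + x (neg i) * D (neg i) f * g) =
      (D (neg i) f * D (pos i) g - D (pos i) f * D (neg i) g) -
        (x (pos i) * D (pos i) f + x (neg i) * D (neg i) f) * D zer g +
        (x (pos i) * D (pos i) g + x (neg i) * D (neg i) g) * D zer f + 2 * (g * D zer f) := by
    intro i
    simp only [map_add, map_sub, Derivation.leibniz, smul_eq_mul, hx, reduceCtorEq, if_false,
      if_true]
    rw [hD (pos i) zer f, hD (neg i) zer f, hD (pos i) (neg i) g]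
    ring
  rw [h2, Finset.sum_congr rfl fun i _ => hterm i, contactBracket, contactDelta, contactDelta]
  simp only [Finset.sum_add_distrib, Finset.sum_sub_distrib, sub_mul, Finset.sum_mul, add_mul]
  simp
  ring

end Brackets

variable {𝒦 : Type*} [Field 𝒦] {p n : ℕ}

/-- The coefficient of the top divided power. -/
noncomputable def topCoeff : DivPow 𝒦 p n →ₗ[𝒦] 𝒦 :=
  lift fun α => if α = fun _ => (p : ℤ) - 1 then 1 else 0

variable [Fact p.Prime]

omit [Fact p.Prime] in
lemma topCoeff_dp {α : Idx n → ℤ} (hα : InBox p α) :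
    topCoeff (dp α : DivPow 𝒦 p n) = if α = fun _ => (p : ℤ) - 1 then 1 else 0 := lift_dp _ hα

variable [CharP 𝒦 p]

/-- A derivative lowers the exponent at `j` to at most p - 2, so x^(τ) cannot occur. -/
lemma topCoeff_D (j : Idx n) (f : DivPow 𝒦 p n) : topCoeff (D j f) = 0 := by
  have : topCoeff ∘ₗ (D j : DerDP 𝒦 p n).toLinearMap = 0 := by
    refine hom_ext fun α hα => ?_
    change topCoeff (D j (dp α : DivPow 𝒦 p n)) = 0
    rw [D_dp j hα]
    by_cases h : InBox p (α - eps j)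
    · rw [topCoeff_dp h, if_neg]
      intro h'
      have h1 := congrFun h' j
      have h2 := (hα j).2
      rw [Pi.sub_apply, eps_self] at h1
      omega
    · rw [dp_eq_zero h, map_zero]
  exact LinearMap.congr_fun this f

lemma topCoeff_contactBracket (hpn : p ∣ 2 * n + 4) (f g : DivPow 𝒦 p n) :
    topCoeff (contactBracket D DivPow.X f g) = 0 := by
  have h0 : ((2 * n + 4 : ℕ) : DivPow 𝒦 p n) = 0 := by
    rw [← map_natCast (algebraMap 𝒦 (DivPow 𝒦 p n)), (CharP.cast_eq_zero_iff 𝒦 p _).2 hpn, map_zero]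
  rw [contactBracket_eq_divergence D_comm D_X, h0, zero_mul, sub_zero, map_add, map_sum, topCoeff_D,
    zero_add]
  refine Finset.sum_eq_zero fun i _ => ?_
  rw [map_sub, map_add, topCoeff_D, topCoeff_D, topCoeff_D]
  simp

/-! ### The derived algebra -/

lemma lie_DK (f g : DivPow 𝒦 p n) : ⁅(DK f : DerDP 𝒦 p n), DK g⁆ =
    DK (contactBracket D DivPow.X f g) := by
  rw [DK_eq_contactField, DK_eq_contactField, DK_eq_contactField,
    lie_contactField D DivPow.X D_comm D_X]

lemma two_ne_zero_of_char (hp : p ≠ 2) : (2 : 𝒦) ≠ 0 := by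
  have h : ((2 : ℕ) : 𝒦) ≠ 0 := by
    rw [Ne, CharP.cast_eq_zero_iff 𝒦 p, Nat.prime_dvd_prime_iff_eq Fact.out Nat.prime_two]
    exact hp
  exact_mod_cast h

lemma DK_apply_X (f : DivPow 𝒦 p n) (j : Idx n) :
    DK f (DivPow.X j) = contactCoef D DivPow.X f j := by
  have : contactField D DivPow.X f (DivPow.X j) =
      ∑ l, contactCoef D DivPow.X f l * D l (DivPow.X j) := by
    rw [contactField, derivation_sum_apply]; rfl
  rw [DK_eq_contactField, this]
  simp [D_X]

/-- Eliminating D_0 f from the coefficients at i and -i shows that the Euler sum vanishes. The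
coefficient at 0 then reads 2f = 0. -/
lemma DK_injective (hp : p ≠ 2) :
    Function.Injective (DK : DivPow 𝒦 p n →ₗ[𝒦] DerDP 𝒦 p n) := by
  rw [injective_iff_map_eq_zero]
  intro f hf
  have h : ∀ j : Idx n, contactCoef D DivPow.X f j = 0 := fun j => by
    rw [← DK_apply_X, hf]
    rfl
  have h0 : contactDelta D DivPow.X f = 0 := h zer
  have hpos : ∀ i : Fin n, DivPow.X (pos i) * D zer f + D (neg i) f = 0 := fun i => h (pos i)
  have hneg : ∀ i : Fin n, DivPow.X (neg i) * D zer f - D (pos i) f = 0 := fun i => h (neg i)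
  have hsum : ∑ i : Fin n, (DivPow.X (pos i) * D (pos i) f + DivPow.X (neg i) * D (neg i) f) =
      0 := by
    refine Finset.sum_eq_zero fun i _ => ?_
    linear_combination DivPow.X (neg i) * hpos i - DivPow.X (pos i) * hneg i
  rw [contactDelta, hsum, sub_zero, two_mul, ← two_smul 𝒦] at h0
  exact (smul_eq_zero.1 h0).resolve_left (two_ne_zero_of_char hp)

variable (𝒦 p n) in
/-- The functions whose contact vector fields belong to the contact algebra. -/
noncomputable def derivedFun : Submodule 𝒦 (DivPow 𝒦 p n) :=
  (((⁅(⊤ : LieIdeal 𝒦 (KPrime 𝒦 p n)), (⊤ : LieIdeal 𝒦 (KPrime 𝒦 p n))⁆ :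
    LieIdeal 𝒦 (KPrime 𝒦 p n)).toSubmodule).map
      (KPrime 𝒦 p n).toSubmodule.subtype).comap DK

lemma mem_derivedFun {f : DivPow 𝒦 p n} :
    f ∈ derivedFun 𝒦 p n ↔ ∃ x : ContactK 𝒦 p n, ((x : KPrime 𝒦 p n) : DerDP 𝒦 p n) = DK f := by
  rw [derivedFun, Submodule.mem_comap, Submodule.mem_map]
  constructor
  · rintro ⟨y, hy, h⟩
    exact ⟨⟨y, hy⟩, h⟩
  · rintro ⟨x, hx⟩
    exact ⟨x.1, x.2, hx⟩

lemma contactBracket_mem_derivedFun (f g : DivPow 𝒦 p n) :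
    contactBracket D DivPow.X f g ∈ derivedFun 𝒦 p n := by
  let F : KPrime 𝒦 p n := ⟨DK f, f, rfl⟩
  let G : KPrime 𝒦 p n := ⟨DK g, g, rfl⟩
  refine mem_derivedFun.2 ⟨⟨⁅F, G⁆, LieSubmodule.lie_mem_lie (LieSubmodule.mem_top F)
    (LieSubmodule.mem_top G)⟩, lie_DK f g⟩

/-- Bracketing with 1 gives 2 D_0 g, and bracketing with x_i or x_(-i) gives the other partial
derivatives up to sign and up to a D_0-derivative. -/
lemma D_mem_derivedFun (hp : p ≠ 2) (j : Idx n) (g : DivPow 𝒦 p n) : D j g ∈ derivedFun 𝒦 p n := by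
  have h0 : ∀ g : DivPow 𝒦 p n, D zer g ∈ derivedFun 𝒦 p n := by
    intro g
    have h := contactBracket_mem_derivedFun 1 g
    rw [contactBracket_one, two_mul, ← two_smul 𝒦] at h
    have := (derivedFun 𝒦 p n).smul_mem (2 : 𝒦)⁻¹ h
    rwa [smul_smul, inv_mul_cancel₀ (two_ne_zero_of_char hp), one_smul] at this
  rcases j with _ | i | i
  · exact h0 g
  · have h := contactBracket_mem_derivedFun (DivPow.X (neg i)) g
    rw [contactBracket_neg D_X] at h
    have h' := (derivedFun 𝒦 p n).sub_mem h (h0 (DivPow.X (neg i) * g))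
    rwa [add_sub_cancel_left] at h'
  · have h := contactBracket_mem_derivedFun (DivPow.X (pos i)) g
    rw [contactBracket_pos D_X] at h
    have h' := (derivedFun 𝒦 p n).sub_mem (h0 (DivPow.X (pos i) * g)) h
    rwa [sub_sub_cancel] at h'

/-- If some exponent is below p - 1, the divided power is a partial derivative of another one.
Otherwise α = τ, and x_0 acts on it by the scalar -(2n+4). -/
lemma dp_mem_derivedFun (hp : p ≠ 2) {α : Idx n → ℤ} (hα : InBox p α)
    (hτ : p ∣ 2 * n + 4 → α ≠ fun _ => (p : ℤ) - 1) : (dp α : DivPow 𝒦 p n) ∈ derivedFun 𝒦 p n := by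
  by_cases h : ∃ j, α j < p - 1
  · obtain ⟨j, hj⟩ := h
    have hbox : InBox p (α + eps j) := fun i => by
      have := hα i
      rw [Pi.add_apply]
      by_cases hi : i = j
      · subst hi; rw [eps_self]; omega
      · rw [eps_ne hi]; omega
    have := D_mem_derivedFun hp j (dp (α + eps j) : DivPow 𝒦 p n)
    rwa [D_dp j hbox, add_sub_cancel_right] at this
  · push Not at h
    have hα' : α = fun _ => (p : ℤ) - 1 := funext fun j => by
      have := (hα j).2
      have := h j
      omega
    have hpn : ¬ p ∣ 2 * n + 4 := fun hdvd => hτ hdvd hα'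
    have hb := contactBracket_mem_derivedFun (DivPow.X zer) (dp α : DivPow 𝒦 p n)
    have hcalc : contactBracket D DivPow.X (DivPow.X zer) (dp α : DivPow 𝒦 p n) =
        (-((2 * n + 4 : ℕ) : 𝒦)) • dp α := by
      rw [contactBracket_zer D_X, contactDelta_dp hα, mul_assoc, X_mul_D _ hα, two_mul,
        ← add_smul, ← sub_smul, hα']
      congr 1
      simp
      ring
    rw [hcalc] at hb
    have hne : (-((2 * n + 4 : ℕ) : 𝒦)) ≠ 0 := by
      rw [Ne, neg_eq_zero, CharP.cast_eq_zero_iff 𝒦 p]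
      exact hpn
    have := (derivedFun 𝒦 p n).smul_mem (-((2 * n + 4 : ℕ) : 𝒦))⁻¹ hb
    rwa [smul_smul, inv_mul_cancel₀ hne, one_smul] at this

lemma exists_isDK (hp : p ≠ 2) {α : Idx n → ℤ} (hα : InBox p α)
    (hτ : p ∣ 2 * n + 4 → α ≠ fun _ => (p : ℤ) - 1) : ∃ x : ContactK 𝒦 p n, x.IsDK α :=
  mem_derivedFun.1 (dp_mem_derivedFun hp hα hτ)

/-- The derived algebra is the linear span of the brackets, and the top coefficient is linear. -/
lemma exists_DK_eq (x : ContactK 𝒦 p n) : ∃ f : DivPow 𝒦 p n,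
    (p ∣ 2 * n + 4 → topCoeff f = 0) ∧ ((x : KPrime 𝒦 p n) : DerDP 𝒦 p n) = DK f := by
  have hx : x.1 ∈ (⁅(⊤ : LieIdeal 𝒦 (KPrime 𝒦 p n)), (⊤ : LieIdeal 𝒦 (KPrime 𝒦 p n))⁆ :
    LieIdeal 𝒦 (KPrime 𝒦 p n)).toSubmodule := x.2
  rw [LieSubmodule.lieIdeal_oper_eq_linear_span'] at hx
  generalize x.1 = y at hx ⊢
  induction hx using Submodule.span_induction with
  | mem y hy =>
    obtain ⟨⟨_, f, rfl⟩, -, ⟨_, g, rfl⟩, -, rfl⟩ := hy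
    exact ⟨contactBracket D DivPow.X f g, fun h => topCoeff_contactBracket h f g, lie_DK f g⟩
  | zero => exact ⟨0, fun _ => map_zero _, by rw [map_zero]; rfl⟩
  | add y z _ _ hy hz =>
    obtain ⟨f, hf, hyf⟩ := hy
    obtain ⟨g, hg, hzg⟩ := hz
    refine ⟨f + g, fun h => by rw [map_add, hf h, hg h, add_zero], ?_⟩
    rw [map_add, ← hyf, ← hzg]
    rfl
  | smul c y _ hy =>
    obtain ⟨f, hf, hyf⟩ := hy
    refine ⟨c • f, fun h => by rw [map_smul, hf h, smul_zero], ?_⟩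
    rw [map_smul, ← hyf]
    rfl

variable (p n) in
/-- The indices of the standard basis of the contact algebra. -/
def ContactIdx : Type := {a : Idx n → Fin p // p ∣ 2 * n + 4 → toZ a ≠ fun _ => (p : ℤ) - 1}

noncomputable instance : Fintype (ContactIdx p n) := by
  classical
  exact inferInstanceAs (Fintype {a : Idx n → Fin p // _})

omit [Fact p.Prime] in
lemma toZ_injective : Function.Injective (toZ : (Idx n → Fin p) → Idx n → ℤ) := fun a b h =>
  funext fun i => Fin.ext (by simpa [DivPow.toZ] using congrFun h i)

lemma card_contactIdx :
    (¬ p ∣ 2 * n + 4 → Fintype.card (ContactIdx p n) = p ^ (2 * n + 1)) ∧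
    (p ∣ 2 * n + 4 → Fintype.card (ContactIdx p n) + 1 = p ^ (2 * n + 1)) := by
  classical
  have hcard : Fintype.card (Idx n → Fin p) = p ^ (2 * n + 1) := by
    simp [two_mul]
  constructor
  · intro h
    rw [← hcard]
    exact Fintype.card_congr (Equiv.subtypeUnivEquiv fun a hdvd => absurd hdvd h)
  · intro h
    have hp := (Fact.out : p.Prime).pos
    let a₀ : Idx n → Fin p := fun _ => ⟨p - 1, by omega⟩
    have ha₀ : toZ a₀ = fun _ => (p : ℤ) - 1 := funext fun i => by
      simp only [DivPow.toZ, a₀]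
      omega
    have h1 : Fintype.card (ContactIdx p n) = Fintype.card {a : Idx n → Fin p // a ≠ a₀} :=
      Fintype.card_congr (Equiv.subtypeEquivRight fun a => by
        rw [← ha₀]
        exact ⟨fun h' he => h' h (he ▸ rfl), fun h' _ he => h' (toZ_injective he)⟩)
    rw [h1, Fintype.card_subtype_compl, hcard, Fintype.card_subtype_eq]
    have : 0 < p ^ (2 * n + 1) := pow_pos hp _
    omega

lemma exists_contactBasis (hp : p ≠ 2) : ∃ b : Module.Basis (ContactIdx p n) 𝒦 (ContactK 𝒦 p n),
    ∀ a, (b a).IsDK (toZ a.1) := by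
  classical
  choose v hv using fun a : ContactIdx p n =>
    exists_isDK (𝒦 := 𝒦) hp (inBox_toZ a.1) a.2
  let incl : ContactK 𝒦 p n →ₗ[𝒦] DerDP 𝒦 p n :=
    (KPrime 𝒦 p n).toSubmodule.subtype ∘ₗ
      ((⁅(⊤ : LieIdeal 𝒦 (KPrime 𝒦 p n)), (⊤ : LieIdeal 𝒦 (KPrime 𝒦 p n))⁆ :
        LieIdeal 𝒦 (KPrime 𝒦 p n)).toSubmodule).subtype
  have hincl : Function.Injective incl := fun x y h => Subtype.ext (Subtype.ext h)
  have hli : LinearIndependent 𝒦 v := by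
    have h1 : LinearIndependent 𝒦 fun a : ContactIdx p n => (basisVec a.1 : DivPow 𝒦 p n) := by
      have := (Finsupp.basisSingleOne (R := 𝒦) (ι := Idx n → Fin p)).linearIndependent
      simp only [Finsupp.coe_basisSingleOne] at this
      exact this.comp (fun a : ContactIdx p n => a.1) Subtype.val_injective
    have h2 := h1.map' DK (LinearMap.ker_eq_bot.2 (DK_injective hp))
    refine LinearIndependent.of_comp incl ?_
    have h3 : incl ∘ v = DK ∘ fun a : ContactIdx p n => (basisVec a.1 : DivPow 𝒦 p n) :=
      funext fun a => (hv a).trans (by rw [dp_toZ]; rfl)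
    rw [h3]
    exact h2
  refine ⟨Module.Basis.mk hli ?_, fun a => by rw [Module.Basis.mk_apply]; exact hv a⟩
  intro x _
  obtain ⟨f, hf, hxf⟩ := exists_DK_eq x
  set V : Submodule 𝒦 (DivPow 𝒦 p n) :=
    Submodule.span 𝒦 {g | ∃ a : ContactIdx p n, g = dp (toZ a.1)} with hV
  have hVmem : ∀ α : Idx n → ℤ, InBox p α → (p ∣ 2 * n + 4 → α ≠ fun _ => (p : ℤ) - 1) →
      (dp α : DivPow 𝒦 p n) ∈ V := by
    intro α hα hτ
    obtain ⟨a, rfl⟩ := exists_toZ hα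
    exact Submodule.subset_span ⟨⟨a, hτ⟩, rfl⟩
  have hpos := (Fact.out : p.Prime).pos
  have hbox : InBox p (fun _ : Idx n => (p : ℤ) - 1) := fun i => by
    change 0 ≤ (p : ℤ) - 1 ∧ (p : ℤ) - 1 < p
    omega
  have hfV : f ∈ V := by
    -- Modulo `V` every function equals its top coefficient times x^(τ).
    have h1 : V.mkQ = LinearMap.smulRight topCoeff (V.mkQ (dp fun _ => (p : ℤ) - 1)) := by
      refine hom_ext fun α hα => ?_
      rw [LinearMap.smulRight_apply, topCoeff_dp hα]
      split_ifs with h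
      · rw [h, one_smul]
      · rw [zero_smul]
        exact (Submodule.Quotient.mk_eq_zero V).2 (hVmem α hα fun _ => h)
    have h2 := LinearMap.congr_fun h1 f
    rw [LinearMap.smulRight_apply] at h2
    rw [← Submodule.Quotient.mk_eq_zero V]
    refine h2.trans ?_
    by_cases hpn : p ∣ 2 * n + 4
    · rw [hf hpn, zero_smul]
    · have : V.mkQ (dp fun _ => (p : ℤ) - 1) = 0 :=
        (Submodule.Quotient.mk_eq_zero V).2 (hVmem _ hbox fun h => absurd h hpn)
      rw [this, smul_zero]
  have key : ∀ g ∈ V, DK g ∈ (Submodule.span 𝒦 (Set.range v)).map incl := by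
    intro g hg
    induction hg using Submodule.span_induction with
    | mem g hg =>
      obtain ⟨a, rfl⟩ := hg
      exact ⟨v a, Submodule.subset_span ⟨a, rfl⟩, hv a⟩
    | zero => rw [map_zero]; exact zero_mem _
    | add f g _ _ hf hg => rw [map_add]; exact add_mem hf hg
    | smul c f _ hf => rw [map_smul]; exact Submodule.smul_mem _ c hf
  obtain ⟨y, hy, hyx⟩ := key f hfV
  have : y = x := hincl (hyx.trans hxf.symm)
  rwa [← this]

/-! ### Weights -/

lemma contactK_ext {x y : ContactK 𝒦 p n}
    (h : ((x : KPrime 𝒦 p n) : DerDP 𝒦 p n) = ((y : KPrime 𝒦 p n) : DerDP 𝒦 p n)) : x = y :=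
  Subtype.ext (Subtype.ext h)

lemma lie_eq_weight {k : Fin n} {h x : ContactK 𝒦 p n} (hh : h.IsDK (eps (pos k) + eps (neg k)))
    {α : Idx n → ℤ} (hα : InBox p α) (hx : x.IsDK α) :
    ⁅h, x⁆ = ((α (pos k) - α (neg k) : ℤ) : 𝒦) • x := by
  refine contactK_ext ?_
  have h1 : (dp (eps (pos k) + eps (neg k)) : DivPow 𝒦 p n) =
    DivPow.X (pos k) * DivPow.X (neg k) := dp_eps_add_eps (by simp)
  have hc : contactBracket D DivPow.X (dp (eps (pos k) + eps (neg k))) (dp α : DivPow 𝒦 p n) =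
      ((α (pos k) - α (neg k) : ℤ) : 𝒦) • dp α := by
    rw [h1, contactBracket_pair D_X, X_mul_D _ hα, X_mul_D _ hα, ← sub_smul, Int.cast_sub]
  change ⁅((h : KPrime 𝒦 p n) : DerDP 𝒦 p n), ((x : KPrime 𝒦 p n) : DerDP 𝒦 p n)⁆ =
    ((α (pos k) - α (neg k) : ℤ) : 𝒦) • ((x : KPrime 𝒦 p n) : DerDP 𝒦 p n)
  rw [hh, hx, lie_DK, hc, map_smul]

end DerivedContact

/-! ### The restricted enveloping algebra and its universal property -/

section RestrictedEnveloping

attribute [local instance] LieRing.ofAssociativeRing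

variable {𝒦 : Type*} [Field 𝒦] {p n : ℕ} [Fact p.Prime] [CharP 𝒦 p]

/-- A Lie algebra map from the contact algebra to an associative algebra which is compatible with
the `p`-th powers of the vectors `D_K (x^(α))`. -/
structure IsRestricted {B : Type*} [Ring B] [Algebra 𝒦 B] (f : ContactK 𝒦 p n →ₗ⁅𝒦⁆ B) : Prop where
  pair : ∀ (i : Fin n) (x : ContactK 𝒦 p n), x.IsDK (eps (pos i) + eps (neg i)) → f x ^ p = f x
  zero : ∀ x : ContactK 𝒦 p n, x.IsDK (eps zer) → f x ^ p = f x
  nil : ∀ α : Idx n → ℤ, InBox p α → α ≠ eps zer → (∀ i : Fin n, α ≠ eps (pos i) + eps (neg i)) →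
    ∀ x : ContactK 𝒦 p n, x.IsDK α → f x ^ p = 0

/-- The canonical map to the restricted enveloping algebra. -/
noncomputable def toU : ContactK 𝒦 p n →ₗ⁅𝒦⁆ RestrU 𝒦 p n :=
  (AlgHom.toLieHom (RingQuot.mkAlgHom 𝒦 RestrRel)).comp (UniversalEnvelopingAlgebra.ι 𝒦)

lemma toU_apply (x : ContactK 𝒦 p n) :
    toU x = RingQuot.mkAlgHom 𝒦 RestrRel (UniversalEnvelopingAlgebra.ι 𝒦 x) := rfl

lemma isRestricted_toU : IsRestricted (toU : ContactK 𝒦 p n →ₗ⁅𝒦⁆ RestrU 𝒦 p n) where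
  pair i x hx := by
    rw [toU_apply, ← map_pow]
    exact RingQuot.mkAlgHom_rel 𝒦 (RestrRel.pair i x hx)
  zero x hx := by
    rw [toU_apply, ← map_pow]
    exact RingQuot.mkAlgHom_rel 𝒦 (RestrRel.zero x hx)
  nil α hα h0 h1 x hx := by
    rw [toU_apply, ← map_pow, ← map_zero (RingQuot.mkAlgHom 𝒦 RestrRel)]
    exact RingQuot.mkAlgHom_rel 𝒦 (RestrRel.nil α hα h0 h1 x hx)

section Lift

variable {B : Type*} [Ring B] [Algebra 𝒦 B]

/-- The universal property of the restricted enveloping algebra. -/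
noncomputable def restrLift (f : ContactK 𝒦 p n →ₗ⁅𝒦⁆ B) (hf : IsRestricted f) :
    RestrU 𝒦 p n →ₐ[𝒦] B :=
  RingQuot.liftAlgHom 𝒦 ⟨UniversalEnvelopingAlgebra.lift 𝒦 f, by
    intro a b hab
    induction hab with
    | pair i x hx =>
      rw [map_pow, UniversalEnvelopingAlgebra.lift_ι_apply]
      exact hf.pair i x hx
    | zero x hx =>
      rw [map_pow, UniversalEnvelopingAlgebra.lift_ι_apply]
      exact hf.zero x hx
    | nil α hα h0 h1 x hx =>
      rw [map_pow, UniversalEnvelopingAlgebra.lift_ι_apply, map_zero]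
      exact hf.nil α hα h0 h1 x hx⟩

lemma restrLift_toU (f : ContactK 𝒦 p n →ₗ⁅𝒦⁆ B) (hf : IsRestricted f) (x : ContactK 𝒦 p n) :
    restrLift f hf (toU x) = f x := by
  rw [toU_apply, restrLift, RingQuot.liftAlgHom_mkAlgHom_apply,
    UniversalEnvelopingAlgebra.lift_ι_apply]

/-- The composition of a Lie algebra map with a homomorphism of associative algebras. -/
noncomputable def lieHomComp {C : Type*} [Ring C] [Algebra 𝒦 C] (g : B →ₐ[𝒦] C)
    (f : ContactK 𝒦 p n →ₗ⁅𝒦⁆ B) :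
    ContactK 𝒦 p n →ₗ⁅𝒦⁆ C := (AlgHom.toLieHom g).comp f

lemma IsRestricted.comp {f : ContactK 𝒦 p n →ₗ⁅𝒦⁆ B} (hf : IsRestricted f) {C : Type*} [Ring C]
    [Algebra 𝒦 C] (g : B →ₐ[𝒦] C) : IsRestricted (lieHomComp g f) where
  pair i x hx := by
    change g (f x) ^ p = g (f x)
    rw [← map_pow, hf.pair i x hx]
  zero x hx := by
    change g (f x) ^ p = g (f x)
    rw [← map_pow, hf.zero x hx]
  nil α hα h0 h1 x hx := by
    change g (f x) ^ p = 0
    rw [← map_pow, hf.nil α hα h0 h1 x hx, map_zero]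

lemma isRestricted_zero : IsRestricted (0 : ContactK 𝒦 p n →ₗ⁅𝒦⁆ B) where
  pair i x hx := by simp [(Fact.out : p.Prime).ne_zero]
  zero x hx := by simp [(Fact.out : p.Prime).ne_zero]
  nil α hα h0 h1 x hx := by simp [(Fact.out : p.Prime).ne_zero]

variable (R : Type*) [CommRing R] [Algebra R B] [Algebra 𝒦 R] [IsScalarTower 𝒦 R B]

/-- The Lie algebra map `x ↦ f x ⊗ 1 + 1 ⊗ f x`. -/
noncomputable def primitiveHom (f : ContactK 𝒦 p n →ₗ⁅𝒦⁆ B) :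
    ContactK 𝒦 p n →ₗ⁅𝒦⁆ B ⊗[R] B where
  toFun x := f x ⊗ₜ 1 + 1 ⊗ₜ f x
  map_add' x y := by
    rw [map_add, TensorProduct.add_tmul, TensorProduct.tmul_add]
    abel
  map_smul' c x := by
    rw [map_smul, RingHom.id_apply, smul_add, TensorProduct.smul_tmul', ← algebraMap_smul R c (f x),
      TensorProduct.tmul_smul, ← TensorProduct.smul_tmul', algebraMap_smul, algebraMap_smul]
  map_lie' {x y} := by
    simp only [LieHom.map_lie, Ring.lie_def, mul_add, add_mul, Algebra.TensorProduct.tmul_mul_tmul,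
      one_mul, mul_one, TensorProduct.sub_tmul, TensorProduct.tmul_sub]
    abel

lemma primitiveHom_apply (f : ContactK 𝒦 p n →ₗ⁅𝒦⁆ B) (x : ContactK 𝒦 p n) :
    primitiveHom R f x = f x ⊗ₜ 1 + 1 ⊗ₜ f x := rfl

/-- The two summands commute, so in characteristic p the p-th power is additive. Hence the coproduct
respects the restricted relations. -/
lemma primitiveHom_pow (f : ContactK 𝒦 p n →ₗ⁅𝒦⁆ B) (x : ContactK 𝒦 p n) :
    primitiveHom R f x ^ p = (f x ^ p) ⊗ₜ 1 + 1 ⊗ₜ (f x ^ p) := by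
  have hc : Commute (f x ⊗ₜ[R] (1 : B)) (1 ⊗ₜ f x) := by
    rw [Commute, SemiconjBy, Algebra.TensorProduct.tmul_mul_tmul,
      Algebra.TensorProduct.tmul_mul_tmul]
    simp
  rw [primitiveHom_apply, add_pow_prime_of_commute (natCast_eq_zero_of_algebra (𝒦 := 𝒦)) hc,
    Algebra.TensorProduct.tmul_pow, Algebra.TensorProduct.tmul_pow, one_pow]

lemma IsRestricted.primitiveHom {f : ContactK 𝒦 p n →ₗ⁅𝒦⁆ B} (hf : IsRestricted f) :
    IsRestricted (primitiveHom R f) where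
  pair i x hx := by rw [primitiveHom_pow, hf.pair i x hx, primitiveHom_apply]
  zero x hx := by rw [primitiveHom_pow, hf.zero x hx, primitiveHom_apply]
  nil α hα h0 h1 x hx := by
    rw [primitiveHom_pow, hf.nil α hα h0 h1 x hx, TensorProduct.zero_tmul, TensorProduct.tmul_zero,
      add_zero]

/-- The Lie algebra map `x ↦ - f x` to the opposite algebra. -/
noncomputable def negOpHom (f : ContactK 𝒦 p n →ₗ⁅𝒦⁆ B) : ContactK 𝒦 p n →ₗ⁅𝒦⁆ Bᵐᵒᵖ where
  toFun x := MulOpposite.op (- f x)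
  map_add' x y := by rw [map_add, neg_add, MulOpposite.op_add]
  map_smul' c x := by rw [map_smul, ← smul_neg, MulOpposite.op_smul, RingHom.id_apply]
  map_lie' {x y} := by
    rw [LieHom.map_lie, Ring.lie_def, Ring.lie_def, ← MulOpposite.op_mul, ← MulOpposite.op_mul,
      ← MulOpposite.op_sub]
    congr 1
    noncomm_ring

lemma negOpHom_apply (f : ContactK 𝒦 p n →ₗ⁅𝒦⁆ B) (x : ContactK 𝒦 p n) :
    negOpHom f x = MulOpposite.op (- f x) := rfl

lemma negOpHom_pow (hp : p ≠ 2) (f : ContactK 𝒦 p n →ₗ⁅𝒦⁆ B) (x : ContactK 𝒦 p n) :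
    negOpHom f x ^ p = MulOpposite.op (- (f x ^ p)) := by
  rw [negOpHom_apply, ← MulOpposite.op_pow,
    Odd.neg_pow ((Fact.out : p.Prime).odd_of_ne_two hp)]

lemma IsRestricted.negOpHom (hp : p ≠ 2) {f : ContactK 𝒦 p n →ₗ⁅𝒦⁆ B} (hf : IsRestricted f) :
    IsRestricted (negOpHom f) where
  pair i x hx := by rw [negOpHom_pow hp, hf.pair i x hx, negOpHom_apply]
  zero x hx := by rw [negOpHom_pow hp, hf.zero x hx, negOpHom_apply]
  nil α hα h0 h1 x hx := by
    rw [negOpHom_pow hp, hf.nil α hα h0 h1 x hx, neg_zero, MulOpposite.op_zero]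

end Lift

/-! ### The standard representation and the dimension -/

variable (𝒦 p n) in
/-- The action of the contact algebra on the divided power algebra. -/
noncomputable def stdRep : ContactK 𝒦 p n →ₗ⁅𝒦⁆ Module.End 𝒦 (DivPow 𝒦 p n) where
  toFun x := (((x : KPrime 𝒦 p n) : DerDP 𝒦 p n) : DivPow 𝒦 p n →ₗ[𝒦] DivPow 𝒦 p n)
  map_add' _ _ := rfl
  map_smul' _ _ := rfl
  map_lie' := Derivation.commutator_coe_linear_map

lemma stdRep_of_isDK {x : ContactK 𝒦 p n} {α : Idx n → ℤ} (hx : x.IsDK α) :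
    stdRep 𝒦 p n x = (DK (dp α : DivPow 𝒦 p n)).toLinearMap := by
  rw [← hx]
  rfl

lemma isRestricted_stdRep : IsRestricted (stdRep 𝒦 p n) where
  pair i x hx := by
    rw [stdRep_of_isDK hx, DK_pow_char_pair]
  zero x hx := by
    rw [stdRep_of_isDK hx, DK_pow_char_zero]
  nil α hα h0 h1 x hx := by
    rw [stdRep_of_isDK hx, DK_pow_char_nil hα h0 h1]

lemma stdRep_injective : Function.Injective (stdRep 𝒦 p n) := fun _ _ h =>
  contactK_ext (Derivation.ext fun f => LinearMap.congr_fun h f)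

/-- The standard representation is faithful on the contact algebra and, by the computed p-th powers,
factors through the restricted enveloping algebra. -/
lemma toU_injective : Function.Injective (toU : ContactK 𝒦 p n →ₗ⁅𝒦⁆ RestrU 𝒦 p n) := by
  intro x y h
  have := congrArg (restrLift _ isRestricted_stdRep) h
  rw [restrLift_toU, restrLift_toU] at this
  exact stdRep_injective this

variable (𝒦 p n) in
lemma adjoin_range_toU :
    Algebra.adjoin 𝒦 (Set.range (toU : ContactK 𝒦 p n →ₗ⁅𝒦⁆ RestrU 𝒦 p n)) = ⊤ := by
  let g : TensorAlgebra 𝒦 (ContactK 𝒦 p n) →ₐ[𝒦] RestrU 𝒦 p n :=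
    (RingQuot.mkAlgHom 𝒦 RestrRel).comp (UniversalEnvelopingAlgebra.mkAlgHom 𝒦 (ContactK 𝒦 p n))
  have hg : Function.Surjective g :=
    (RingQuot.mkAlgHom_surjective 𝒦 _).comp Quotient.mk_surjective
  have hr : Set.range (toU : ContactK 𝒦 p n →ₗ⁅𝒦⁆ RestrU 𝒦 p n) =
      g '' Set.range (TensorAlgebra.ι 𝒦) := by
    rw [← Set.range_comp]
    rfl
  rw [hr, ← AlgHom.map_adjoin, TensorAlgebra.adjoin_range_ι, Algebra.map_top,
    (AlgHom.range_eq_top g).2 hg]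

/-- The universal property supplies a coproduct with primitive generators and a counit, so the
criterion for ordered monomials applies to the image of a basis of the contact algebra. -/
lemma finrank_restrU (hp : p ≠ 2) : Module.Finite 𝒦 (RestrU 𝒦 p n) ∧
    Module.finrank 𝒦 (RestrU 𝒦 p n) = p ^ Fintype.card (ContactIdx p n) := by
  obtain ⟨b, hb⟩ := exists_contactBasis (𝒦 := 𝒦) (p := p) (n := n) hp
  let toULin : ContactK 𝒦 p n →ₗ[𝒦] RestrU 𝒦 p n := (toU : ContactK 𝒦 p n →ₗ⁅𝒦⁆ RestrU 𝒦 p n)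
  let y : Fin (Fintype.card (ContactIdx p n)) → RestrU 𝒦 p n := fun i =>
    toU (b ((Fintype.equivFin _).symm i))
  have hrange : Set.range y = toU '' Set.range b := by
    rw [← Set.range_comp]
    exact (Fintype.equivFin _).symm.surjective.range_comp (toU ∘ b)
  have hspan : ∀ x : ContactK 𝒦 p n, toU x ∈ Submodule.span 𝒦 (Set.range y) := by
    intro x
    have := Submodule.mem_map_of_mem (f := toULin)
      (b.mem_span x)
    rw [Submodule.map_span] at this
    rw [hrange]
    exact this
  have hli : LinearIndependent 𝒦 y := by
    have := b.linearIndependent.map' toULin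
      (LinearMap.ker_eq_bot.2 toU_injective)
    exact this.comp _ (Fintype.equivFin _).symm.injective
  refine finrank_eq_of_primitive_generators p
    (restrLift _ (isRestricted_toU.primitiveHom 𝒦)) (restrLift _ isRestricted_zero) y
    (fun i => restrLift_toU _ _ _) (fun i => restrLift_toU _ _ _) hli ?_ ?_ ?_
  · rw [eq_top_iff, ← adjoin_range_toU, Algebra.adjoin_le_iff]
    rintro _ ⟨x, rfl⟩
    exact Algebra.span_le_adjoin 𝒦 _ (hspan x)
  · intro i j
    have : y i * y j - y j * y i = toU ⁅b ((Fintype.equivFin _).symm i),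
        b ((Fintype.equivFin _).symm j)⁆ := (LieHom.map_lie toU _ _).symm
    rw [this]
    exact hspan _
  · intro i
    by_cases h0 : DivPow.toZ ((Fintype.equivFin (ContactIdx p n)).symm i).1 = eps zer
    · have hx := hb ((Fintype.equivFin _).symm i)
      rw [h0] at hx
      have : y i ^ p = y i := isRestricted_toU.zero _ hx
      rw [this]
      exact Submodule.subset_span ⟨i, rfl⟩
    · by_cases h1 : ∃ l : Fin n, DivPow.toZ ((Fintype.equivFin (ContactIdx p n)).symm i).1 =
          eps (pos l) + eps (neg l)
      · obtain ⟨l, hl⟩ := h1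
        have hx := hb ((Fintype.equivFin _).symm i)
        rw [hl] at hx
        have : y i ^ p = y i := isRestricted_toU.pair l _ hx
        rw [this]
        exact Submodule.subset_span ⟨i, rfl⟩
      · push Not at h1
        have : y i ^ p = 0 := isRestricted_toU.nil _ (DivPow.inBox_toZ _) h0 h1 _ (hb _)
        rw [this]
        exact zero_mem _

end RestrictedEnveloping

section InnerDerivation

attribute [local instance] LieRing.ofAssociativeRing

variable {𝒦 : Type*} [Field 𝒦] {p n : ℕ} [Fact p.Prime] [CharP 𝒦 p]
  {B : Type*} [Ring B] [Algebra 𝒦 B]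

/-! ### Divided powers of the inner derivation -/

lemma lieHom_lie (f : ContactK 𝒦 p n →ₗ⁅𝒦⁆ B) (x y : ContactK 𝒦 p n) :
    f ⁅x, y⁆ = f x * f y - f y * f x := LieHom.map_lie f x y

lemma map_iterate_lie (f : ContactK 𝒦 p n →ₗ⁅𝒦⁆ B) (e x : ContactK 𝒦 p n) (ℓ : ℕ) :
    f ((fun y => ⁅e, y⁆)^[ℓ] x) =
      ((LinearMap.mulLeft 𝒦 (f e) + LinearMap.mulRight 𝒦 (-f e)) ^ ℓ) (f x) := by
  induction ℓ with
  | zero => rfl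
  | succ ℓ ih =>
    rw [Function.iterate_succ_apply', pow_succ', Module.End.mul_apply, ← ih, LieHom.map_lie,
      Ring.lie_def,
      LinearMap.add_apply, LinearMap.mulLeft_apply, LinearMap.mulRight_apply]
    noncomm_ring

/-- Left and right multiplications commute, so the p-th power of ad e is multiplication by e^p on
the left minus that on the right. -/
lemma map_iterate_lie_prime {f : ContactK 𝒦 p n →ₗ⁅𝒦⁆ B} {e : ContactK 𝒦 p n} (he : f e ^ p = 0)
    (hp : p ≠ 2) (x : ContactK 𝒦 p n) : f ((fun y => ⁅e, y⁆)^[p] x) = 0 := by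
  rw [map_iterate_lie, add_pow_prime_of_commute (natCast_eq_zero_of_algebra (𝒦 := 𝒦))
    (LinearMap.commute_mulLeft_right _ _), LinearMap.pow_mulLeft, LinearMap.pow_mulRight,
    Odd.neg_pow ((Fact.out : p.Prime).odd_of_ne_two hp), he]
  simp

lemma lie_iterate_lie {h e x : ContactK 𝒦 p n} {w : ℤ} (he : ⁅h, e⁆ = e)
    (hx : ⁅h, x⁆ = (w : 𝒦) • x) (ℓ : ℕ) :
    ⁅h, (fun y => ⁅e, y⁆)^[ℓ] x⁆ = ((w + ℓ : ℤ) : 𝒦) • (fun y => ⁅e, y⁆)^[ℓ] x := by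
  induction ℓ with
  | zero => simpa using hx
  | succ ℓ ih =>
    rw [Function.iterate_succ_apply', leibniz_lie, ih, he, lie_smul]
    push_cast
    module

/-- Below p - 1 the recursion is the one for inverse factorials. -/
lemma dividedAd_dPow (hp : p ≠ 2) {f : ContactK 𝒦 p n →ₗ⁅𝒦⁆ B} {h e x : ContactK 𝒦 p n} {w : ℤ}
    (hep : f e ^ p = 0)
    (he : ⁅h, e⁆ = e) (hx : ⁅h, x⁆ = (w : 𝒦) • x) :
    TwistData.DividedAd p (f h) (f e) w (f x)
      (fun ℓ => f (dPow e ℓ x)) where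
  zero := by simp [dPow]
  succ ℓ hℓ := by
    have h1 : ⁅e, dPow e ℓ x⁆ = ((ℓ.factorial : 𝒦)⁻¹) • (fun y => ⁅e, y⁆)^[ℓ + 1] x := by
      rw [dPow, lie_smul, Function.iterate_succ_apply']
    rw [← Ring.lie_def, ← LieHom.map_lie, h1]
    rcases Nat.lt_or_ge (ℓ + 1) p with hlt | hge
    · have hne : ((ℓ + 1 : ℕ) : 𝒦) ≠ 0 := by
        rw [Ne, CharP.cast_eq_zero_iff 𝒦 p]
        exact fun h => absurd (Nat.le_of_dvd (Nat.succ_pos ℓ) h) (by omega)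
      have h2 : ((ℓ.factorial : 𝒦)⁻¹) = ((ℓ + 1 : ℕ) : 𝒦) * (((ℓ + 1).factorial : 𝒦)⁻¹) := by
        rw [Nat.factorial_succ, Nat.cast_mul, mul_inv, ← mul_assoc, mul_inv_cancel₀ hne, one_mul]
      rw [h2, mul_smul, map_smul, Nat.cast_smul_eq_nsmul, dPow]
    -- At ℓ = p - 1 the left side vanishes since (ad e)^p = 0, and the right side since it carries
    -- the factor p.
    · obtain rfl : p = ℓ + 1 := by omega
      rw [map_smul, map_iterate_lie_prime hep hp, smul_zero, ← Nat.cast_smul_eq_nsmul 𝒦,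
        CharP.cast_eq_zero, zero_smul]
  weight ℓ _ := by
    have h1 : ⁅h, dPow e ℓ x⁆ = ((w + ℓ : ℤ) : 𝒦) • dPow e ℓ x := by
      rw [dPow, lie_smul, lie_iterate_lie he hx, smul_comm]
    have h2 := f.map_lie h (dPow e ℓ x)
    rw [h1, map_smul, Int.cast_smul_eq_zsmul, Ring.lie_def] at h2
    rw [h2]
    abel

end InnerDerivation

/-! ### The truncated polynomial ring: characteristic, rank, and t ≠ 0 -/

section TruncPolyFacts

open scoped Polynomial

variable {𝒦 : Type*} [Field 𝒦] {p : ℕ} [Fact p.Prime] (q : 𝒦)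

lemma degree_C_mul_X_lt_prime : (Polynomial.C q * Polynomial.X : 𝒦[X]).degree < p :=
  (Polynomial.degree_C_mul_X_le q).trans_lt (by exact_mod_cast (Fact.out : p.Prime).one_lt)

lemma monic_truncPoly : (Polynomial.X ^ p - Polynomial.C q * Polynomial.X : 𝒦[X]).Monic :=
  Polynomial.monic_X_pow_sub (degree_C_mul_X_lt_prime q)

lemma natDegree_truncPoly :
    (Polynomial.X ^ p - Polynomial.C q * Polynomial.X : 𝒦[X]).natDegree = p := by
  have h : (Polynomial.X ^ p - Polynomial.C q * Polynomial.X : 𝒦[X]).degree = p := by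
    rw [Polynomial.degree_sub_eq_left_of_degree_lt, Polynomial.degree_X_pow]
    rw [Polynomial.degree_X_pow]
    exact degree_C_mul_X_lt_prime q
  exact Polynomial.natDegree_eq_of_degree_eq_some h

lemma nontrivial_truncPoly : Nontrivial (TruncPoly p q) := by
  refine AdjoinRoot.nontrivial _ fun h => ?_
  have h1 := Polynomial.natDegree_eq_of_degree_eq_some h
  rw [natDegree_truncPoly] at h1
  exact (Fact.out : p.Prime).ne_zero h1

lemma charP_truncPoly [CharP 𝒦 p] : CharP (TruncPoly p q) p :=
  haveI := nontrivial_truncPoly (p := p) q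
  charP_of_injective_algebraMap (algebraMap 𝒦 (TruncPoly p q)).injective p

lemma finite_truncPoly : Module.Finite 𝒦 (TruncPoly p q) :=
  (AdjoinRoot.powerBasis' (monic_truncPoly q)).finite

lemma finrank_truncPoly : Module.finrank 𝒦 (TruncPoly p q) = p := by
  rw [(AdjoinRoot.powerBasis' (monic_truncPoly q)).finrank, AdjoinRoot.powerBasis'_dim,
    natDegree_truncPoly]

lemma truncPoly_t_ne_zero : TruncPoly.t p q ≠ 0 := by
  intro h
  have h1 : AdjoinRoot.mk (Polynomial.X ^ p - Polynomial.C q * Polynomial.X : 𝒦[X])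
      Polynomial.X = 0 := by
    rw [AdjoinRoot.mk_X]
    exact h
  rw [AdjoinRoot.mk_eq_zero] at h1
  refine (monic_truncPoly q).not_dvd_of_natDegree_lt Polynomial.X_ne_zero ?_ h1
  rw [Polynomial.natDegree_X, natDegree_truncPoly]
  exact (Fact.out : p.Prime).one_lt

end TruncPolyFacts

/-! ### Extension of scalars to the truncated polynomial ring -/

section ScalarExtension

attribute [local instance] LieRing.ofAssociativeRing

variable {𝒦 : Type*} [Field 𝒦] {p n : ℕ} [Fact p.Prime] [CharP 𝒦 p] (q : 𝒦)

lemma finrank_restrUtq (hp : p ≠ 2) : Module.Finite 𝒦 (RestrUtq p n q) ∧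
    Module.finrank 𝒦 (RestrUtq p n q) = p ^ (Fintype.card (ContactIdx p n) + 1) := by
  obtain ⟨h1, h2⟩ := finrank_restrU (𝒦 := 𝒦) (p := p) (n := n) hp
  have := finite_truncPoly (p := p) q
  refine ⟨inferInstance, ?_⟩
  rw [Module.finrank_tensorProduct, h2, finrank_truncPoly, pow_succ']

/-- The map `toUtq` as a homomorphism of Lie algebras. -/
noncomputable def toUtqHom :=
  lieHomComp (Algebra.TensorProduct.includeRight : RestrU 𝒦 p n →ₐ[𝒦] RestrUtq p n q) toU

lemma isRestricted_toUtqHom : IsRestricted (toUtqHom (p := p) (n := n) q) :=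
  isRestricted_toU.comp _

lemma toUtq_smul (c : 𝒦) (x : ContactK 𝒦 p n) : toUtq q (c • x) = c • toUtq q x :=
  map_smul (toUtqHom q) c x

/-- The universal property of the scalar extension of the restricted enveloping algebra. -/
noncomputable def utqLift {B : Type*} [Ring B] [Algebra 𝒦 B] [Algebra (TruncPoly p q) B]
    [IsScalarTower 𝒦 (TruncPoly p q) B] (f : ContactK 𝒦 p n →ₗ⁅𝒦⁆ B) (hf : IsRestricted f) :
    RestrUtq p n q →ₐ[TruncPoly p q] B :=
  Algebra.TensorProduct.lift (Algebra.ofId (TruncPoly p q) B) (restrLift f hf) fun r a =>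
    Algebra.commute_algebraMap_left r (restrLift f hf a)

lemma utqLift_toUtq {B : Type*} [Ring B] [Algebra 𝒦 B] [Algebra (TruncPoly p q) B]
    [IsScalarTower 𝒦 (TruncPoly p q) B] (f : ContactK 𝒦 p n →ₗ⁅𝒦⁆ B) (hf : IsRestricted f)
    (x : ContactK 𝒦 p n) : utqLift q f hf (toUtq q x) = f x := by
  refine (Algebra.TensorProduct.lift_tmul _ _ _ 1 (toU x)).trans ?_
  rw [map_one, one_mul, restrLift_toU]

lemma eq_top_of_toUtq_mem (S : Subalgebra (TruncPoly p q) (RestrUtq p n q))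
    (hS : ∀ x, toUtq q x ∈ S) : S = ⊤ := by
  have h1 : (⊤ : Subalgebra 𝒦 (RestrU 𝒦 p n)) ≤
      (S.restrictScalars 𝒦).comap Algebra.TensorProduct.includeRight := by
    rw [← adjoin_range_toU, Algebra.adjoin_le_iff]
    rintro _ ⟨x, rfl⟩
    exact hS x
  rw [eq_top_iff]
  intro a _
  induction a using TensorProduct.induction_on with
  | zero => exact zero_mem S
  | tmul r a =>
    have h2 : (1 : TruncPoly p q) ⊗ₜ[𝒦] a ∈ S := h1 (Algebra.mem_top (x := a))
    have h3 := S.smul_mem h2 r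
    rwa [TensorProduct.smul_tmul', smul_eq_mul, mul_one] at h3
  | add a b ha hb => exact add_mem (ha trivial) (hb trivial)

/-- These generators are weight vectors for every ad h, as needed for checking the twisted axioms.
-/
lemma adjoin_toUtq_eq_top (hp : p ≠ 2) : Algebra.adjoin (TruncPoly p q)
    {a : RestrUtq p n q | ∃ (α : Idx n → ℤ) (x : ContactK 𝒦 p n),
      InBox p α ∧ x.IsDK α ∧ a = toUtq q x} = ⊤ := by
  obtain ⟨b, hb⟩ := exists_contactBasis (𝒦 := 𝒦) (p := p) (n := n) hp
  refine eq_top_of_toUtq_mem q _ fun x => ?_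
  have hx := b.mem_span x
  induction hx using Submodule.span_induction with
  | mem x hx =>
    obtain ⟨a, rfl⟩ := hx
    exact Algebra.subset_adjoin ⟨_, _, inBox_toZ a.1, hb a, rfl⟩
  | zero =>
    have : toUtq q (0 : ContactK 𝒦 p n) = 0 := map_zero (toUtqHom q)
    rw [this]
    exact zero_mem _
  | add x y _ _ hx hy =>
    have : toUtq q (x + y) = toUtq q x + toUtq q y := map_add (toUtqHom q) x y
    rw [this]
    exact add_mem hx hy
  | smul c x _ hx =>
    rw [toUtq_smul, ← algebraMap_smul (TruncPoly p q) c (toUtq q x)]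
    exact Subalgebra.smul_mem _ hx _

variable {q}

/-! ### Matrix coefficients of the standard representation -/

variable (q) in
/-- The matrix coefficient `a ↦ l (a f)` of the standard representation. -/
noncomputable def matCoeff (f : DivPow 𝒦 p n) (l : DivPow 𝒦 p n →ₗ[𝒦] 𝒦) :
    RestrUtq p n q →ₗ[TruncPoly p q] TruncPoly p q :=
  (TensorProduct.AlgebraTensorModule.rid 𝒦 (TruncPoly p q) (TruncPoly p q)).toLinearMap ∘ₗ
    LinearMap.baseChange (TruncPoly p q) (l ∘ₗ LinearMap.applyₗ f ∘ₗ
      (restrLift (stdRep 𝒦 p n) isRestricted_stdRep).toLinearMap)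

lemma matCoeff_toUtq (f : DivPow 𝒦 p n) (l : DivPow 𝒦 p n →ₗ[𝒦] 𝒦) (x : ContactK 𝒦 p n) :
    matCoeff q f l (toUtq q x) = l (stdRep 𝒦 p n x f) • 1 := by
  have := restrLift_toU (stdRep 𝒦 p n) isRestricted_stdRep x
  rw [← this]
  rfl

/-- The annihilator of `f` is a left ideal. With x = e this supplies the functional that detects
noncocommutativity. -/
lemma matCoeff_mul_toUtq {f : DivPow 𝒦 p n} (l : DivPow 𝒦 p n →ₗ[𝒦] 𝒦) {x : ContactK 𝒦 p n}
    (hx : stdRep 𝒦 p n x f = 0) (a : RestrUtq p n q) : matCoeff q f l (a * toUtq q x) = 0 := by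
  induction a using TensorProduct.induction_on with
  | zero => rw [zero_mul, map_zero]
  | tmul r a =>
    have h1 : (r ⊗ₜ[𝒦] a : RestrUtq p n q) * toUtq q x = r ⊗ₜ (a * toU x) := by
      rw [toUtq, Algebra.TensorProduct.tmul_mul_tmul, mul_one]
      rfl
    have h2 : (restrLift (stdRep 𝒦 p n) isRestricted_stdRep (a * toU x)) f = 0 := by
      rw [map_mul, restrLift_toU, Module.End.mul_apply, hx, map_zero]
    rw [h1]
    change l ((restrLift (stdRep 𝒦 p n) isRestricted_stdRep (a * toU x)) f) • r = 0
    rw [h2, map_zero, zero_smul]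
  | add a b ha hb => rw [add_mul, map_add, ha, hb, add_zero]

end ScalarExtension

/-! ### Failure of cocommutativity -/

section Noncocommutative

variable {R A : Type*} [CommRing R] [Ring A] [Algebra R A] {p : ℕ} [Fact p.Prime] [CharP R p]
  {h e : A} {t : R} {T T' : Aˣ}

namespace TwistData

lemma comulHom_self (D : TwistData p h e t T T') {Δ : A →ₐ[R] A ⊗[R] A}
    (hΔ : Δ h = h ⊗ₜ 1 + 1 ⊗ₜ h) :
    D.comulHom Δ h = h ⊗ₜ 1 + 1 ⊗ₜ h + h ⊗ₜ (t • (((T⁻¹ : Aˣ) : A) * e)) := by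
  -- From [e, h] = -e and [e, e] = 0 the divided powers of ad e on h stop after ℓ = 1.
  let d : ℕ → A := fun ℓ => if ℓ = 0 then h else if ℓ = 1 then -e else 0
  have hd : DividedAd p h e 0 h d := by
    refine ⟨rfl, fun ℓ _ => ?_, fun ℓ _ => ?_⟩
    · rcases ℓ with _ | _ | ℓ
      · simp [d, D.lie]
      · simp [d]
      · simp [d]
    · rcases ℓ with _ | _ | ℓ
      · simp [d]
      · simp [d, D.lie, add_comm]
      · simp [d]
  obtain ⟨r, hr⟩ : ∃ r, p = r + 2 := ⟨p - 2, by have := (Fact.out : p.Prime).two_le; omega⟩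
  rw [D.comulHom_formula hd hΔ, hr, Finset.sum_range_succ', Finset.sum_range_succ',
    Finset.sum_eq_zero fun ℓ _ => by simp [d]]
  simp only [d, rising, neg_one_mul, pow_one, pow_zero, zpow_zero, zero_add, if_true, one_ne_zero,
    if_false, Nat.cast_zero, Nat.cast_one, neg_zero, one_mul, one_smul, mul_one, add_zero, zpow_neg,
    zpow_one, Units.val_one, mul_neg, TensorProduct.tmul_neg, TensorProduct.tmul_smul, neg_smul,
    smul_neg, neg_neg]
  abel

/-- A linear functional which separates `h` from the left ideal of `e` detects that the twisted
comultiplication is not cocommutative. -/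
lemma not_comm_comulHom (D : TwistData p h e t T T') {Δ : A →ₐ[R] A ⊗[R] A}
    (hΔ : Δ h = h ⊗ₜ 1 + 1 ⊗ₜ h) (he : t • e ≠ 0) (φ : A →ₗ[R] R) (hφh : φ h = 1)
    (hφe : ∀ a, φ (a * e) = 0) :
    TensorProduct.comm R A A (D.comulHom Δ h) ≠ D.comulHom Δ h := by
  intro hcomm
  rw [D.comulHom_self hΔ, map_add, map_add] at hcomm
  simp only [TensorProduct.comm_tmul] at hcomm
  rw [add_comm ((1 : A) ⊗ₜ[R] h) (h ⊗ₜ[R] 1), add_right_inj] at hcomm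
  -- Cocommutativity would make h ⊗ t T⁻¹ e symmetric. The functional `φ` on the first leg sends it
  -- to t T⁻¹ e and its flip to 0.
  have h1 := congrArg ((TensorProduct.lid R A) ∘ (φ.rTensor A)) hcomm
  simp only [Function.comp_apply, LinearMap.rTensor_tmul, TensorProduct.lid_tmul, map_smul, hφe,
    hφh, one_smul, smul_zero, zero_smul] at h1
  refine he ?_
  have h2 : t • e = (T : A) * (t • (((T⁻¹ : Aˣ) : A) * e)) := by
    rw [mul_smul_comm, Units.mul_inv_cancel_left]
  rw [h2, ← h1, mul_zero]

end TwistData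

end Noncocommutative

/-! ### Construction of the twisted Hopf algebra -/

section TwistExistence

attribute [local instance] LieRing.ofAssociativeRing

variable {𝒦 : Type*} [Field 𝒦] {p n : ℕ} [Fact p.Prime] [CharP 𝒦 p]
  {B : Type*} [Ring B] [Algebra 𝒦 B] {R : Type*} [CommRing R] [Algebra R B]

omit [CharP 𝒦 p] in
lemma inBox_root {k : Fin n} {m : Fin n ⊕ Fin n} (hkm : m ≠ Sum.inl k) :
    InBox p (eps (pos k) + eps (some m)) :=
  inBox_eps_add_eps (by simpa using hkm.symm)

lemma lie_eq_self {k : Fin n} {m : Fin n ⊕ Fin n} (hkm : m ≠ Sum.inl k ∧ m ≠ Sum.inr k)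
    {h e : ContactK 𝒦 p n} (hh : h.IsDK (eps (pos k) + eps (neg k)))
    (he : e.IsDK (eps (pos k) + eps (some m))) : ⁅h, e⁆ = e := by
  rw [lie_eq_weight hh (inBox_root hkm.1) he]
  have h1 : (some (Sum.inl k) : Idx n) ≠ some m := fun h => hkm.1 (Option.some.inj h).symm
  have h2 : (some (Sum.inr k) : Idx n) ≠ some m := fun h => hkm.2 (Option.some.inj h).symm
  simp [eps, h1, h2]

lemma IsRestricted.pow_root_eq_zero {f : ContactK 𝒦 p n →ₗ⁅𝒦⁆ B} (hf : IsRestricted f)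
    {k : Fin n} {m : Fin n ⊕ Fin n} (hkm : m ≠ Sum.inl k ∧ m ≠ Sum.inr k)
    {e : ContactK 𝒦 p n} (he : e.IsDK (eps (pos k) + eps (some m))) : f e ^ p = 0 := by
  have h1 : (some (Sum.inl k) : Idx n) ≠ some m := fun h => hkm.1 (Option.some.inj h).symm
  refine hf.nil _ (inBox_root hkm.1) (fun h => ?_) (fun i h => ?_) e he
  · have := congrFun h (pos k)
    simp [eps, h1] at this
  · have h3 := congrFun h (pos k)
    have h4 := congrFun h (some m)
    by_cases hi : i = k
    · subst hi
      simp [eps, h1.symm, hkm.2] at h4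
    · simp [eps, h1, Ne.symm hi] at h3

/-- In characteristic p, (1 + se)^p = 1 + s^p e^p = 1, which makes both elements units. -/
lemma exists_twistData [CharP R p] (t : R) {h e : B} (hh : h ^ p = h) (hlie : h * e = e * h + e)
    (he : e ^ p = 0) : ∃ T T' : Bˣ, TwistData p h e t T T' := by
  have hB : (p : B) = 0 := by rw [← map_natCast (algebraMap R B), CharP.cast_eq_zero, map_zero]
  have key : ∀ s : R, ((1 : B) + s • e) ^ p = 1 := fun s => by
    rw [add_pow_prime_of_commute hB (Commute.one_left _), one_pow, smul_pow, he, smul_zero,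
      add_zero]
  have hp := (Fact.out : p.Prime).ne_zero
  have hT : (1 - t • e) ^ p = 1 := by
    have := key (-t)
    rwa [neg_smul, ← sub_eq_add_neg] at this
  exact ⟨Units.ofPowEqOne _ p hT hp, Units.ofPowEqOne _ p (key t) hp, hh, hlie, rfl, rfl,
    Units.pow_ofPowEqOne hT hp, Units.pow_ofPowEqOne (key t) hp⟩

/-- The twisted Hopf algebra structure. -/
theorem exists_twisted_hopfAlgebra [CharP R p] (hp : p ≠ 2) (t : R)
    (f : ContactK 𝒦 p n →ₗ⁅𝒦⁆ B) (hf : IsRestricted f)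
    (hgen : Algebra.adjoin R {a : B | ∃ (α : Idx n → ℤ) (x : ContactK 𝒦 p n),
      InBox p α ∧ x.IsDK α ∧ a = f x} = ⊤)
    (Δ : B →ₐ[R] B ⊗[R] B) (hΔ : ∀ x, Δ (f x) = f x ⊗ₜ 1 + 1 ⊗ₜ f x)
    (ε : B →ₐ[R] R) (hε : ∀ x, ε (f x) = 0)
    (S : B →ₐ[R] Bᵐᵒᵖ) (hS : ∀ x, S (f x) = MulOpposite.op (- f x))
    {k : Fin n} {m : Fin n ⊕ Fin n} (hkm : m ≠ Sum.inl k ∧ m ≠ Sum.inr k)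
    {h e : ContactK 𝒦 p n} (hh : h.IsDK (eps (pos k) + eps (neg k)))
    (he : e.IsDK (eps (pos k) + eps (some m))) (hte : t • f e ≠ 0)
    (φ : B →ₗ[R] R) (hφh : φ (f h) = 1) (hφe : ∀ a, φ (a * f e) = 0) :
    ∃ T : Bˣ, (T : B) = 1 - t • f e ∧ ∃ H : HopfAlgebra R B,
      H.toAlgebra = (inferInstance : Algebra R B) ∧
      (∀ α : Idx n → ℤ, InBox p α → (p ∣ 2 * n + 4 → α ≠ fun _ => (p : ℤ) - 1) →
        ∃ x : ContactK 𝒦 p n, x.IsDK α ∧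
          TwistFormulas p t (f h) T (α (pos k) - α (neg k)) (f x) (fun ℓ => f (dPow e ℓ x))) ∧
      NoncommNoncocomm R B := by
  have hhe := lie_eq_self hkm hh he
  have hep := hf.pow_root_eq_zero hkm he
  have hcomm : f h * f e = f e * f h + f e := by
    rw [← sub_eq_iff_eq_add', ← lieHom_lie, hhe]
  obtain ⟨T, T', D⟩ := exists_twistData t (hf.pair k h hh) hcomm hep
  have hweight : ∀ (α : Idx n → ℤ) (x : ContactK 𝒦 p n), InBox p α → x.IsDK α →
      TwistData.DividedAd p (f h) (f e) (α (pos k) - α (neg k)) (f x) fun ℓ => f (dPow e ℓ x) :=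
    fun α x hα hx => dividedAd_dPow hp hep hhe (lie_eq_weight hh hα hx)
  let H : HopfAlgebra R B := D.hopfAlgebra hp (hΔ h) (hΔ e) (hε h) (hε e) (hS h) (hS e) _ hgen
    (by rintro _ ⟨α, x, -, -, rfl⟩; exact hΔ x) (by rintro _ ⟨α, x, -, -, rfl⟩; exact hε x)
    (by rintro _ ⟨α, x, -, -, rfl⟩; exact hS x) (by
      rintro _ ⟨α, x, hα, hx, rfl⟩
      have := (hweight α x hα hx).weight 0 (Fact.out : p.Prime).pos
      rw [(hweight α x hα hx).zero, Nat.cast_zero, add_zero] at this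
      exact ⟨_, this⟩)
  refine ⟨T, D.T_eq, H, rfl, fun α hα hτ => ?_, fun hc => ?_, fun hc => ?_⟩
  · obtain ⟨x, hx⟩ := exists_isDK (𝒦 := 𝒦) hp hα hτ
    exact ⟨x, hx, D.comulHom_formula (hweight α x hα hx) (hΔ x),
      D.antipodeHom_formula (hweight α x hα hx) (hS x), hε x⟩
  · refine hte ?_
    -- If f h and f e commuted, the relation he = eh + e would force this.
    have h1 : f e = 0 := by simpa [hc (f h) (f e)] using hcomm
    rw [h1, smul_zero]
  · exact D.not_comm_comulHom (hΔ h) hte φ hφh hφe (LinearMap.congr_fun hc.comm_comp_comul (f h))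

end TwistExistence

/-! ### The action of h and e on coordinate functions -/

section MatrixCoefficients

variable {𝒦 : Type*} [Field 𝒦] {p n : ℕ} [Fact p.Prime] [CharP 𝒦 p]

lemma exists_isDK_eps_add_eps (hp : p ≠ 2) {i j : Fin n ⊕ Fin n} (hij : i ≠ j) :
    ∃ x : ContactK 𝒦 p n, x.IsDK (eps (some i) + eps (some j)) := by
  refine exists_isDK hp (inBox_eps_add_eps (by simpa using hij)) fun _ h => ?_
  have h1 := congrFun h zer
  have := (Fact.out : p.Prime).two_le
  simp [eps] at h1
  omega

lemma stdRep_apply_X {x : ContactK 𝒦 p n} {i j : Idx n} (hij : i ≠ j)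
    (hx : x.IsDK (eps i + eps j)) (l : Idx n) : stdRep 𝒦 p n x (DivPow.X l) =
      contactCoef D DivPow.X (DivPow.X i * DivPow.X j) l := by
  rw [stdRep_of_isDK hx, dp_eps_add_eps hij]
  exact DK_apply_X _ l

omit [CharP 𝒦 p] in
lemma exists_coordinate (j : Idx n) : ∃ l : DivPow 𝒦 p n →ₗ[𝒦] 𝒦, l (DivPow.X j) = 1 :=
  -- Any functional with value 1 at this basis vector will do; this one is 1 on the whole basis.
  ⟨lift fun _ => 1, lift_dp _ (inBox_eps j)⟩

variable {k : Fin n} {m : Fin n ⊕ Fin n} {x : ContactK 𝒦 p n}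

/-- The vector x_k is fixed by h and killed by e, so a matrix coefficient at x_k separates h from
the left ideal of e. -/
lemma stdRep_pair_X (hx : x.IsDK (eps (pos k) + eps (neg k))) :
    stdRep 𝒦 p n x (DivPow.X (pos k)) = DivPow.X (pos k) := by
  rw [stdRep_apply_X (by simp) hx]
  change DivPow.X (pos k) * D zer (DivPow.X (pos k) * DivPow.X (neg k)) +
    D (neg k) (DivPow.X (pos k) * DivPow.X (neg k)) = DivPow.X (pos k)
  simp [Derivation.leibniz, D_X]

lemma stdRep_root_X_pos (hkm : m ≠ Sum.inl k ∧ m ≠ Sum.inr k)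
    (hx : x.IsDK (eps (pos k) + eps (some m))) : stdRep 𝒦 p n x (DivPow.X (pos k)) = 0 := by
  rw [stdRep_apply_X (by simpa using hkm.1.symm) hx]
  change DivPow.X (pos k) * D zer (DivPow.X (pos k) * DivPow.X (some m)) +
    D (neg k) (DivPow.X (pos k) * DivPow.X (some m)) = 0
  simp [Derivation.leibniz, D_X, hkm.2.symm]

lemma stdRep_root_X_neg (hkm : m ≠ Sum.inl k ∧ m ≠ Sum.inr k)
    (hx : x.IsDK (eps (pos k) + eps (some m))) :
    stdRep 𝒦 p n x (DivPow.X (neg k)) = -DivPow.X (some m) := by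
  rw [stdRep_apply_X (by simpa using hkm.1.symm) hx]
  change DivPow.X (neg k) * D zer (DivPow.X (pos k) * DivPow.X (some m)) -
    D (pos k) (DivPow.X (pos k) * DivPow.X (some m)) = -DivPow.X (some m)
  simp [Derivation.leibniz, D_X, hkm.1.symm]

end MatrixCoefficients

theorem mainTheorem6 {𝒦 : Type*} [Field 𝒦] (p : ℕ) [Fact p.Prime] [CharP 𝒦 p] (hp : p ≠ 2)
    (q : 𝒦) (n : ℕ) (hn : 2 ≤ n) (k : Fin n) (m : Fin n ⊕ Fin n)
    (hkm : m ≠ Sum.inl k ∧ m ≠ Sum.inr k) :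
    (∃ h e : ContactK 𝒦 p n,
      h.IsDK (eps (pos k) + eps (neg k)) ∧ e.IsDK (eps (pos k) + eps (some m)) ∧
      ∃ T : (RestrUtq p n q)ˣ, (T : RestrUtq p n q) = 1 - TruncPoly.t p q • toUtq q e ∧
      ∃ H : HopfAlgebra (TruncPoly p q) (RestrUtq p n q),
        H.toAlgebra = (inferInstance : Algebra (TruncPoly p q) (RestrUtq p n q)) ∧
        (∀ α : Idx n → ℤ, InBox p α → (p ∣ 2 * n + 4 → α ≠ fun _ => (p : ℤ) - 1) →
          ∃ x : ContactK 𝒦 p n, x.IsDK α ∧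
            TwistFormulas p (TruncPoly.t p q) (toUtq q h) T (α (pos k) - α (neg k)) (toUtq q x)
              (fun ℓ => toUtq q (dPow e ℓ x))) ∧
        NoncommNoncocomm (TruncPoly p q) (RestrUtq p n q)) ∧
    Module.Finite 𝒦 (RestrUtq p n q) ∧
    (¬ p ∣ 2 * n + 4 → Module.finrank 𝒦 (RestrUtq p n q) = p ^ (p ^ (2 * n + 1) + 1)) ∧
    (p ∣ 2 * n + 4 → Module.finrank 𝒦 (RestrUtq p n q) = p ^ p ^ (2 * n + 1)) := by
  obtain ⟨hfin, hrank⟩ := finrank_restrUtq (n := n) q hp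
  refine ⟨?_, hfin, fun h => ?_, fun h => ?_⟩
  swap
  · rw [hrank, card_contactIdx.1 h]
  swap
  -- The factor p contributed by t compensates for the missing basis vector at τ.
  · rw [hrank, card_contactIdx.2 h]
  have := charP_truncPoly (p := p) q
  obtain ⟨h, hh⟩ := exists_isDK_eps_add_eps (𝒦 := 𝒦) hp (i := Sum.inl k) (j := Sum.inr k) (by simp)
  obtain ⟨e, he⟩ := exists_isDK_eps_add_eps (𝒦 := 𝒦) hp hkm.1.symm
  obtain ⟨l, hl⟩ := exists_coordinate (𝒦 := 𝒦) (p := p) (pos k)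
  obtain ⟨l', hl'⟩ := exists_coordinate (𝒦 := 𝒦) (p := p) (some m)
  have hf := isRestricted_toUtqHom (p := p) (n := n) q
  -- Since e sends x_(-k) to -x_m, a matrix coefficient of te at x_(-k) equals -t, which is nonzero.
  have hte : TruncPoly.t p q • toUtq q e ≠ 0 := by
    intro h0
    have h1 := congrArg (matCoeff q (DivPow.X (neg k)) l') h0
    rw [map_smul, map_zero, matCoeff_toUtq, stdRep_root_X_neg hkm he, map_neg, hl', neg_smul,
      one_smul, smul_neg, smul_eq_mul, mul_one, neg_eq_zero] at h1
    exact truncPoly_t_ne_zero q h1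
  refine ⟨h, e, hh, he, exists_twisted_hopfAlgebra hp (TruncPoly.t p q) (toUtqHom q) hf
    (adjoin_toUtq_eq_top q hp)
    (utqLift q _ (hf.primitiveHom (TruncPoly p q))) (utqLift_toUtq q _ _)
    (utqLift q 0 isRestricted_zero) (utqLift_toUtq q _ _)
    (utqLift q _ (hf.negOpHom hp)) (utqLift_toUtq q _ _) hkm hh he hte
    (matCoeff q (DivPow.X (pos k)) l) ?_ ?_⟩
  · have := matCoeff_toUtq (q := q) (DivPow.X (pos k)) l h
    rwa [stdRep_pair_X hh, hl, one_smul] at this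
  · exact matCoeff_mul_toUtq l (stdRep_root_X_pos hkm he)
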